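/- Let $k$ be a field, let $Q$ be a finite quiver, let $Z$ be a set of paths of length $\ge 2$ in $Q$, and suppose that the monomial algebra $A=kQ/\langle Z\rangle$ is finite-dimensional. Paths are composed from right to left, $s$ and $t$ denote the starting and ending vertex, two paths are parallel, written $p\|q$, if they have the same start and the same end, and $\mathcal B_A$ is the set of paths of $Q$ that have no subpath in $Z$; it gives a basis of $A$. Let $\alpha:e_1\to e_2$ be a source arrow ($e_1$ is a source, no other arrow starts at $e_1$ and no other arrow ends at $e_2$) and $\beta:e_{n-1}\to e_n$ a sink arrow ($e_n$ is a sink, no other arrow starts at $e_{n-1}$ and no other arrow ends at $e_n$), where $e_1,e_2,e_{n-1},e_n$ are pairwise different. Let $B$ be the algebra obtained from $A$ by gluing $\alpha$ and $\beta$: the subalgebra of $A$ generated by $f_1=e_1+e_{n-1}$, $f_2=e_2+e_n$, the other vertices, $\gamma^*=\alpha+\beta$ and the other arrows. It is isomorphic, by the evident map, to $kQ_B/\langle Z_B\rangle$, where $Q_B$ is obtained from $Q$ by identifying $\alpha$ with $\beta$ (hence $e_1$ with $e_{n-1}$ and $e_2$ with $e_n$), $p\mapsto p^*$ denotes the induced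 map on paths, and $Z_B$ consists of the $z^*$ with $z\in Z$ and of the newly formed paths of length 2 through $f_1$ or $f_2$ and of length 3 through $\gamma^*$. Let $\mathcal B_B$ be the set of paths of $Q_B$ that have no subpath in $Z_B$. For $X\in\{A,B\}$, let $k((Q_X)_0\|\mathcal B_X)$ and $k((Q_X)_1\|\mathcal B_X)$ be the vector spaces with bases the pairs $e\|p$ and $a\|p$ of a vertex $e$, respectively an arrow $a$, and a path $p\in\mathcal B_X$ parallel to it, and let $$\delta^0_X:k((Q_X)_0\|\mathcal B_X)\to k((Q_X)_1\|\mathcal B_X),\qquad e\|p\mapsto\sum_{s(a)=e,\ ap\in\mathcal B_X}a\|ap-\sum_{t(a)=e,\ pa\in\mathcal B_X}a\|pa .$$ Let $\psi_1:k((Q_A)_1\|\mathcal B_A)\to k((Q_B)_1\|\mathcal B_B)$ be the linear map $a\|p\mapsto a^*\|p^*$. Let $Z_{sp}(\alpha,\beta)$ be the span of the elements $\delta^0_B(f_1\|p^*)\neq 0$, where $p\in\mathcal B_A$ is a path of length $\ge1$ from $e_1$ to $e_{n-1}$ or from $e_{n-1}$ to $e_1$, and of the elements $\delta^0_B(f_2\|q^*)\neq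 0$, where $q\in\mathcal B_A$ is a path of length $\ge1$ from $e_2$ to $e_n$ or from $e_n$ to $e_2$. An element $y=\sum y_{a\|p}\,a\|p$ of $k((Q_B)_1\|\mathcal B_B)$ corresponds to the derivation of $B$ that kills the vertices and sends each arrow $a$ to $\sum_p y_{a\|p}\,p$, whenever this derivation exists (that is, when $y$ is a cocycle), and so to a class in $\mathrm{HH}^1(B)=\mathrm{Der}_k(B)/\mathrm{Inn}(B)$, a Lie algebra under the commutator bracket. Then the following hold. (1) The sum $Y:=\psi_1(\mathrm{Im}\,\delta^0_A)\oplus Z_{sp}(\alpha,\beta)$ is direct, $\mathrm{Im}\,\delta^0_B\subseteq Y$, every element of $Y$ corresponds to a derivation of $B$, this derivation is inner exactly for the elements of $\mathrm{Im}\,\delta^0_B$, the subspace $I:=Y/\mathrm{Im}\,\delta^0_B$ of $\mathrm{HH}^1(B)$ is a Lie ideal, and $$\mathrm{HH}^1(A)\cong\mathrm{HH}^1(B)/I\quad\text{as Lie algebras.}$$ (2) If $\alpha$ and $\beta$ lie in the same block of $A$, then $I$ is one-dimensional and spanned by the class of $\gamma^*\|\gamma^*$, so that $\mathrm{HH}^1(A)\cong\mathrm{HH}^1(B)/\langle\gamma^*\|\gamma^*\rangle$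 as Lie algebras. (3) If $\alpha$ and $\beta$ lie in different blocks of $A$, then $I=0$ and $\mathrm{HH}^1(A)\cong\mathrm{HH}^1(B)$ as Lie algebras. -/

import Mathlib

noncomputable section

namespace GluingArrows

/-! ### Quivers, paths and the path algebra -/

/-- A quiver with vertex set `V` and arrow set `E`; `src` and `tgt` are the maps `s` and `t`. -/
structure Qvr (V E : Type*) where
  src : E → V
  tgt : E → V

namespace Qvr

variable {V E : Type*} (Q : Qvr V E)

/-- `Q.IsWalk v [a₁, …, aₙ]`: the arrows `a₁, …, aₙ` can be travelled in this order, from `v`. -/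
def IsWalk : V → List E → Prop
  | _, [] => True
  | v, a :: l => Q.src a = v ∧ IsWalk (Q.tgt a) l

/-- The vertex reached from `v` by travelling along the arrows of the list. -/
def walkEnd : V → List E → V
  | v, [] => v
  | _, a :: l => walkEnd (Q.tgt a) l

/-- A path of `Q`: a starting vertex and the list `[a₁, …, aₙ]` of its arrows in the order in which
they are travelled. It is the path written `aₙ ⋯ a₁`. The empty lists give the trivial paths. -/
@[ext]
structure Path where
  start : V
  arrows : List E
  isWalk : Q.IsWalk start arrows

variable {Q}

theorem isWalk_append {v : V} {l m : List E} :
    Q.IsWalk v (l ++ m) ↔ Q.IsWalk v l ∧ Q.IsWalk (Q.walkEnd v l) m := by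
  induction l generalizing v with
  | nil => simp [IsWalk, walkEnd]
  | cons a l ih => simp [IsWalk, walkEnd, ih, and_assoc]

theorem walkEnd_append {v : V} {l m : List E} :
    Q.walkEnd v (l ++ m) = Q.walkEnd (Q.walkEnd v l) m := by
  induction l generalizing v with
  | nil => rfl
  | cons a l ih => simp [walkEnd, ih]

namespace Path

/-- The ending vertex `t(p)` of a path; its starting vertex `s(p)` is `p.start`. -/
def target (p : Q.Path) : V := Q.walkEnd p.start p.arrows

/-- The length of a path. -/
def length (p : Q.Path) : ℕ := p.arrows.length

/-- The trivial path at a vertex. -/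
def trivial (Q : Qvr V E) (v : V) : Q.Path := ⟨v, [], by simp [IsWalk]⟩

/-- An arrow as a path of length one. -/
def ofArrow (Q : Qvr V E) (a : E) : Q.Path := ⟨Q.src a, [a], by simp [IsWalk]⟩

/-- The path `p q`: first `q`, then `p`. -/
def comp (p q : Q.Path) (h : q.target = p.start) : Q.Path :=
  ⟨q.start, q.arrows ++ p.arrows, isWalk_append.2 ⟨q.isWalk, by
    change Q.IsWalk q.target p.arrows
    rw [h]
    exact p.isWalk⟩⟩

theorem target_comp (p q : Q.Path) (h : q.target = p.start) :
    (p.comp q h).target = p.target := by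
  change Q.walkEnd q.start (q.arrows ++ p.arrows) = _
  rw [walkEnd_append]
  change Q.walkEnd q.target p.arrows = _
  rw [h]
  rfl

end Path

end Qvr

/-- The path algebra `kQ`: the vector space with basis the paths of `Q`. -/
def PathAlg (k : Type*) [Field k] {V E : Type*} (Q : Qvr V E) : Type _ := Q.Path →₀ k

namespace PathAlg

variable {k : Type*} [Field k] {V E : Type*} {Q : Qvr V E}

instance : AddCommGroup (PathAlg k Q) := inferInstanceAs (AddCommGroup (Q.Path →₀ k))

instance : Module k (PathAlg k Q) := inferInstanceAs (Module k (Q.Path →₀ k))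

variable (k) in
/-- A path as an element of `kQ`. -/
def of (p : Q.Path) : PathAlg k Q := Finsupp.single p (1 : k)

variable (k Q) in
/-- The coefficients of an element of `kQ` in the basis of paths. -/
def coeffs : PathAlg k Q ≃ₗ[k] (Q.Path →₀ k) := LinearEquiv.refl k (Q.Path →₀ k)

theorem coeffs_of (p : Q.Path) : coeffs k Q (of k p) = Finsupp.single p 1 := rfl

@[elab_as_elim]
theorem induction {P : PathAlg k Q → Prop} (x : PathAlg k Q) (h0 : P 0)
    (hadd : ∀ x y, P x → P y → P (x + y)) (hof : ∀ (c : k) p, P (c • of k p)) : P x := by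
  refine Finsupp.induction_linear (motive := P) x h0 hadd fun p c => ?_
  have : (Finsupp.single p c : Q.Path →₀ k) = c • Finsupp.single p 1 := by simp
  rw [this]
  exact hof c p

variable [DecidableEq V]

variable (k) in
/-- The product of two paths: their composite `p q` if `t(q) = s(p)`, and `0` otherwise. -/
def pathMul (p q : Q.Path) : PathAlg k Q :=
  if h : q.target = p.start then of k (p.comp q h) else 0

variable (k Q) in
/-- The bilinear extension of the product of paths. -/
def mulLin : PathAlg k Q →ₗ[k] PathAlg k Q →ₗ[k] PathAlg k Q :=
  (Finsupp.linearCombination k fun p : Q.Path =>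
    Finsupp.linearCombination k (pathMul k p) ∘ₗ (coeffs k Q).toLinearMap) ∘ₗ
      (coeffs k Q).toLinearMap

theorem mulLin_of (p q : Q.Path) : mulLin k Q (of k p) (of k q) = pathMul k p q := by
  simp [mulLin, coeffs_of]

theorem pathMul_assoc (p q r : Q.Path) :
    mulLin k Q (pathMul k p q) (of k r) = mulLin k Q (of k p) (pathMul k q r) := by
  unfold pathMul
  by_cases h1 : q.target = p.start <;> by_cases h2 : r.target = q.start
  · rw [dif_pos h1, dif_pos h2, mulLin_of, mulLin_of, pathMul, pathMul,
      dif_pos (show r.target = (p.comp q h1).start from h2),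
      dif_pos (show (q.comp r h2).target = p.start from (q.target_comp r h2).trans h1)]
    congr 1
    ext1
    · rfl
    · simp [Qvr.Path.comp]
  · rw [dif_pos h1, dif_neg h2, mulLin_of, pathMul,
      dif_neg (show ¬ r.target = (p.comp q h1).start from h2)]
    simp
  · rw [dif_neg h1, dif_pos h2, mulLin_of, pathMul,
      dif_neg (show ¬ (q.comp r h2).target = p.start from fun h =>
        h1 ((q.target_comp r h2).symm.trans h))]
    simp
  · rw [dif_neg h1, dif_neg h2]
    simp

theorem mulLin_assoc (x y z : PathAlg k Q) :
    mulLin k Q (mulLin k Q x y) z = mulLin k Q x (mulLin k Q y z) := by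
  induction x using induction with
  | h0 => simp
  | hadd x x' hx hx' => simp [hx, hx']
  | hof c p =>
    induction y using induction with
    | h0 => simp
    | hadd y y' hy hy' => simp only [map_add, LinearMap.add_apply, hy, hy']
    | hof d q =>
      induction z using induction with
      | h0 => simp
      | hadd z z' hz hz' => simp only [map_add, hz, hz']
      | hof e r =>
        simp only [map_smul, LinearMap.smul_apply, mulLin_of, pathMul_assoc]

variable [Fintype V]

variable (k Q) in
/-- The identity of `kQ`: the sum of the trivial paths. -/
def unit : PathAlg k Q := ∑ v : V, of k (Qvr.Path.trivial Q v)

theorem unit_mulLin (x : PathAlg k Q) : mulLin k Q (unit k Q) x = x := by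
  induction x using induction with
  | h0 => simp
  | hadd x y hx hy => rw [map_add, hx, hy]
  | hof c p =>
    rw [map_smul, unit, map_sum, LinearMap.sum_apply, Finset.sum_eq_single p.target]
    · rw [mulLin_of, pathMul, dif_pos (show p.target = (Qvr.Path.trivial Q p.target).start from rfl)]
      congr 2
      ext1
      · rfl
      · simp [Qvr.Path.comp, Qvr.Path.trivial]
    · intro v _ hv
      rw [mulLin_of, pathMul,
        dif_neg (show ¬ p.target = (Qvr.Path.trivial Q v).start from fun h => hv h.symm)]
    · simp

theorem mulLin_unit (x : PathAlg k Q) : mulLin k Q x (unit k Q) = x := by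
  induction x using induction with
  | h0 => simp
  | hadd x y hx hy => rw [map_add, LinearMap.add_apply, hx, hy]
  | hof c p =>
    rw [map_smul, LinearMap.smul_apply, unit, map_sum, Finset.sum_eq_single p.start]
    · rw [mulLin_of, pathMul, dif_pos (show (Qvr.Path.trivial Q p.start).target = p.start from rfl)]
      congr 2
    · intro v _ hv
      rw [mulLin_of, pathMul,
        dif_neg (show ¬ (Qvr.Path.trivial Q v).target = p.start from hv)]
    · simp

instance : Ring (PathAlg k Q) :=
  { (inferInstance : AddCommGroup (PathAlg k Q)) with
    mul := fun x y => mulLin k Q x y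
    one := unit k Q
    mul_assoc := mulLin_assoc
    one_mul := unit_mulLin
    mul_one := mulLin_unit
    left_distrib := fun x y z => map_add (mulLin k Q x) y z
    right_distrib := fun x y z => by
      change mulLin k Q (x + y) z = mulLin k Q x z + mulLin k Q y z
      simp
    zero_mul := fun x => by
      change mulLin k Q 0 x = 0
      simp
    mul_zero := fun x => map_zero (mulLin k Q x) }

instance : Algebra k (PathAlg k Q) :=
  Algebra.ofModule
    (fun c x y => by
      change mulLin k Q (c • x) y = c • mulLin k Q x y
      simp)
    (fun c x y => map_smul (mulLin k Q x) c y)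

end PathAlg

/-! ### Monomial algebras -/

section MonAlg

variable (k : Type*) [Field k] {V E : Type*} [Fintype V] [DecidableEq V]

/-- The two-sided ideal of `kQ` generated by a set `Z` of paths. -/
def relIdeal (Q : Qvr V E) (Z : Set Q.Path) : TwoSidedIdeal (PathAlg k Q) :=
  TwoSidedIdeal.span (PathAlg.of k '' Z)

/-- The algebra `kQ/I`, where `I` is the two-sided ideal generated by a set `Z` of paths. -/
def MonAlg (Q : Qvr V E) (Z : Set Q.Path) : Type _ := (relIdeal k Q Z).ringCon.Quotient

variable {Q : Qvr V E} (Z : Set Q.Path)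

instance : Ring (MonAlg k Q Z) := inferInstanceAs (Ring (relIdeal k Q Z).ringCon.Quotient)

instance : Algebra k (MonAlg k Q Z) :=
  inferInstanceAs (Algebra k (relIdeal k Q Z).ringCon.Quotient)

/-- The projection `kQ → kQ/I`. -/
def MonAlg.proj : PathAlg k Q →ₐ[k] MonAlg k Q Z := 
  RingCon.mkₐ k (relIdeal k Q Z).ringCon

/-- The class of a path in `kQ/I`. -/
def MonAlg.path (p : Q.Path) : MonAlg k Q Z := MonAlg.proj k Z (PathAlg.of k p)

/-- The idempotent of `kQ/I` given by a vertex. -/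
def MonAlg.vertex (v : V) : MonAlg k Q Z := MonAlg.path k Z (Qvr.Path.trivial Q v)

/-- The class of an arrow in `kQ/I`. -/
def MonAlg.arrow (a : E) : MonAlg k Q Z := MonAlg.path k Z (Qvr.Path.ofArrow Q a)

end MonAlg

/-! ### The first Hochschild cohomology -/

section HH1

attribute [local instance 100] LieRing.ofAssociativeRing

variable (k : Type*) [Field k] (R : Type*) [Ring R] [Algebra k R]

/-- The Lie algebra of `k`-linear derivations of an associative algebra `R` (the Hochschild
1-cocycles) under the commutator bracket `[D, D'] = D ∘ D' - D' ∘ D`. -/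
def derivations : LieSubalgebra k (Module.End k R) where
  carrier := {D | ∀ a b, D (a * b) = D a * b + a * D b}
  add_mem' := by
    intro D D' h h' a b
    simp only [LinearMap.add_apply, h a b, h' a b]
    noncomm_ring
  zero_mem' := by
    intro a b
    simp
  smul_mem' := by
    intro c D h a b
    simp [h a b, smul_add]
  lie_mem' := by
    intro D D' h h' a b
    change ∀ a b, D (a * b) = D a * b + a * D b at h
    change ∀ a b, D' (a * b) = D' a * b + a * D' b at h'
    change ⁅D, D'⁆ (a * b) = ⁅D, D'⁆ a * b + a * ⁅D, D'⁆ b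
    simp only [LieRing.of_associative_ring_bracket, LinearMap.sub_apply, Module.End.mul_apply,
      h, h', map_add]
    noncomm_ring

/-- Derivations of `R`, as a Lie algebra. -/
abbrev Der : Type _ := ↥(derivations k R)

/-- The Lie ideal of inner derivations `a ↦ x a - a x` (the Hochschild 1-coboundaries). -/
def innerDer : LieIdeal k (Der k R) where
  carrier := {D | ∃ x : R, ∀ a, D.1 a = x * a - a * x}
  add_mem' := by
    rintro D D' ⟨x, hx⟩ ⟨y, hy⟩
    refine ⟨x + y, fun a => ?_⟩
    change D.1 a + D'.1 a = _
    rw [hx, hy]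
    noncomm_ring
  zero_mem' := ⟨0, fun a => by simp⟩
  smul_mem' := by
    rintro c D ⟨x, hx⟩
    refine ⟨c • x, fun a => ?_⟩
    change c • D.1 a = _
    rw [hx, smul_sub, smul_mul_assoc, mul_smul_comm]
  lie_mem := by
    rintro D D' ⟨x, hx⟩
    refine ⟨D.1 x, fun a => ?_⟩
    change D.1 (D'.1 a) - D'.1 (D.1 a) = _
    have h := D.2
    rw [hx, hx, map_sub, h x a, h a x]
    noncomm_ring

/-- The first Hochschild cohomology `HH¹(R) = Der(R) / Inn(R)`. -/
def HH1 : Type _ := Der k R ⧸ innerDer k R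

instance : LieRing (HH1 k R) := inferInstanceAs (LieRing (Der k R ⧸ innerDer k R))

instance : LieAlgebra k (HH1 k R) := inferInstanceAs (LieAlgebra k (Der k R ⧸ innerDer k R))

/-- The class in `HH¹(R)` of a derivation. -/
def HH1.mk : Der k R →ₗ⁅k⁆ HH1 k R :=
  { (LieSubmodule.Quotient.mk' (innerDer k R) : Der k R →ₗ[k] Der k R ⧸ innerDer k R) with
    map_lie' := rfl }

end HH1

/-! ### Parallel paths and the map `δ⁰` -/

namespace Qvr

variable {V E : Type*} (Q : Qvr V E)

/-- The set `𝓑` of the paths that have no subpath in `Z` (for a set `Z` of paths of positive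
length). -/
def basisPaths (Z : Set Q.Path) : Set Q.Path := {p | ∀ z ∈ Z, ¬ z.arrows <:+: p.arrows}

/-- The set `Q₀ ‖ 𝓑` of the parallel pairs `e ‖ p` of a vertex `e` and a path `p ∈ 𝓑`. -/
def VertexPar (Z : Set Q.Path) : Type _ :=
  {x : V × Q.Path // x.2 ∈ Q.basisPaths Z ∧ x.2.start = x.1 ∧ x.2.target = x.1}

/-- The set `Q₁ ‖ 𝓑` of the parallel pairs `a ‖ p` of an arrow `a` and a path `p ∈ 𝓑`. -/
def ArrowPar (Z : Set Q.Path) : Type _ :=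
  {x : E × Q.Path // x.2 ∈ Q.basisPaths Z ∧ x.2.start = Q.src x.1 ∧ x.2.target = Q.tgt x.1}

end Qvr

section Delta

variable (k : Type*) [Field k] {V E : Type*} {Q : Qvr V E} (Z : Set Q.Path)

open Classical in
/-- The basis element `e ‖ p` of `k(Q₀ ‖ 𝓑)`, read as `0` if `e ‖ p` is not in `Q₀ ‖ 𝓑`. -/
def vertexPar (e : V) (p : Q.Path) : Q.VertexPar Z →₀ k :=
  if h : p ∈ Q.basisPaths Z ∧ p.start = e ∧ p.target = e then Finsupp.single ⟨(e, p), h⟩ 1 else 0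

open Classical in
/-- The basis element `a ‖ p` of `k(Q₁ ‖ 𝓑)`, read as `0` if `a ‖ p` is not in `Q₁ ‖ 𝓑`. -/
def arrowPar (a : E) (p : Q.Path) : Q.ArrowPar Z →₀ k :=
  if h : p ∈ Q.basisPaths Z ∧ p.start = Q.src a ∧ p.target = Q.tgt a then
    Finsupp.single ⟨(a, p), h⟩ 1 else 0

variable [DecidableEq V] [Fintype E]

/-- The map `δ⁰ : k(Q₀ ‖ 𝓑) → k(Q₁ ‖ 𝓑)`,
`e ‖ p ↦ ∑_{s(a) = e, a p ∈ 𝓑} a ‖ a p - ∑_{t(a) = e, p a ∈ 𝓑} a ‖ p a`. -/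
def delta0 : (Q.VertexPar Z →₀ k) →ₗ[k] (Q.ArrowPar Z →₀ k) :=
  Finsupp.linearCombination k fun x =>
    (∑ a : E, if h : x.1.2.target = Q.src a then
        arrowPar k Z a ((Qvr.Path.ofArrow Q a).comp x.1.2 h) else 0) -
      ∑ a : E, if h : Q.tgt a = x.1.2.start then
        arrowPar k Z a (x.1.2.comp (Qvr.Path.ofArrow Q a) h) else 0

variable [Fintype V]

/-- The derivation `D` of `kQ/I` is the one that corresponds to `y ∈ k(Q₁ ‖ 𝓑)` in the
description of `HH¹(kQ/I)` by parallel paths: it kills the vertices, and it sends an arrow `a` to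
`∑ y(a ‖ p) p`, the sum over the `p ∈ 𝓑` parallel to `a`. There is at most one such `D`. -/
def Realizes (y : Q.ArrowPar Z →₀ k) (D : Der k (MonAlg k Q Z)) : Prop :=
  (∀ v : V, D.1 (MonAlg.vertex k Z v) = 0) ∧
    ∀ a : E, open Classical in D.1 (MonAlg.arrow k Z a) =
      y.sum fun x c => if x.1.1 = a then c • MonAlg.path k Z x.1.2 else 0

end Delta

/-! ### Blocks -/

/-- A block idempotent of a ring: a primitive central idempotent. -/
def IsBlockIdempotent {R : Type*} [Ring R] (c : R) : Prop :=
  c ∈ Subring.center R ∧ IsIdempotentElem c ∧ c ≠ 0 ∧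
    ∀ d ∈ Subring.center R, IsIdempotentElem d → d * c = d → d = 0 ∨ d = c

/-- The elements `x` and `y` of `R` lie in one and the same block `c R` of `R`. -/
def InSameBlock {R : Type*} [Ring R] (x y : R) : Prop :=
  ∃ c : R, IsBlockIdempotent c ∧ c * x = x ∧ c * y = y

/-! ### Gluing two arrows -/

namespace Qvr

variable {V E : Type*} (Q : Qvr V E)

/-- `a` is a source arrow: `s(a)` is a source, no other arrow starts at `s(a)`, and no other arrow
ends at `t(a)`. -/
def IsSourceArrow (a : E) : Prop :=
  (∀ b, Q.tgt b ≠ Q.src a) ∧ (∀ b, Q.src b = Q.src a → b = a) ∧ ∀ b, Q.tgt b = Q.tgt a → b = a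

/-- `a` is a sink arrow: `t(a)` is a sink, no other arrow starts at `s(a)`, and no other arrow
ends at `t(a)`. -/
def IsSinkArrow (a : E) : Prop :=
  (∀ b, Q.src b ≠ Q.tgt a) ∧ (∀ b, Q.src b = Q.src a → b = a) ∧ ∀ b, Q.tgt b = Q.tgt a → b = a

/-- Two arrows `α : e₁ → e₂` and `β : e₃ → e₄` whose four vertices are pairwise different. -/
structure GluePair where
  α : E
  β : E
  nodup : [Q.src α, Q.tgt α, Q.src β, Q.tgt β].Nodup

namespace GluePair

variable {Q} (g : Q.GluePair)

theorem nodup' : (Q.src g.α ≠ Q.tgt g.α ∧ Q.src g.α ≠ Q.src g.β ∧ Q.src g.α ≠ Q.tgt g.β) ∧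
    (Q.tgt g.α ≠ Q.src g.β ∧ Q.tgt g.α ≠ Q.tgt g.β) ∧ Q.src g.β ≠ Q.tgt g.β := by
  have h := g.nodup
  simp only [List.nodup_cons, List.mem_cons, List.not_mem_nil, or_false, not_or,
    not_false_eq_true, List.nodup_nil, and_true] at h
  exact h

/-- The vertices of the glued quiver: `s(β)` and `t(β)` are identified with `s(α)` and `t(α)`,
which represent the glued vertices `f₁` and `f₂`. -/
abbrev Vert : Type _ := {v : V // v ≠ Q.src g.β ∧ v ≠ Q.tgt g.β}

/-- The arrows of the glued quiver: `β` is identified with `α`, which represents the glued arrow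
`γ*`. -/
abbrev Arr : Type _ := {a : E // a ≠ g.β}

/-- The glued vertex `f₁`. -/
def f₁ : g.Vert := ⟨Q.src g.α, g.nodup'.1.2.1, g.nodup'.1.2.2⟩

/-- The glued vertex `f₂`. -/
def f₂ : g.Vert := ⟨Q.tgt g.α, g.nodup'.2.1.1, g.nodup'.2.1.2⟩

/-- The glued arrow `γ*`. -/
def γ : g.Arr := ⟨g.α, fun h => g.nodup'.1.2.1 (congrArg Q.src h)⟩

variable [DecidableEq V]

/-- The identification of vertices. -/
def mapV (v : V) : g.Vert :=
  if h₁ : v = Q.src g.β then g.f₁ else if h₂ : v = Q.tgt g.β then g.f₂ else ⟨v, h₁, h₂⟩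

/-- The glued quiver. -/
def quiver : Qvr g.Vert g.Arr where
  src a := g.mapV (Q.src a.1)
  tgt a := g.mapV (Q.tgt a.1)

variable [DecidableEq E]

/-- The identification of arrows, `a ↦ a*`. -/
def mapE (a : E) : g.Arr := if h : a = g.β then g.γ else ⟨a, h⟩

theorem src_mapE (a : E) : g.quiver.src (g.mapE a) = g.mapV (Q.src a) := by
  have h := g.nodup'
  by_cases ha : a = g.β
  · subst ha
    simp [mapE, quiver, mapV, γ, f₁, h.1.2.1, h.1.2.2]
  · simp [mapE, quiver, ha]

theorem tgt_mapE (a : E) : g.quiver.tgt (g.mapE a) = g.mapV (Q.tgt a) := by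
  have h := g.nodup'
  by_cases ha : a = g.β
  · subst ha
    simp [mapE, quiver, mapV, γ, f₂, h.2.1.1, h.2.1.2, h.2.2.symm]
  · simp [mapE, quiver, ha]

theorem isWalk_map {v : V} {l : List E} (h : Q.IsWalk v l) :
    g.quiver.IsWalk (g.mapV v) (l.map g.mapE) := by
  induction l generalizing v with
  | nil => simp [IsWalk]
  | cons a l ih =>
    obtain ⟨h₁, h₂⟩ := h
    refine ⟨by rw [src_mapE, h₁], ?_⟩
    rw [tgt_mapE]
    exact ih h₂

/-- The path `p*` of the glued quiver that is the image of a path `p`. -/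
def mapPath (p : Q.Path) : g.quiver.Path :=
  ⟨g.mapV p.start, p.arrows.map g.mapE, g.isWalk_map p.isWalk⟩

/-- For `(x, y) = (α, β)` or `(β, α)`, the newly formed paths of the glued quiver that pass from an
arrow attached to `x` to an arrow attached to `y`: the paths `λ* η*` and `ξ* μ*` of length two
through `f₁` and `f₂`, and the paths `ξ* γ* η*` of length three. Here `t(η) = s(x)`,
`t(μ) = t(x)`, `μ ≠ x`, `s(λ) = s(y)`, `λ ≠ y`, `s(ξ) = t(y)`. -/
def newPathsOf (x y : E) : Set g.quiver.Path :=
  {p | (∃ η l, Q.tgt η = Q.src x ∧ Q.src l = Q.src y ∧ l ≠ y ∧ p.arrows = [g.mapE η, g.mapE l]) ∨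
    (∃ μ ξ, Q.tgt μ = Q.tgt x ∧ μ ≠ x ∧ Q.src ξ = Q.tgt y ∧ p.arrows = [g.mapE μ, g.mapE ξ]) ∨
    ∃ η ξ, Q.tgt η = Q.src x ∧ Q.src ξ = Q.tgt y ∧ p.arrows = [g.mapE η, g.γ, g.mapE ξ]}

/-- The set `Z_new` of all newly formed paths of length two through `f₁` or `f₂` and of length
three through `γ*`. -/
def newPaths : Set g.quiver.Path := g.newPathsOf g.α g.β ∪ g.newPathsOf g.β g.α

/-- The relations `Z ∪ Z_new` of the algebra obtained from `kQ/⟨Z⟩` by gluing `α` and `β`. -/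
def relations (Z : Set Q.Path) : Set g.quiver.Path := g.mapPath '' Z ∪ g.newPaths

end GluePair

end Qvr

section Glue

variable (k : Type*) [Field k] {V E : Type*} [Fintype V] [DecidableEq V] [Fintype E]
  [DecidableEq E] {Q : Qvr V E} (g : Q.GluePair) (Z : Set Q.Path)

/-- The algebra `B = k Q_B / I_B` obtained from `A = kQ/⟨Z⟩` by gluing `α` and `β`. -/
abbrev GluedAlg : Type _ := MonAlg k g.quiver (g.relations Z)

/-- The element `∑ v`, over the vertices `v` in the class `f`, of `A`: these elements are
`e₁ + e₃` (for `f₁`), `e₂ + e₄` (for `f₂`) and the other vertices of `Q`. -/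
def vertexSum (f : g.Vert) : MonAlg k Q Z := ∑ v : V with g.mapV v = f, MonAlg.vertex k Z v

/-- The element `∑ a`, over the arrows `a` in the class `b`, of `A`: these elements are `α + β`
(for `γ*`) and the other arrows of `Q`. -/
def arrowSum (b : g.Arr) : MonAlg k Q Z := ∑ a : E with g.mapE a = b, MonAlg.arrow k Z a

/-- The subalgebra of `A` generated by `e₁ + e₃`, `e₂ + e₄`, the other vertices, `α + β`, and the
other arrows. -/
def gluedSubalgebra : Subalgebra k (MonAlg k Q Z) :=
  Algebra.adjoin k (Set.range (vertexSum k g Z) ∪ Set.range (arrowSum k g Z))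

/-- The map `ψ₁ : k(Q₁ ‖ 𝓑_A) → k((Q_B)₁ ‖ 𝓑_B)`, `a ‖ p ↦ a* ‖ p*`. -/
def psi1 : (Q.ArrowPar Z →₀ k) →ₗ[k] (g.quiver.ArrowPar (g.relations Z) →₀ k) :=
  Finsupp.linearCombination k fun x =>
    arrowPar k (g.relations Z) (g.mapE x.1.1) (g.mapPath x.1.2)

/-- The element `δ⁰_B(f ‖ p*)`. -/
def deltaStar (f : g.Vert) (p : Q.Path) : g.quiver.ArrowPar (g.relations Z) →₀ k :=
  delta0 k (g.relations Z) (vertexPar k (g.relations Z) f (g.mapPath p))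

/-- The special paths between `u` and `v`, two vertices of `Q` in the class `f`: the paths
`p ∈ 𝓑_A` of positive length from `u` to `v` or from `v` to `u` with `δ⁰_B(f ‖ p*) ≠ 0`. -/
def specialPaths (u v : V) (f : g.Vert) : Set Q.Path :=
  {p | p ∈ Q.basisPaths Z ∧ 1 ≤ p.length ∧
    ((p.start = u ∧ p.target = v) ∨ (p.start = v ∧ p.target = u)) ∧ deltaStar k g Z f p ≠ 0}

/-- The subspace `Z_sp(α, β)` of `Im δ⁰_B`, spanned by the `δ⁰_B(f₁ ‖ p*)` with `p` a special path
between `s(α)` and `s(β)` and the `δ⁰_B(f₂ ‖ q*)` with `q` a special path between `t(α)` and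
`t(β)`. -/
def Zsp : Submodule k (g.quiver.ArrowPar (g.relations Z) →₀ k) :=
  Submodule.span k
    (deltaStar k g Z g.f₁ '' specialPaths k g Z (Q.src g.α) (Q.src g.β) g.f₁ ∪
      deltaStar k g Z g.f₂ '' specialPaths k g Z (Q.tgt g.α) (Q.tgt g.β) g.f₂)

/-- `ψ₁(Im δ⁰_A)`. -/
def psiIm : Submodule k (g.quiver.ArrowPar (g.relations Z) →₀ k) :=
  (LinearMap.range (delta0 k Z)).map (psi1 k g Z)

/-- `Im δ⁰_B`. -/
def imB : Submodule k (g.quiver.ArrowPar (g.relations Z) →₀ k) :=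
  LinearMap.range (delta0 k (g.relations Z))

/-- `Y = ψ₁(Im δ⁰_A) + Z_sp(α, β)`. -/
def Ysub : Submodule k (g.quiver.ArrowPar (g.relations Z) →₀ k) := psiIm k g Z ⊔ Zsp k g Z

/-- `γ* ‖ γ*`. -/
def gammaPar : g.quiver.ArrowPar (g.relations Z) →₀ k :=
  arrowPar k (g.relations Z) g.γ (Qvr.Path.ofArrow g.quiver g.γ)

end Glue

end GluingArrows

end

open GluingArrows

set_option linter.unusedSectionVars false

noncomputable section

namespace GluingArrows

/-! ### Path algebras and representations of quivers in rings -/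

namespace PathAlg

variable {k : Type*} [Field k] {V E : Type*} {Q : Qvr V E} [DecidableEq V] [Fintype V]

/-! The algebra `B` is embedded in `A` by `embed`, which sends a vertex or an arrow to the sum of
its preimages. Modulo inner derivations, a derivation of a monomial algebra kills the vertices; it
is then given by an element of `k(Q₁ ‖ 𝓑)`, and it is inner exactly for the elements of `Im δ⁰`
(`exists_sub_adDer_vertex_eq_zero`, `exists_realizes`, `Realizes.mk_eq_zero_iff`).

The two cohomologies are compared through derivations that vanish on the glued arrows. As α is a
source arrow and β a sink arrow, each is the only path parallel to itself. A derivation of `A` that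
kills the vertices therefore acts on α and β by scalars, and multiples of `ad e₁` and `ad eₙ` remove
these. What remains preserves `B` (`exists_restrict_of_eq_zero`). Conversely, a derivation of `B`
that kills the vertices and γ* extends to `A` (`exists_extend`). The pairs of a derivation and its
restriction form one Lie algebra `restrictPairs`, which maps onto `HH¹(A)` and, modulo `I`, onto
`HH¹(B)`: every `γ* ‖ p` lies in `Y` (`single_mem_Ysub`). Both maps have the same kernel
(`mk_eq_zero_iff_of_restrict`): restriction corresponds to ψ₁, the sum defining `Y` is direct, and
the kernel of ψ₁ consists of coboundaries.

As for the ideal, ψ₁ carries `δ⁰_A` to `δ⁰_B` except at e₁ and eₙ, where it produces `±γ* ‖ γ*`.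
Hence `Y = Im δ⁰_B + k (γ* ‖ γ*)` (`Ysub_eq`), and `I` is spanned by one class. That derivation is
the restriction of `ad (eₙ - e₁)`, so it commutes with everything that extends to a derivation of
`A` killing the vertices; its class is central (`lie_mk_gammaDer`) and `I` is an ideal. If α and β
lie in different blocks, adding a central idempotent to `eₙ - e₁` gives an element of `B`, and the
class vanishes. If the derivation is inner, the vertex coefficients of an inducing element jump by
one along γ* only, which yields a function on the vertices of `Q` that separates the blocks of α and
β. -/

theorem of_mul_of (p q : Q.Path) : of k p * of k q = pathMul k p q := mulLin_of p q

theorem one_eq_sum : (1 : PathAlg k Q) = ∑ v : V, of k (Qvr.Path.trivial Q v) := rfl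

theorem span_range_of : Submodule.span k (Set.range (of k : Q.Path → PathAlg k Q)) = ⊤ := by
  refine eq_top_iff.2 fun x _ => ?_
  induction x using induction with
  | h0 => exact zero_mem _
  | hadd x y hx hy => exact add_mem (hx trivial) (hy trivial)
  | hof c p => exact Submodule.smul_mem _ _ (Submodule.subset_span ⟨p, rfl⟩)

theorem linearMap_ext {M : Type*} [AddCommMonoid M] [Module k M] {f g : PathAlg k Q →ₗ[k] M}
    (h : ∀ p, f (of k p) = g (of k p)) : f = g :=
  LinearMap.ext_on_range span_range_of h

end PathAlg

/-- A representation of a quiver `Q` in a ring `R`: a complete family of orthogonal idempotents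
indexed by the vertices, and an element `x a ∈ e_{t(a)} R e_{s(a)}` for every arrow `a`. -/
structure Rep {V E : Type*} [DecidableEq V] [Fintype V] (Q : Qvr V E) (R : Type*) [Ring R] where
  e : V → R
  x : E → R
  e_mul_e : ∀ v w, e v * e w = if v = w then e v else 0
  sum_e : ∑ v, e v = 1
  e_mul_x : ∀ a, e (Q.tgt a) * x a = x a
  x_mul_e : ∀ a, x a * e (Q.src a) = x a

namespace Rep

variable {k : Type*} [Field k] {V E : Type*} [DecidableEq V] [Fintype V] {Q : Qvr V E}
  {R : Type*} [Ring R] [Algebra k R] (ρ : Rep Q R)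

/-- The product of the elements of `R` attached to the arrows of a walk from `v`. -/
def walkVal : V → List E → R
  | v, [] => ρ.e v
  | _, a :: l => walkVal (Q.tgt a) l * ρ.x a

theorem walkVal_mul_e {v : V} {l : List E} (h : Q.IsWalk v l) :
    ρ.walkVal v l * ρ.e v = ρ.walkVal v l := by
  cases l with
  | nil => simp [walkVal, ρ.e_mul_e]
  | cons a l => rw [walkVal, mul_assoc, ← h.1, ρ.x_mul_e]

theorem e_mul_walkVal (v : V) (l : List E) :
    ρ.e (Q.walkEnd v l) * ρ.walkVal v l = ρ.walkVal v l := by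
  induction l generalizing v with
  | nil => simp [walkVal, Qvr.walkEnd, ρ.e_mul_e]
  | cons a l ih => rw [walkVal, ← mul_assoc, Qvr.walkEnd, ih]

theorem walkVal_append {v : V} {l m : List E} (h : Q.IsWalk v (l ++ m)) :
    ρ.walkVal v (l ++ m) = ρ.walkVal (Q.walkEnd v l) m * ρ.walkVal v l := by
  induction l generalizing v with
  | nil => exact (ρ.walkVal_mul_e h).symm
  | cons a l ih =>
    rw [List.cons_append, walkVal, ih h.2, walkVal, mul_assoc]
    rfl

/-- The element of `R` attached to a path. -/
def val (p : Q.Path) : R := ρ.walkVal p.start p.arrows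

theorem val_comp (p q : Q.Path) (h : q.target = p.start) :
    ρ.val (p.comp q h) = ρ.val p * ρ.val q := by
  refine (ρ.walkVal_append (p.comp q h).isWalk).trans ?_
  rw [val, val, ← h]
  rfl

theorem val_mul_val_of_ne (p q : Q.Path) (h : q.target ≠ p.start) : ρ.val p * ρ.val q = 0 := by
  rw [val, val, ← ρ.walkVal_mul_e p.isWalk, ← ρ.e_mul_walkVal q.start, mul_assoc,
    ← mul_assoc (ρ.e _), ρ.e_mul_e, if_neg (show ¬p.start = Q.walkEnd q.start q.arrows from Ne.symm h), zero_mul, mul_zero]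

variable (k) in
/-- The linear map on `kQ` that sends a path to its value. -/
def liftLin : PathAlg k Q →ₗ[k] R :=
  Finsupp.linearCombination k ρ.val ∘ₗ (PathAlg.coeffs k Q).toLinearMap

theorem liftLin_of (p : Q.Path) : ρ.liftLin k (PathAlg.of k p) = ρ.val p := by
  simp [liftLin, PathAlg.coeffs_of]

theorem val_trivial (v : V) : ρ.val (Qvr.Path.trivial Q v) = ρ.e v := rfl

theorem val_ofArrow (a : E) : ρ.val (Qvr.Path.ofArrow Q a) = ρ.x a := ρ.e_mul_x a

variable (k) in
/-- The universal property of the path algebra. -/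
def lift : PathAlg k Q →ₐ[k] R :=
  AlgHom.ofLinearMap (ρ.liftLin k)
    (by simp [PathAlg.one_eq_sum, map_sum, liftLin_of, val_trivial, ρ.sum_e])
    (by
      intro x y
      induction x using PathAlg.induction with
      | h0 => simp
      | hadd x x' hx hx' => simp only [add_mul, map_add, hx, hx']
      | hof c p =>
        induction y using PathAlg.induction with
        | h0 => simp
        | hadd y y' hy hy' => simp only [mul_add, map_add, hy, hy']
        | hof d q =>
          rw [smul_mul_smul_comm, map_smul, map_smul, map_smul, smul_mul_smul_comm,
            PathAlg.of_mul_of, liftLin_of, liftLin_of, PathAlg.pathMul]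
          split_ifs with h
          · rw [liftLin_of, ρ.val_comp]
          · rw [ρ.val_mul_val_of_ne p q h, map_zero])

theorem lift_of (p : Q.Path) : ρ.lift k (PathAlg.of k p) = ρ.val p := ρ.liftLin_of p

end Rep

namespace PathAlg

variable {k : Type*} [Field k] {V E : Type*} [DecidableEq V] [Fintype V] {Q : Qvr V E}

theorem of_comp (p q : Q.Path) (h : q.target = p.start) :
    of k (p.comp q h) = of k p * of k q := by
  rw [of_mul_of, pathMul, dif_pos h]

theorem of_trivial_mul_of (v : V) (p : Q.Path) :
    of k (Qvr.Path.trivial Q v) * of k p = if p.target = v then of k p else 0 := by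
  rw [of_mul_of, pathMul]
  change (if h : p.target = v then _ else _) = _
  split_ifs with h
  · congr 1
    ext1
    · rfl
    · simp [Qvr.Path.comp, Qvr.Path.trivial]
  · rfl

theorem of_mul_of_trivial (p : Q.Path) (v : V) :
    of k p * of k (Qvr.Path.trivial Q v) = if p.start = v then of k p else 0 := by
  rw [of_mul_of, pathMul]
  change (if h : v = p.start then _ else _) = _
  by_cases h : v = p.start
  · rw [dif_pos h, if_pos h.symm]
    subst h
    rfl
  · rw [dif_neg h, if_neg (Ne.symm h)]

theorem of_cons (v : V) (a : E) (l : List E) (h : Q.IsWalk v (a :: l)) :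
    of k (⟨v, a :: l, h⟩ : Q.Path) =
      of k ⟨Q.tgt a, l, h.2⟩ * of k (Qvr.Path.ofArrow Q a) := by
  refine Eq.trans ?_ (of_comp ⟨Q.tgt a, l, h.2⟩ (Qvr.Path.ofArrow Q a) rfl)
  congr 1
  ext1
  · exact h.1.symm
  · rfl

theorem algHom_ext {R : Type*} [Ring R] [Algebra k R] {f f' : PathAlg k Q →ₐ[k] R}
    (hv : ∀ v, f (of k (Qvr.Path.trivial Q v)) = f' (of k (Qvr.Path.trivial Q v)))
    (ha : ∀ a, f (of k (Qvr.Path.ofArrow Q a)) = f' (of k (Qvr.Path.ofArrow Q a))) : f = f' := by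
  refine AlgHom.toLinearMap_injective (linearMap_ext fun p => ?_)
  obtain ⟨v, l, h⟩ := p
  induction l generalizing v with
  | nil => exact hv v
  | cons a l ih =>
    have ih' := ih _ h.2
    simp only [AlgHom.toLinearMap_apply] at ih' ⊢
    rw [of_cons, map_mul, map_mul, ih', ha]

end PathAlg

/-! ### The normal form of an element of a monomial algebra -/

namespace Qvr

variable {V E : Type*} {Q : Qvr V E} {Z : Set Q.Path}

theorem basisPaths_of_infix {p q : Q.Path} (hp : p ∈ Q.basisPaths Z)
    (h : q.arrows <:+: p.arrows) : q ∈ Q.basisPaths Z :=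
  fun z hz hzq => hp z hz (hzq.trans h)

theorem mem_basisPaths_of_comp_left {p q : Q.Path} {h : q.target = p.start}
    (hpq : p.comp q h ∈ Q.basisPaths Z) : p ∈ Q.basisPaths Z :=
  basisPaths_of_infix hpq (List.suffix_append _ _).isInfix

theorem mem_basisPaths_of_comp_right {p q : Q.Path} {h : q.target = p.start}
    (hpq : p.comp q h ∈ Q.basisPaths Z) : q ∈ Q.basisPaths Z :=
  basisPaths_of_infix hpq (List.prefix_append _ _).isInfix

theorem mem_basisPaths_of_length_le_one (hZ : ∀ z ∈ Z, 2 ≤ z.length) {p : Q.Path}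
    (hp : p.length ≤ 1) : p ∈ Q.basisPaths Z := by
  intro z hz h
  have h₁ := h.length_le
  have h₂ := hZ z hz
  unfold Path.length at hp h₂
  omega

end Qvr

namespace MonAlg

variable {k : Type*} [Field k] {V E : Type*} [DecidableEq V] [Fintype V] {Q : Qvr V E}
  {Z : Set Q.Path}

theorem proj_surjective : Function.Surjective (proj k Z) := fun x =>
  Quotient.inductionOn x fun a => ⟨a, rfl⟩

theorem proj_eq_zero_iff (x : PathAlg k Q) : proj k Z x = 0 ↔ x ∈ relIdeal k Q Z := by
  rw [TwoSidedIdeal.mem_iff]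
  exact RingCon.eq (relIdeal k Q Z).ringCon (a := x) (b := 0)

theorem span_range_path : Submodule.span k (Set.range (path k Z)) = ⊤ := by
  have h : Set.range (path k Z) = (proj k Z).toLinearMap '' Set.range (PathAlg.of k) := by
    rw [← Set.range_comp]
    rfl
  rw [h, ← Submodule.map_span, PathAlg.span_range_of, Submodule.map_top,
    LinearMap.range_eq_top.2 proj_surjective]

theorem linearMap_ext {M : Type*} [AddCommMonoid M] [Module k M] {f g : MonAlg k Q Z →ₗ[k] M}
    (h : ∀ p, f (path k Z p) = g (path k Z p)) : f = g :=
  LinearMap.ext_on_range span_range_path h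

theorem path_comp (p q : Q.Path) (h : q.target = p.start) :
    path k Z (p.comp q h) = path k Z p * path k Z q := by
  rw [path, path, path, ← map_mul, PathAlg.of_comp]

theorem path_mul_path_of_ne {p q : Q.Path} (h : q.target ≠ p.start) :
    path k Z p * path k Z q = 0 := by
  rw [path, path, ← map_mul, PathAlg.of_mul_of, PathAlg.pathMul, dif_neg h, map_zero]

theorem vertex_mul_path (v : V) (p : Q.Path) :
    vertex k Z v * path k Z p = if p.target = v then path k Z p else 0 := by
  rw [vertex, path, path, ← map_mul, PathAlg.of_trivial_mul_of]
  split_ifs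
  · rfl
  · exact map_zero _

theorem path_mul_vertex (p : Q.Path) (v : V) :
    path k Z p * vertex k Z v = if p.start = v then path k Z p else 0 := by
  rw [vertex, path, path, ← map_mul, PathAlg.of_mul_of_trivial]
  split_ifs
  · rfl
  · exact map_zero _

theorem vertex_mul_vertex (v w : V) :
    vertex k Z v * vertex k Z w = if v = w then vertex k Z v else 0 := by
  rw [vertex, path_mul_vertex]
  rfl

theorem vertex_mul_arrow (v : V) (a : E) :
    vertex k Z v * arrow k Z a = if Q.tgt a = v then arrow k Z a else 0 :=
  vertex_mul_path _ _

theorem arrow_mul_vertex (a : E) (v : V) :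
    arrow k Z a * vertex k Z v = if Q.src a = v then arrow k Z a else 0 :=
  path_mul_vertex _ _

theorem sum_vertex : ∑ v, vertex k Z v = 1 := by
  rw [← map_one (proj k Z), PathAlg.one_eq_sum, map_sum]
  rfl

theorem path_cons (v : V) (a : E) (l : List E) (h : Q.IsWalk v (a :: l)) :
    path k Z (⟨v, a :: l, h⟩ : Q.Path) = path k Z ⟨Q.tgt a, l, h.2⟩ * arrow k Z a := by
  rw [path, PathAlg.of_cons, map_mul]
  rfl

/-- The universal property of `kQ/⟨Z⟩`. -/
def lift {R : Type*} [Ring R] [Algebra k R] (f : PathAlg k Q →ₐ[k] R)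
    (hf : ∀ z ∈ Z, f (PathAlg.of k z) = 0) : MonAlg k Q Z →ₐ[k] R :=
  (relIdeal k Q Z).ringCon.liftₐ f (by
    have h : relIdeal k Q Z ≤ TwoSidedIdeal.ker f.toRingHom := by
      rw [relIdeal, TwoSidedIdeal.span_le]
      rintro _ ⟨z, hz, rfl⟩
      exact (TwoSidedIdeal.mem_ker _).2 (hf z hz)
    exact TwoSidedIdeal.ringCon_le_iff.1 h)

theorem algHom_ext {R : Type*} [Ring R] [Algebra k R] {f f' : MonAlg k Q Z →ₐ[k] R}
    (hv : ∀ v, f (vertex k Z v) = f' (vertex k Z v))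
    (ha : ∀ a, f (arrow k Z a) = f' (arrow k Z a)) : f = f' := by
  have h : f.comp (proj k Z) = f'.comp (proj k Z) := PathAlg.algHom_ext hv ha
  ext x
  obtain ⟨x, rfl⟩ := proj_surjective x
  exact DFunLike.congr_fun h x

variable (k Z) in
theorem adjoin_eq_top :
    Algebra.adjoin k (Set.range (vertex k Z) ∪ Set.range (arrow k Z)) = ⊤ := by
  rw [← Algebra.toSubmodule_eq_top, eq_top_iff, ← span_range_path, Submodule.span_le]
  rintro _ ⟨⟨v, l, h⟩, rfl⟩
  change _ ∈ Algebra.adjoin k _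
  induction l generalizing v with
  | nil => exact Algebra.subset_adjoin (Or.inl ⟨v, rfl⟩)
  | cons a l ih =>
    rw [path_cons]
    exact mul_mem (ih _ h.2) (Algebra.subset_adjoin (Or.inr ⟨a, rfl⟩))

theorem path_append (v : V) (l m : List E) (h : Q.IsWalk v (l ++ m)) :
    path k Z (⟨v, l ++ m, h⟩ : Q.Path) =
      path k Z ⟨Q.walkEnd v l, m, (Qvr.isWalk_append.1 h).2⟩ *
        path k Z ⟨v, l, (Qvr.isWalk_append.1 h).1⟩ :=
  path_comp ⟨Q.walkEnd v l, m, (Qvr.isWalk_append.1 h).2⟩ ⟨v, l, (Qvr.isWalk_append.1 h).1⟩ rfl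

theorem path_of_mem {z : Q.Path} (hz : z ∈ Z) : path k Z z = 0 := by
  rw [path, proj_eq_zero_iff]
  exact TwoSidedIdeal.subset_span ⟨z, hz, rfl⟩

theorem path_eq_zero (hZ : ∀ z ∈ Z, 2 ≤ z.length) {p : Q.Path} (hp : p ∉ Q.basisPaths Z) :
    path k Z p = 0 := by
  simp only [Qvr.basisPaths, Set.mem_ofPred_eq, not_forall, not_not] at hp
  obtain ⟨z, hz, s, t, hst⟩ := hp
  have h2 := hZ z hz
  obtain ⟨v, l, h⟩ := p
  obtain ⟨w, m, hm⟩ := z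
  subst hst
  have hsm := (Qvr.isWalk_append.1 (Qvr.isWalk_append.1 h).1).2
  -- Subpaths are compared as lists of arrows. As `z` has positive length, its first arrow fixes its
  -- start, so the walk found inside `p` is `z` itself.
  have hz' : path k Z (⟨Q.walkEnd v s, m, hsm⟩ : Q.Path) = 0 := by
    rw [← path_of_mem (k := k) hz]
    congr 1
    ext1
    · cases m with
      | nil => simp [Qvr.Path.length] at h2
      | cons a m => exact hsm.1.symm.trans hm.1
    · rfl
  rw [path_append, path_append v s m, hz', zero_mul, mul_zero]

open Classical in
variable (k Z) in
/-- The part of an element of `kQ` that is supported on the paths with no subpath in `Z`. -/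
def nfAux : PathAlg k Q →ₗ[k] (Q.Path →₀ k) :=
  Finsupp.linearCombination k (fun p => if p ∈ Q.basisPaths Z then Finsupp.single p 1 else 0) ∘ₗ
    (PathAlg.coeffs k Q).toLinearMap

open Classical in
theorem nfAux_of (p : Q.Path) :
    nfAux k Z (PathAlg.of k p) = if p ∈ Q.basisPaths Z then Finsupp.single p 1 else 0 := by
  simp [nfAux, PathAlg.coeffs_of]

theorem nfAux_mul_of {p : Q.Path} (hp : p ∉ Q.basisPaths Z) (x : PathAlg k Q) :
    nfAux k Z (x * PathAlg.of k p) = 0 := by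
  induction x using PathAlg.induction with
  | h0 => simp
  | hadd x y hx hy => rw [add_mul, map_add, hx, hy, add_zero]
  | hof c q =>
    rw [smul_mul_assoc, map_smul, PathAlg.of_mul_of, PathAlg.pathMul]
    split_ifs with h
    · rw [nfAux_of, if_neg fun h' => hp (Qvr.mem_basisPaths_of_comp_right h'), smul_zero]
    · rw [map_zero, smul_zero]

theorem nfAux_of_mul {p : Q.Path} (hp : p ∉ Q.basisPaths Z) (x : PathAlg k Q) :
    nfAux k Z (PathAlg.of k p * x) = 0 := by
  induction x using PathAlg.induction with
  | h0 => simp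
  | hadd x y hx hy => rw [mul_add, map_add, hx, hy, add_zero]
  | hof c q =>
    rw [mul_smul_comm, map_smul, PathAlg.of_mul_of, PathAlg.pathMul]
    split_ifs with h
    · rw [nfAux_of, if_neg fun h' => hp (Qvr.mem_basisPaths_of_comp_left h'), smul_zero]
    · rw [map_zero, smul_zero]

/-- The paths outside `𝓑` absorb composition, so `nfAux (x * y)` depends on `y` only through `nfAux
y`. -/
theorem nfAux_mul_eq_zero_of_right (x : PathAlg k Q) {y : PathAlg k Q} (hy : nfAux k Z y = 0) :
    nfAux k Z (x * y) = 0 := by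
  have h : nfAux k Z ∘ₗ LinearMap.mulLeft k x =
      (Finsupp.linearCombination k fun p => nfAux k Z (x * PathAlg.of k p)) ∘ₗ nfAux k Z := by
    refine PathAlg.linearMap_ext fun p => ?_
    simp only [LinearMap.comp_apply, LinearMap.mulLeft_apply, nfAux_of]
    split_ifs with hp
    · simp
    · rw [nfAux_mul_of hp, map_zero]
  simpa [hy] using DFunLike.congr_fun h y

theorem nfAux_mul_eq_zero_of_left {x : PathAlg k Q} (y : PathAlg k Q) (hx : nfAux k Z x = 0) :
    nfAux k Z (x * y) = 0 := by
  have h : nfAux k Z ∘ₗ LinearMap.mulRight k y =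
      (Finsupp.linearCombination k fun p => nfAux k Z (PathAlg.of k p * y)) ∘ₗ nfAux k Z := by
    refine PathAlg.linearMap_ext fun p => ?_
    simp only [LinearMap.comp_apply, LinearMap.mulRight_apply, nfAux_of]
    split_ifs with hp
    · simp
    · rw [nfAux_of_mul hp, map_zero]
  simpa [hx] using DFunLike.congr_fun h x

/-- The kernel of `nfAux` is a two-sided ideal that contains `Z`. This makes the coefficients in `𝓑`
well defined on the quotient. -/
theorem nfAux_eq_zero_of_mem {x : PathAlg k Q} (hx : x ∈ relIdeal k Q Z) : nfAux k Z x = 0 := by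
  have h : relIdeal k Q Z ≤ TwoSidedIdeal.mk' {x | nfAux k Z x = 0} (map_zero _)
      (fun {x y} hx hy => by
        change nfAux k Z (x + y) = 0
        rw [map_add, show nfAux k Z x = 0 from hx, show nfAux k Z y = 0 from hy, add_zero])
      (fun {x} hx => by
        change nfAux k Z (-x) = 0
        rw [map_neg, show nfAux k Z x = 0 from hx, neg_zero])
      (fun {x y} hy => nfAux_mul_eq_zero_of_right x hy)
      (fun {x y} hx => nfAux_mul_eq_zero_of_left y hx) := by
    rw [relIdeal, TwoSidedIdeal.span_le]
    rintro _ ⟨z, hz, rfl⟩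
    rw [SetLike.mem_coe, TwoSidedIdeal.mem_mk']
    change nfAux k Z (PathAlg.of k z) = 0
    rw [nfAux_of, if_neg fun hz' => hz' z hz (List.infix_refl _)]
  have := h hx
  rwa [TwoSidedIdeal.mem_mk'] at this

variable (k Z) in
/-- The coefficients of an element of `kQ/⟨Z⟩` in the basis `𝓑`. -/
def nf : MonAlg k Q Z →ₗ[k] (Q.Path →₀ k) :=
  (LinearMap.ker (proj k Z).toLinearMap).liftQ (nfAux k Z)
      (fun _ hx => nfAux_eq_zero_of_mem ((proj_eq_zero_iff _).1 hx)) ∘ₗ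
    ((proj k Z).toLinearMap.quotKerEquivOfSurjective proj_surjective).symm.toLinearMap

theorem nf_proj (x : PathAlg k Q) : nf k Z (proj k Z x) = nfAux k Z x := by
  have h : ((proj k Z).toLinearMap.quotKerEquivOfSurjective proj_surjective).symm (proj k Z x) =
      Submodule.Quotient.mk x := by
    rw [LinearEquiv.symm_apply_eq]
    rfl
  rw [nf, LinearMap.comp_apply, LinearEquiv.coe_coe, h]
  rfl

theorem nf_path_of_mem {p : Q.Path} (hp : p ∈ Q.basisPaths Z) :
    nf k Z (path k Z p) = Finsupp.single p 1 := by
  rw [path, nf_proj, nfAux_of, if_pos hp]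

theorem nf_path_of_notMem {p : Q.Path} (hp : p ∉ Q.basisPaths Z) :
    nf k Z (path k Z p) = 0 := by
  rw [path, nf_proj, nfAux_of, if_neg hp]

theorem path_ne_zero {p : Q.Path} (hp : p ∈ Q.basisPaths Z) : path k Z p ≠ 0 := fun h => by
  have := nf_path_of_mem (k := k) hp
  rw [h, map_zero] at this
  exact one_ne_zero (Finsupp.single_eq_zero.1 this.symm)

/-- Rebuilding an element from its coefficients is a left inverse, because a path outside `𝓑` is
already zero in the quotient. -/
theorem nf_injective (hZ : ∀ z ∈ Z, 2 ≤ z.length) : Function.Injective (nf k Z) := by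
  have h : Finsupp.linearCombination k (path k Z) ∘ₗ nf k Z = LinearMap.id := by
    refine linearMap_ext fun p => ?_
    by_cases hp : p ∈ Q.basisPaths Z
    · simp [nf_path_of_mem hp]
    · simp [path_eq_zero hZ hp]
  intro x y hxy
  have hx := DFunLike.congr_fun h x
  have hy := DFunLike.congr_fun h y
  rw [LinearMap.comp_apply] at hx hy
  rw [← LinearMap.id_apply (R := k) x, ← LinearMap.id_apply (R := k) y, ← hx, ← hy, hxy]

theorem nf_apply_of_notMem (x : MonAlg k Q Z) {p : Q.Path} (hp : p ∉ Q.basisPaths Z) :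
    nf k Z x p = 0 := by
  have h : Finsupp.lapply p ∘ₗ nf k Z = 0 := by
    refine linearMap_ext fun q => ?_
    by_cases hq : q ∈ Q.basisPaths Z
    · have : q ≠ p := fun h => hp (h ▸ hq)
      simp [nf_path_of_mem hq, this]
    · simp [nf_path_of_notMem hq]
  exact DFunLike.congr_fun h x

theorem arrow_ne_zero (hZ : ∀ z ∈ Z, 2 ≤ z.length) (a : E) : arrow k Z a ≠ 0 :=
  path_ne_zero (Qvr.mem_basisPaths_of_length_le_one hZ (by simp [Qvr.Path.ofArrow, Qvr.Path.length]))

end MonAlg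

/-! ### Parallel paths and derivations -/

section Parallel

variable (k : Type*) [Field k] {V E : Type*} {Q : Qvr V E} (Z : Set Q.Path)

theorem arrowPar_of_mem {a : E} {p : Q.Path}
    (h : p ∈ Q.basisPaths Z ∧ p.start = Q.src a ∧ p.target = Q.tgt a) :
    arrowPar k Z a p = Finsupp.single ⟨(a, p), h⟩ 1 := dif_pos h

theorem arrowPar_of_notMem {a : E} {p : Q.Path} (h : p ∉ Q.basisPaths Z) :
    arrowPar k Z a p = 0 := dif_neg fun h' => h h'.1

theorem vertexPar_of_mem {v : V} {p : Q.Path}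
    (h : p ∈ Q.basisPaths Z ∧ p.start = v ∧ p.target = v) :
    vertexPar k Z v p = Finsupp.single ⟨(v, p), h⟩ 1 := dif_pos h

variable [DecidableEq V] [Fintype V]

/-- The linear map that sends `e ‖ p` to the class of `p`. -/
def evVertex : (Q.VertexPar Z →₀ k) →ₗ[k] MonAlg k Q Z :=
  Finsupp.linearCombination k fun x => MonAlg.path k Z x.1.2

open Classical in
/-- The linear map that sends `a ‖ p` to the class of `p`, and `b ‖ p` to `0` for `b ≠ a`. -/
def evArrow (a : E) : (Q.ArrowPar Z →₀ k) →ₗ[k] MonAlg k Q Z :=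
  Finsupp.linearCombination k fun x => if x.1.1 = a then MonAlg.path k Z x.1.2 else 0

variable {k Z}

theorem evVertex_single (x : Q.VertexPar Z) (c : k) :
    evVertex k Z (Finsupp.single x c) = c • MonAlg.path k Z x.1.2 := by
  simp [evVertex]

open Classical in
theorem evArrow_single (a : E) (x : Q.ArrowPar Z) (c : k) :
    evArrow k Z a (Finsupp.single x c) = if x.1.1 = a then c • MonAlg.path k Z x.1.2 else 0 := by
  simp [evArrow]

open Classical in
theorem evArrow_arrowPar (hZ : ∀ z ∈ Z, 2 ≤ z.length) (a b : E) {p : Q.Path}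
    (h₁ : p.start = Q.src b) (h₂ : p.target = Q.tgt b) :
    evArrow k Z a (arrowPar k Z b p) = if b = a then MonAlg.path k Z p else 0 := by
  by_cases h : p ∈ Q.basisPaths Z
  · rw [arrowPar_of_mem k Z ⟨h, h₁, h₂⟩]
    refine (evArrow_single a ⟨(b, p), h, h₁, h₂⟩ 1).trans ?_
    rw [one_smul]
  · rw [arrowPar_of_notMem k Z h, map_zero, MonAlg.path_eq_zero hZ h, ite_self]

/-- The coefficient at `a ‖ p` can be read off inside the algebra. Hence the values at all arrows
determine an element of `k(Q₁ ‖ 𝓑)`, and identities there can be checked as identities in the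
algebra. -/
theorem nf_evArrow (x : Q.ArrowPar Z) (y : Q.ArrowPar Z →₀ k) :
    MonAlg.nf k Z (evArrow k Z x.1.1 y) x.1.2 = y x := by
  classical
  have h : Finsupp.lapply x.1.2 ∘ₗ MonAlg.nf k Z ∘ₗ evArrow k Z x.1.1 = Finsupp.lapply x := by
    refine Finsupp.lhom_ext fun w c => ?_
    simp only [LinearMap.comp_apply, evArrow_single, Finsupp.lapply_apply]
    split_ifs with h
    · rw [map_smul, MonAlg.nf_path_of_mem w.2.1, Finsupp.smul_single_one, Finsupp.single_apply,
        Finsupp.single_apply]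
      congr 1
      exact propext ⟨fun h' => Subtype.ext (Prod.ext h h'), fun h' => by rw [h']⟩
    · rw [map_zero, Finsupp.single_apply, if_neg (fun h' => h (by rw [h']))]
      rfl
  exact DFunLike.congr_fun h y

theorem evArrow_ext {y y' : Q.ArrowPar Z →₀ k} (h : ∀ a, evArrow k Z a y = evArrow k Z a y') :
    y = y' := by
  ext x
  rw [← nf_evArrow, ← nf_evArrow, h]

theorem vertex_mul_evVertex (w : Q.VertexPar Z →₀ k) (v : V) :
    MonAlg.vertex k Z v * evVertex k Z w = evVertex k Z w * MonAlg.vertex k Z v := by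
  have h : LinearMap.mulLeft k (MonAlg.vertex k Z v) ∘ₗ evVertex k Z =
      LinearMap.mulRight k (MonAlg.vertex k Z v) ∘ₗ evVertex k Z := by
    refine Finsupp.lhom_ext fun x c => ?_
    simp only [LinearMap.comp_apply, evVertex_single, map_smul, LinearMap.mulLeft_apply,
      LinearMap.mulRight_apply, MonAlg.vertex_mul_path, MonAlg.path_mul_vertex, x.2.2.1, x.2.2.2]
  exact DFunLike.congr_fun h w

theorem vertex_mul_mul_vertex_mem_range (v : V) (x : MonAlg k Q Z)
    (hZ : ∀ z ∈ Z, 2 ≤ z.length) :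
    MonAlg.vertex k Z v * x * MonAlg.vertex k Z v ∈ LinearMap.range (evVertex k Z) := by
  have hx : x ∈ Submodule.span k (Set.range (MonAlg.path k Z)) := by
    rw [MonAlg.span_range_path]
    trivial
  induction hx using Submodule.span_induction with
  | zero => simp
  | add x y _ _ hx hy => rw [mul_add, add_mul]; exact add_mem hx hy
  | smul c x _ hx => rw [mul_smul_comm, smul_mul_assoc]; exact Submodule.smul_mem _ _ hx
  | mem x hx =>
    obtain ⟨p, rfl⟩ := hx
    rw [MonAlg.vertex_mul_path]
    split_ifs with h₁
    · rw [MonAlg.path_mul_vertex]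
      split_ifs with h₂
      · by_cases hp : p ∈ Q.basisPaths Z
        · exact ⟨Finsupp.single ⟨(v, p), hp, h₂, h₁⟩ 1,
            (evVertex_single ⟨(v, p), hp, h₂, h₁⟩ 1).trans (one_smul _ _)⟩
        · rw [MonAlg.path_eq_zero hZ hp]
          exact zero_mem _
      · exact zero_mem _
    · rw [zero_mul]
      exact zero_mem _

/-- The elements that commute with the vertices are the images of the elements of
`k(Q₀ ‖ 𝓑)`. -/
theorem exists_evVertex_eq (hZ : ∀ z ∈ Z, 2 ≤ z.length) (x : MonAlg k Q Z)
    (hx : ∀ v, MonAlg.vertex k Z v * x = x * MonAlg.vertex k Z v) :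
    ∃ w, evVertex k Z w = x := by
  have h : x = ∑ v, MonAlg.vertex k Z v * x * MonAlg.vertex k Z v := by
    calc x = ∑ v, x * MonAlg.vertex k Z v := by rw [← Finset.mul_sum, MonAlg.sum_vertex, mul_one]
      _ = _ := Finset.sum_congr rfl fun v _ => by
        rw [hx, mul_assoc, MonAlg.vertex_mul_vertex, if_pos rfl]
  rw [← LinearMap.mem_range, h]
  exact Submodule.sum_mem _ fun v _ => vertex_mul_mul_vertex_mem_range v x hZ

theorem exists_evArrow_eq (hZ : ∀ z ∈ Z, 2 ≤ z.length) (a : E) (x : MonAlg k Q Z) :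
    ∃ y, evArrow k Z a y = MonAlg.vertex k Z (Q.tgt a) * x * MonAlg.vertex k Z (Q.src a) ∧
      ∀ b, b ≠ a → evArrow k Z b y = 0 := by
  classical
  have hx : x ∈ Submodule.span k (Set.range (MonAlg.path k Z)) := by
    rw [MonAlg.span_range_path]
    trivial
  induction hx using Submodule.span_induction with
  | zero => exact ⟨0, by simp⟩
  | add x y _ _ hx hy =>
    obtain ⟨u, hu, hu'⟩ := hx
    obtain ⟨v, hv, hv'⟩ := hy
    exact ⟨u + v, by rw [map_add, hu, hv, mul_add, add_mul], fun b hb => by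
      rw [map_add, hu' b hb, hv' b hb, add_zero]⟩
  | smul c x _ hx =>
    obtain ⟨u, hu, hu'⟩ := hx
    exact ⟨c • u, by rw [map_smul, hu, mul_smul_comm, smul_mul_assoc], fun b hb => by
      rw [map_smul, hu' b hb, smul_zero]⟩
  | mem x hx =>
    obtain ⟨p, rfl⟩ := hx
    rw [MonAlg.vertex_mul_path]
    split_ifs with h₁
    · rw [MonAlg.path_mul_vertex]
      split_ifs with h₂
      · refine ⟨arrowPar k Z a p, ?_, fun b hb => ?_⟩
        · rw [evArrow_arrowPar hZ _ _ h₂ h₁, if_pos rfl]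
        · rw [evArrow_arrowPar hZ _ _ h₂ h₁, if_neg hb.symm]
      · exact ⟨0, by simp⟩
    · exact ⟨0, by simp⟩

open Classical in
theorem evArrow_arrow_comp (hZ : ∀ z ∈ Z, 2 ≤ z.length) (a b : E) {p : Q.Path}
    (hp : p.target = p.start) :
    evArrow k Z a (if h : p.target = Q.src b then
      arrowPar k Z b ((Qvr.Path.ofArrow Q b).comp p h) else 0) =
      if b = a then MonAlg.arrow k Z b * MonAlg.path k Z p else 0 := by
  by_cases h : p.target = Q.src b
  · rw [dif_pos h, evArrow_arrowPar hZ a b (p := (Qvr.Path.ofArrow Q b).comp p h)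
      (hp.symm.trans h) (Qvr.Path.target_comp (Qvr.Path.ofArrow Q b) p h),
      MonAlg.path_comp (Qvr.Path.ofArrow Q b) p h]
    rfl
  · rw [dif_neg h, map_zero, MonAlg.arrow,
      MonAlg.path_mul_path_of_ne (p := Qvr.Path.ofArrow Q b) h, ite_self]

open Classical in
theorem evArrow_comp_arrow (hZ : ∀ z ∈ Z, 2 ≤ z.length) (a b : E) {p : Q.Path}
    (hp : p.target = p.start) :
    evArrow k Z a (if h : Q.tgt b = p.start then
      arrowPar k Z b (p.comp (Qvr.Path.ofArrow Q b) h) else 0) =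
      if b = a then MonAlg.path k Z p * MonAlg.arrow k Z b else 0 := by
  by_cases h : Q.tgt b = p.start
  · rw [dif_pos h, evArrow_arrowPar hZ a b (p := p.comp (Qvr.Path.ofArrow Q b) h) rfl
      ((Qvr.Path.target_comp p (Qvr.Path.ofArrow Q b) h).trans (hp.trans h.symm)), 
      MonAlg.path_comp p (Qvr.Path.ofArrow Q b) h]
    rfl
  · rw [dif_neg h, map_zero, MonAlg.arrow,
      MonAlg.path_mul_path_of_ne (q := Qvr.Path.ofArrow Q b) h, ite_self]

theorem realizes_iff [Fintype E] {y : Q.ArrowPar Z →₀ k} {D : Der k (MonAlg k Q Z)} :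
    Realizes k Z y D ↔ (∀ v, D.1 (MonAlg.vertex k Z v) = 0) ∧
      ∀ a, D.1 (MonAlg.arrow k Z a) = evArrow k Z a y := by
  simp only [Realizes, evArrow, Finsupp.linearCombination_apply, smul_ite, smul_zero]

variable [Fintype E]

/-- The two sums in `δ⁰` are the products `a w` and `w a`; composites that do not exist or leave `𝓑`
are zero on both sides. Later computations with `δ⁰` thus become computations of commutators. -/
theorem evArrow_delta0 (hZ : ∀ z ∈ Z, 2 ≤ z.length) (a : E) (w : Q.VertexPar Z →₀ k) :
    evArrow k Z a (delta0 k Z w) =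
      MonAlg.arrow k Z a * evVertex k Z w - evVertex k Z w * MonAlg.arrow k Z a := by
  classical
  have h : evArrow k Z a ∘ₗ delta0 k Z =
      (LinearMap.mulLeft k (MonAlg.arrow k Z a) - LinearMap.mulRight k (MonAlg.arrow k Z a)) ∘ₗ
        evVertex k Z := by
    refine Finsupp.lhom_ext fun x c => ?_
    have h₁ := fun b => evArrow_arrow_comp (k := k) hZ a b (x.2.2.2.trans x.2.2.1.symm)
    have h₂ := fun b => evArrow_comp_arrow (k := k) hZ a b (x.2.2.2.trans x.2.2.1.symm)
    simp only [LinearMap.comp_apply, delta0, Finsupp.linearCombination_single, map_smul, map_sub,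
      map_sum, h₁, h₂, evVertex_single, LinearMap.sub_apply, LinearMap.mulLeft_apply,
      LinearMap.mulRight_apply, Finset.sum_ite_eq', Finset.mem_univ, if_true]
  exact DFunLike.congr_fun h w

end Parallel

/-! ### Derivations modulo inner derivations -/

section Derivations

attribute [local instance 100] LieRing.ofAssociativeRing

variable {k : Type*} [Field k] {R : Type*} [Ring R] [Algebra k R]

theorem Der.leibniz (D : Der k R) (a b : R) : D.1 (a * b) = D.1 a * b + a * D.1 b := D.2 a b

theorem Der.map_one (D : Der k R) : D.1 1 = 0 := by
  have h := D.leibniz 1 1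
  simpa using h

variable (k) in
/-- The inner derivation `a ↦ x a - a x`. -/
def adDer (x : R) : Der k R :=
  ⟨LinearMap.mulLeft k x - LinearMap.mulRight k x, fun a b => by
    simp only [LinearMap.sub_apply, LinearMap.mulLeft_apply, LinearMap.mulRight_apply]
    noncomm_ring⟩

theorem adDer_apply (x a : R) : (adDer k x).1 a = x * a - a * x := rfl

theorem HH1.mk_eq_zero_iff {D : Der k R} : HH1.mk k R D = 0 ↔ ∃ x, D = adDer k x := by
  have h : HH1.mk k R D = 0 ↔ D ∈ innerDer k R :=
    LieSubmodule.Quotient.mk_eq_zero (innerDer k R)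
  rw [h]
  constructor
  · rintro ⟨x, hx⟩
    exact ⟨x, Subtype.ext (LinearMap.ext hx)⟩
  · rintro ⟨x, rfl⟩
    exact ⟨x, fun _ => rfl⟩

theorem HH1.mk_surjective : Function.Surjective (HH1.mk k R) := fun x =>
  Submodule.Quotient.mk_surjective _ x

theorem HH1.mk_adDer (x : R) : HH1.mk k R (adDer k x) = 0 := mk_eq_zero_iff.2 ⟨x, rfl⟩

variable {V E : Type*} [DecidableEq V] [Fintype V] {Q : Qvr V E} {Z : Set Q.Path}

/-- Derivations with the same values on the vertices and on the arrows are equal. -/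
theorem Der.ext_vertex_arrow {D D' : Der k (MonAlg k Q Z)}
    (hv : ∀ v, D.1 (MonAlg.vertex k Z v) = D'.1 (MonAlg.vertex k Z v))
    (ha : ∀ a, D.1 (MonAlg.arrow k Z a) = D'.1 (MonAlg.arrow k Z a)) : D = D' := by
  refine Subtype.ext (LinearMap.ext fun x => ?_)
  have hx : x ∈ Algebra.adjoin k (Set.range (MonAlg.vertex k Z) ∪ Set.range (MonAlg.arrow k Z)) := by
    rw [MonAlg.adjoin_eq_top]
    trivial
  induction hx using Algebra.adjoin_induction with
  | mem x hx =>
    obtain ⟨v, rfl⟩ | ⟨a, rfl⟩ := hx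
    · exact hv v
    · exact ha a
  | algebraMap c =>
    rw [Algebra.algebraMap_eq_smul_one, map_smul, map_smul, Der.map_one, Der.map_one]
  | add x y _ _ hx hy => rw [map_add, map_add, hx, hy]
  | mul x y _ _ hx hy => rw [Der.leibniz, Der.leibniz, hx, hy]

/-- Modulo inner derivations, every derivation kills the vertices. -/
theorem exists_sub_adDer_vertex_eq_zero (D : Der k (MonAlg k Q Z)) :
    ∃ x, ∀ v, (D - adDer k x).1 (MonAlg.vertex k Z v) = 0 := by
  -- The vertices span a separable subalgebra with separability idempotent `∑ v ⊗ v`; applying `D`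
  -- to its left factors and multiplying gives the inducing element.
  refine ⟨∑ v, D.1 (MonAlg.vertex k Z v) * MonAlg.vertex k Z v, fun w => ?_⟩
  change D.1 (MonAlg.vertex k Z w) - (adDer k _).1 (MonAlg.vertex k Z w) = 0
  have h₁ : (∑ v, D.1 (MonAlg.vertex k Z v) * MonAlg.vertex k Z v) * MonAlg.vertex k Z w =
      D.1 (MonAlg.vertex k Z w) * MonAlg.vertex k Z w := by
    rw [Finset.sum_mul, Finset.sum_eq_single w]
    · rw [mul_assoc, MonAlg.vertex_mul_vertex, if_pos rfl]
    · intro v _ hv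
      rw [mul_assoc, MonAlg.vertex_mul_vertex, if_neg hv, mul_zero]
    · simp
  have h₂ : MonAlg.vertex k Z w * ∑ v, D.1 (MonAlg.vertex k Z v) * MonAlg.vertex k Z v =
      D.1 (MonAlg.vertex k Z w) * MonAlg.vertex k Z w - D.1 (MonAlg.vertex k Z w) := by
    -- The Leibniz rule for `e_w e_v`, multiplied on the right by `e_v`.
    have h₃ : ∀ v, MonAlg.vertex k Z w * (D.1 (MonAlg.vertex k Z v) * MonAlg.vertex k Z v) =
        (if w = v then D.1 (MonAlg.vertex k Z w) * MonAlg.vertex k Z w else 0) -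
          D.1 (MonAlg.vertex k Z w) * MonAlg.vertex k Z v := by
      intro v
      have h := D.leibniz (MonAlg.vertex k Z w) (MonAlg.vertex k Z v)
      rw [MonAlg.vertex_mul_vertex] at h
      have h' := congrArg (· * MonAlg.vertex k Z v) h
      simp only [add_mul, mul_assoc, MonAlg.vertex_mul_vertex, if_true] at h'
      rw [← sub_eq_iff_eq_add'] at h'
      rw [← h']
      split_ifs with hwv
      · rw [hwv]
      · rw [map_zero, zero_mul]
    rw [Finset.mul_sum, Finset.sum_congr rfl fun v _ => h₃ v, Finset.sum_sub_distrib,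
      Finset.sum_ite_eq, if_pos (Finset.mem_univ _), ← Finset.mul_sum, MonAlg.sum_vertex, mul_one]
  rw [adDer_apply, h₁, h₂]
  abel

theorem der_arrow_eq {D : Der k (MonAlg k Q Z)} (hD : ∀ v, D.1 (MonAlg.vertex k Z v) = 0)
    (a : E) : MonAlg.vertex k Z (Q.tgt a) * D.1 (MonAlg.arrow k Z a) *
      MonAlg.vertex k Z (Q.src a) = D.1 (MonAlg.arrow k Z a) := by
  have h₁ := D.leibniz (MonAlg.vertex k Z (Q.tgt a)) (MonAlg.arrow k Z a)
  have h₂ := D.leibniz (MonAlg.arrow k Z a) (MonAlg.vertex k Z (Q.src a))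
  rw [MonAlg.vertex_mul_arrow, if_pos rfl, hD, zero_mul, zero_add] at h₁
  rw [MonAlg.arrow_mul_vertex, if_pos rfl, hD, mul_zero, add_zero] at h₂
  rw [← h₁, ← h₂]

variable [Fintype E]

theorem exists_realizes (hZ : ∀ z ∈ Z, 2 ≤ z.length) {D : Der k (MonAlg k Q Z)}
    (hD : ∀ v, D.1 (MonAlg.vertex k Z v) = 0) : ∃ y, Realizes k Z y D := by
  choose y hy hy' using fun a => exists_evArrow_eq hZ a (D.1 (MonAlg.arrow k Z a))
  refine ⟨∑ a, y a, realizes_iff.2 ⟨hD, fun a => ?_⟩⟩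
  rw [map_sum, Finset.sum_eq_single a (fun b _ hb => hy' b a hb.symm) (by simp), hy, der_arrow_eq hD]

theorem Realizes.ext {y : Q.ArrowPar Z →₀ k} {D D' : Der k (MonAlg k Q Z)}
    (h : Realizes k Z y D) (h' : Realizes k Z y D') : D = D' := by
  rw [realizes_iff] at h h'
  exact Der.ext_vertex_arrow (fun v => by rw [h.1, h'.1]) fun a => by rw [h.2, h'.2]

theorem Realizes.unique {y y' : Q.ArrowPar Z →₀ k} {D : Der k (MonAlg k Q Z)}
    (h : Realizes k Z y D) (h' : Realizes k Z y' D) : y = y' := by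
  rw [realizes_iff] at h h'
  exact evArrow_ext fun a => by rw [← h.2, h'.2]

theorem Realizes.add {y y' : Q.ArrowPar Z →₀ k} {D D' : Der k (MonAlg k Q Z)}
    (h : Realizes k Z y D) (h' : Realizes k Z y' D') : Realizes k Z (y + y') (D + D') := by
  rw [realizes_iff] at h h' ⊢
  constructor
  · intro v
    change D.1 _ + D'.1 _ = 0
    rw [h.1, h'.1, add_zero]
  · intro a
    change D.1 _ + D'.1 _ = _
    rw [h.2, h'.2, map_add]

theorem Realizes.smul {y : Q.ArrowPar Z →₀ k} {D : Der k (MonAlg k Q Z)} (c : k)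
    (h : Realizes k Z y D) : Realizes k Z (c • y) (c • D) := by
  rw [realizes_iff] at h ⊢
  constructor
  · intro v
    change c • D.1 _ = 0
    rw [h.1, smul_zero]
  · intro a
    change c • D.1 _ = _
    rw [h.2, map_smul]

/-- The sign appears because `δ⁰` gives `a w - w a`, while `adDer x` is `a ↦ x a - a x`. -/
theorem realizes_delta0 (hZ : ∀ z ∈ Z, 2 ≤ z.length) (w : Q.VertexPar Z →₀ k) :
    Realizes k Z (delta0 k Z w) (adDer k (-evVertex k Z w)) := by
  refine realizes_iff.2 ⟨fun v => ?_, fun a => ?_⟩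
  · rw [adDer_apply, mul_neg, neg_mul, vertex_mul_evVertex, sub_self]
  · rw [adDer_apply, evArrow_delta0 hZ, mul_neg, neg_mul, neg_sub_neg]

/-- If an inner derivation kills the vertices, the inducing element commutes with them and is a
combination of closed paths, so it comes from `k(Q₀ ‖ 𝓑)`. -/
theorem Realizes.mk_eq_zero_iff (hZ : ∀ z ∈ Z, 2 ≤ z.length) {y : Q.ArrowPar Z →₀ k}
    {D : Der k (MonAlg k Q Z)} (h : Realizes k Z y D) :
    HH1.mk k (MonAlg k Q Z) D = 0 ↔ y ∈ LinearMap.range (delta0 k Z) := by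
  constructor
  · rw [HH1.mk_eq_zero_iff]
    rintro ⟨x, rfl⟩
    obtain ⟨w, hw⟩ := exists_evVertex_eq hZ (-x) fun v => by
      have := (realizes_iff.1 h).1 v
      rw [adDer_apply, sub_eq_zero] at this
      rw [mul_neg, neg_mul, this]
    refine ⟨w, Realizes.unique ?_ h⟩
    have := realizes_delta0 hZ w
    rwa [hw, neg_neg] at this
  · rintro ⟨w, rfl⟩
    rw [h.ext (realizes_delta0 hZ w), HH1.mk_adDer]

end Derivations

/-! ### The glued quiver -/

namespace Qvr.GluePair

variable {V E : Type*} {Q : Qvr V E} (g : Q.GluePair) [DecidableEq V]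

theorem mapV_src_β : g.mapV (Q.src g.β) = g.f₁ := by simp [mapV]

theorem mapV_tgt_β : g.mapV (Q.tgt g.β) = g.f₂ := by simp [mapV, g.nodup'.2.2.symm]

theorem mapV_src_α : g.mapV (Q.src g.α) = g.f₁ := by
  simp [mapV, f₁, g.nodup'.1.2.1, g.nodup'.1.2.2]

theorem mapV_tgt_α : g.mapV (Q.tgt g.α) = g.f₂ := by
  simp [mapV, f₂, g.nodup'.2.1.1, g.nodup'.2.1.2]

theorem mapV_val (f : g.Vert) : g.mapV f.1 = f := by
  simp [mapV, f.2.1, f.2.2]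

theorem f₁_ne_f₂ : g.f₁ ≠ g.f₂ := fun h => g.nodup'.1.1 (congrArg Subtype.val h)

theorem mapV_eq_mapV {v w : V} (h : g.mapV v = g.mapV w) :
    v = w ∨ (v = Q.src g.α ∧ w = Q.src g.β) ∨ (v = Q.src g.β ∧ w = Q.src g.α) ∨
      (v = Q.tgt g.α ∧ w = Q.tgt g.β) ∨ (v = Q.tgt g.β ∧ w = Q.tgt g.α) := by
  have hn := g.nodup'
  unfold mapV f₁ f₂ at h
  split_ifs at h <;> simp only [Subtype.mk.injEq] at h <;> grind

theorem mapV_eq_f₁ {v : V} : g.mapV v = g.f₁ ↔ v = Q.src g.α ∨ v = Q.src g.β := by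
  constructor
  · intro h
    rw [← g.mapV_src_α] at h
    have hn := g.nodup'
    have := g.mapV_eq_mapV h
    grind
  · rintro (rfl | rfl)
    · exact g.mapV_src_α
    · exact g.mapV_src_β

theorem mapV_eq_f₂ {v : V} : g.mapV v = g.f₂ ↔ v = Q.tgt g.α ∨ v = Q.tgt g.β := by
  constructor
  · intro h
    rw [← g.mapV_tgt_α] at h
    have hn := g.nodup'
    have := g.mapV_eq_mapV h
    grind
  · rintro (rfl | rfl)
    · exact g.mapV_tgt_α
    · exact g.mapV_tgt_β

theorem α_ne_β : g.α ≠ g.β := fun h => g.nodup'.1.2.1 (congrArg Q.src h)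

variable [DecidableEq E]

theorem mapE_β : g.mapE g.β = g.γ := by simp [mapE]

theorem mapE_of_ne {a : E} (h : a ≠ g.β) : g.mapE a = ⟨a, h⟩ := by simp [mapE, h]

theorem mapE_α : g.mapE g.α = g.γ := g.mapE_of_ne g.α_ne_β

theorem mapE_val (b : g.Arr) : g.mapE b.1 = b := g.mapE_of_ne b.2

theorem mapE_eq_mapE {a b : E} (h : g.mapE a = g.mapE b) :
    a = b ∨ (a = g.α ∧ b = g.β) ∨ (a = g.β ∧ b = g.α) := by
  unfold mapE γ at h
  split_ifs at h <;> simp only [Subtype.mk.injEq] at h <;> grind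

theorem mapE_eq_γ {a : E} : g.mapE a = g.γ ↔ a = g.α ∨ a = g.β := by
  constructor
  · intro h
    rw [← g.mapE_α] at h
    have := g.mapE_eq_mapE h
    grind
  · rintro (rfl | rfl)
    · exact g.mapE_α
    · exact g.mapE_β

theorem target_mapPath (p : Q.Path) : (g.mapPath p).target = g.mapV p.target := by
  obtain ⟨v, l, h⟩ := p
  induction l generalizing v with
  | nil => rfl
  | cons a l ih =>
    refine Eq.trans ?_ (ih _ h.2)
    change g.quiver.walkEnd (g.quiver.tgt (g.mapE a)) _ = g.quiver.walkEnd (g.mapV (Q.tgt a)) _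
    rw [g.tgt_mapE]
    rfl

theorem mapPath_trivial (v : V) :
    g.mapPath (Path.trivial Q v) = Path.trivial g.quiver (g.mapV v) := rfl

theorem mapPath_ofArrow (a : E) :
    g.mapPath (Path.ofArrow Q a) = Path.ofArrow g.quiver (g.mapE a) := by
  ext1
  · exact (g.src_mapE a).symm
  · rfl

theorem length_mapPath (p : Q.Path) : (g.mapPath p).length = p.length := List.length_map _

/-- Gluing a source arrow and a sink arrow forms no new paths but the `ξ* γ* η*`. -/
theorem mem_newPaths (hα : Q.IsSourceArrow g.α) (hβ : Q.IsSinkArrow g.β) {p : g.quiver.Path} :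
    p ∈ g.newPaths ↔ ∃ η ξ, Q.tgt η = Q.src g.β ∧ Q.src ξ = Q.tgt g.α ∧
      p.arrows = [g.mapE η, g.γ, g.mapE ξ] := by
  constructor
  · rintro ((⟨η, l, h, _⟩ | ⟨μ, ξ, h, h', _⟩ | ⟨η, ξ, h, _⟩) |
      (⟨η, l, _, h, h', _⟩ | ⟨μ, ξ, h, h', _⟩ | h))
    · exact (hα.1 _ h).elim
    · exact (h' (hα.2.2 _ h)).elim
    · exact (hα.1 _ h).elim
    · exact (h' (hα.2.1 _ h)).elim
    · exact (h' (hβ.2.2 _ h)).elim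
    · exact h
  · exact fun h => Or.inr (Or.inr (Or.inr h))

theorem two_le_length_of_mem_relations {Z : Set Q.Path} (hZ : ∀ z ∈ Z, 2 ≤ z.length) :
    ∀ z ∈ g.relations Z, 2 ≤ z.length := by
  rintro z (⟨z, hz, rfl⟩ | ((⟨_, _, _, _, _, h⟩ | ⟨_, _, _, _, _, h⟩ | ⟨_, _, _, _, h⟩) |
    (⟨_, _, _, _, _, h⟩ | ⟨_, _, _, _, _, h⟩ | ⟨_, _, _, _, h⟩)))
  · rw [length_mapPath]
    exact hZ z hz
  all_goals simp [Path.length, h]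

end Qvr.GluePair

/-! ### Gluing representations -/

namespace Rep

variable {V E : Type*} [DecidableEq V] [Fintype V] [DecidableEq E] [Fintype E] {Q : Qvr V E}
  {R : Type*} [Ring R] (ρ : Rep Q R) (g : Q.GluePair)

theorem sum_e_mul_e (v : V) : (∑ w with g.mapV w = g.mapV v, ρ.e w) * ρ.e v = ρ.e v := by
  rw [Finset.sum_mul, Finset.sum_eq_single v]
  · simp [ρ.e_mul_e]
  · intro w _ h
    rw [ρ.e_mul_e, if_neg h]
  · simp

theorem e_mul_sum_e (v : V) : ρ.e v * ∑ w with g.mapV w = g.mapV v, ρ.e w = ρ.e v := by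
  rw [Finset.mul_sum, Finset.sum_eq_single v]
  · simp [ρ.e_mul_e]
  · intro w _ h
    rw [ρ.e_mul_e, if_neg h.symm]
  · simp

theorem x_mul_e_of_ne {a : E} {v : V} (h : Q.src a ≠ v) : ρ.x a * ρ.e v = 0 := by
  rw [← ρ.x_mul_e, mul_assoc, ρ.e_mul_e, if_neg h, mul_zero]

theorem x_mul_x_of_ne {a b : E} (h : Q.src a ≠ Q.tgt b) : ρ.x a * ρ.x b = 0 := by
  rw [← ρ.e_mul_x b, ← mul_assoc, ρ.x_mul_e_of_ne h, zero_mul]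

/-- The representation of the glued quiver that attaches to a vertex or an arrow the sum of the
elements attached to its preimages. -/
def glue : Rep g.quiver R where
  e f := ∑ v with g.mapV v = f, ρ.e v
  x b := ∑ a with g.mapE a = b, ρ.x a
  e_mul_e f f' := by
    rw [Finset.sum_mul_sum]
    split_ifs with h
    · subst h
      refine Finset.sum_congr rfl fun v hv => ?_
      rw [Finset.sum_eq_single v]
      · simp [ρ.e_mul_e]
      · intro w _ h
        rw [ρ.e_mul_e, if_neg h.symm]
      · exact fun h => (h hv).elim
    · refine Finset.sum_eq_zero fun v hv => Finset.sum_eq_zero fun w hw => ?_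
      rw [ρ.e_mul_e, if_neg]
      rintro rfl
      exact h ((Finset.mem_filter.1 hv).2.symm.trans (Finset.mem_filter.1 hw).2)
  sum_e := by
    rw [← ρ.sum_e]
    exact Finset.sum_fiberwise Finset.univ g.mapV ρ.e
  e_mul_x b := by
    rw [Finset.mul_sum]
    refine Finset.sum_congr rfl fun a ha => ?_
    rw [← (Finset.mem_filter.1 ha).2, g.tgt_mapE, ← ρ.e_mul_x a, ← mul_assoc, ρ.sum_e_mul_e]
  x_mul_e b := by
    rw [Finset.sum_mul]
    refine Finset.sum_congr rfl fun a ha => ?_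
    rw [← (Finset.mem_filter.1 ha).2, g.src_mapE, ← ρ.x_mul_e a, mul_assoc, ρ.e_mul_sum_e]

/-- α and β have different sources, so the idempotent at `s(a)` isolates one preimage of `a*`. -/
theorem glue_x_mul_e (a : E) : (ρ.glue g).x (g.mapE a) * ρ.e (Q.src a) = ρ.x a := by
  change (∑ b with g.mapE b = g.mapE a, ρ.x b) * _ = _
  rw [Finset.sum_mul, Finset.sum_eq_single a]
  · exact ρ.x_mul_e a
  · intro b hb hba
    refine ρ.x_mul_e_of_ne fun h => ?_
    have hn := g.nodup'
    have := g.mapE_eq_mapE (Finset.mem_filter.1 hb).2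
    grind
  · simp

theorem glue_walkVal_mul_e {v : V} {l : List E} (h : Q.IsWalk v l) :
    (ρ.glue g).walkVal (g.mapV v) (l.map g.mapE) * ρ.e v = ρ.walkVal v l := by
  induction l generalizing v with
  | nil => exact ρ.sum_e_mul_e g v
  | cons a l ih =>
    rw [List.map_cons, walkVal, walkVal, mul_assoc, ← h.1, glue_x_mul_e, g.tgt_mapE,
      ← ρ.e_mul_x a, ← mul_assoc, ih h.2, ρ.e_mul_x a]

theorem glue_val_mapPath_mul_e (p : Q.Path) :
    (ρ.glue g).val (g.mapPath p) * ρ.e p.start = ρ.val p :=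
  ρ.glue_walkVal_mul_e g p.isWalk

variable {g} (hα : Q.IsSourceArrow g.α) (hβ : Q.IsSinkArrow g.β)

-- Only one pair of preimages composes. Nothing starts at `t(β)`, so `a` is not β, and if it is α,
-- the other preimage β contributes nothing. The idempotent at `t(a)` then isolates `b`.
include hα hβ in
theorem glue_x_mul_glue_x {a b : E} (h : Q.src b = Q.tgt a) :
    (ρ.glue g).x (g.mapE b) * (ρ.glue g).x (g.mapE a) = ρ.x b * ρ.x a := by
  change (ρ.glue g).x (g.mapE b) * ∑ a' with g.mapE a' = g.mapE a, ρ.x a' = _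
  rw [Finset.mul_sum, Finset.sum_eq_single a]
  · rw [← ρ.e_mul_x a, ← mul_assoc, ← h, glue_x_mul_e, h, ρ.e_mul_x]
  · intro a' ha' hne
    change (∑ b' with g.mapE b' = g.mapE b, ρ.x b') * _ = 0
    rw [Finset.sum_mul]
    refine Finset.sum_eq_zero fun b' _ => ρ.x_mul_x_of_ne fun h' => ?_
    obtain h₁ | ⟨rfl, rfl⟩ | ⟨rfl, rfl⟩ := g.mapE_eq_mapE (Finset.mem_filter.1 ha').2
    · exact hne h₁
    · exact hβ.1 _ h
    · exact hβ.1 _ h'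
  · simp

-- Nothing ends at `s(α)` and nothing starts at `t(β)`, so the term of α kills the right factor and
-- that of β the left one. This is why the new relations `ξ* γ* η*` hold in `A`.
include hα hβ in
theorem glue_x_mul_glue_γ_mul_glue_x (b b' : g.Arr) :
    (ρ.glue g).x b * (ρ.glue g).x g.γ * (ρ.glue g).x b' = 0 := by
  change (∑ a with g.mapE a = b, ρ.x a) * (∑ a with g.mapE a = g.γ, ρ.x a) *
    (∑ a with g.mapE a = b', ρ.x a) = 0
  rw [Finset.sum_mul_sum, Finset.sum_mul]
  refine Finset.sum_eq_zero fun a _ => ?_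
  rw [Finset.sum_mul]
  refine Finset.sum_eq_zero fun c hc => ?_
  rw [Finset.mul_sum]
  refine Finset.sum_eq_zero fun a' _ => ?_
  obtain rfl | rfl := g.mapE_eq_γ.1 (Finset.mem_filter.1 hc).2
  · rw [mul_assoc, ρ.x_mul_x_of_ne (b := a') fun h => hα.1 _ h.symm, mul_zero]
  · rw [ρ.x_mul_x_of_ne (a := a) (hβ.1 _), zero_mul]

-- The first two arrows already determine the lift: their glued product is a single product, whose
-- end vertex selects the lifts of all later arrows. Glued vertices and γ* alone have two lifts.
include hα hβ in
theorem glue_val_mapPath {p : Q.Path} (hp : 2 ≤ p.length) :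
    (ρ.glue g).val (g.mapPath p) = ρ.val p := by
  obtain ⟨v, l, h⟩ := p
  match l, h, hp with
  | a :: b :: l, h, _ =>
    change (ρ.glue g).walkVal (g.quiver.tgt (g.mapE b)) (l.map g.mapE) *
      (ρ.glue g).x (g.mapE b) * (ρ.glue g).x (g.mapE a) = ρ.walkVal (Q.tgt b) l * ρ.x b * ρ.x a
    rw [mul_assoc, ρ.glue_x_mul_glue_x hα hβ h.2.1, g.tgt_mapE, ← ρ.e_mul_x b, mul_assoc,
      ← mul_assoc, ρ.glue_walkVal_mul_e g h.2.2, ρ.e_mul_x b, ← mul_assoc]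

end Rep

namespace MonAlg

variable (k : Type*) [Field k] {V E : Type*} [DecidableEq V] [Fintype V] {Q : Qvr V E}
  (Z : Set Q.Path)

/-- The representation of `Q` in `kQ/⟨Z⟩`. -/
def rep : Rep Q (MonAlg k Q Z) where
  e := vertex k Z
  x := arrow k Z
  e_mul_e := vertex_mul_vertex
  sum_e := sum_vertex
  e_mul_x a := by rw [vertex_mul_arrow, if_pos rfl]
  x_mul_e a := by rw [arrow_mul_vertex, if_pos rfl]

theorem rep_val (p : Q.Path) : (rep k Z).val p = path k Z p := by
  obtain ⟨v, l, h⟩ := p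
  induction l generalizing v with
  | nil => rfl
  | cons a l ih =>
    rw [path_cons, ← ih]
    rfl

end MonAlg

/-! ### The embedding of the glued algebra -/

section Embedding

variable {k : Type*} [Field k] {V E : Type*} [Fintype V] [DecidableEq V] [Fintype E]
  [DecidableEq E] {Q : Qvr V E} {g : Q.GluePair} {Z : Set Q.Path}

/-- A path of length at least two is determined by its image in the glued quiver. -/
theorem mapPath_injective_of_two_le (hα : Q.IsSourceArrow g.α) (hβ : Q.IsSinkArrow g.β)
    {p q : Q.Path} (hp : 2 ≤ p.length) (h : g.mapPath p = g.mapPath q) : p = q := by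
  have hq : 2 ≤ q.length := by rwa [← g.length_mapPath, ← h, g.length_mapPath]
  -- Without relations all paths are linearly independent, so the paths may be compared in the path
  -- algebra; the field is immaterial.
  have h₁ : MonAlg.path ℚ ∅ p = MonAlg.path ℚ ∅ q := by
    rw [← MonAlg.rep_val, ← MonAlg.rep_val, ← Rep.glue_val_mapPath _ hα hβ hp,
      ← Rep.glue_val_mapPath _ hα hβ hq, h]
  have h₂ := congrArg (MonAlg.nf ℚ ∅) h₁
  rw [MonAlg.nf_path_of_mem (by simp [Qvr.basisPaths]),
    MonAlg.nf_path_of_mem (by simp [Qvr.basisPaths])] at h₂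
  exact Finsupp.single_left_injective one_ne_zero h₂

/-- A representation of `Q` that satisfies the relations `Z` yields a representation of the glued
quiver that satisfies the glued relations. -/
theorem glue_val_of_mem_relations {R : Type*} [Ring R] (ρ : Rep Q R)
    (hα : Q.IsSourceArrow g.α) (hβ : Q.IsSinkArrow g.β) (hZ : ∀ z ∈ Z, 2 ≤ z.length)
    (hρ : ∀ z ∈ Z, ρ.val z = 0) {p : g.quiver.Path} (hp : p ∈ g.relations Z) :
    (ρ.glue g).val p = 0 := by
  obtain ⟨z, hz, rfl⟩ | hp := hp
  · rw [ρ.glue_val_mapPath hα hβ (hZ z hz), hρ z hz]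
  · obtain ⟨η, ξ, -, -, h⟩ := (g.mem_newPaths hα hβ).1 hp
    rw [Rep.val, h]
    change (ρ.glue g).e _ * (ρ.glue g).x (g.mapE ξ) * (ρ.glue g).x g.γ *
      (ρ.glue g).x (g.mapE η) = 0
    rw [mul_assoc, mul_assoc, ← mul_assoc ((ρ.glue g).x _),
      ρ.glue_x_mul_glue_γ_mul_glue_x hα hβ, mul_zero]

variable (k) in
/-- The embedding of the glued algebra into `kQ/⟨Z⟩`. -/
def embed (hα : Q.IsSourceArrow g.α) (hβ : Q.IsSinkArrow g.β) (hZ : ∀ z ∈ Z, 2 ≤ z.length) :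
    GluedAlg k g Z →ₐ[k] MonAlg k Q Z :=
  MonAlg.lift (((MonAlg.rep k Z).glue g).lift k) fun z hz => by
    rw [Rep.lift_of]
    refine glue_val_of_mem_relations _ hα hβ hZ (fun z hz => ?_) hz
    rw [MonAlg.rep_val, MonAlg.path_of_mem hz]

variable (hα : Q.IsSourceArrow g.α) (hβ : Q.IsSinkArrow g.β) (hZ : ∀ z ∈ Z, 2 ≤ z.length)

theorem embed_path (p : g.quiver.Path) :
    embed k hα hβ hZ (MonAlg.path k (g.relations Z) p) = ((MonAlg.rep k Z).glue g).val p :=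
  Rep.lift_of _ p

theorem embed_vertex (f : g.Vert) :
    embed k hα hβ hZ (MonAlg.vertex k (g.relations Z) f) = vertexSum k g Z f :=
  embed_path hα hβ hZ _

theorem embed_arrow (b : g.Arr) :
    embed k hα hβ hZ (MonAlg.arrow k (g.relations Z) b) = arrowSum k g Z b :=
  (embed_path hα hβ hZ _).trans (Rep.val_ofArrow _ b)

theorem embed_path_mapPath_mul_vertex (p : Q.Path) :
    embed k hα hβ hZ (MonAlg.path k (g.relations Z) (g.mapPath p)) *
      MonAlg.vertex k Z p.start = MonAlg.path k Z p := by
  rw [embed_path, ← MonAlg.rep_val, ← Rep.glue_val_mapPath_mul_e _ g p]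
  rfl

theorem embed_path_mapPath {p : Q.Path} (hp : 2 ≤ p.length) :
    embed k hα hβ hZ (MonAlg.path k (g.relations Z) (g.mapPath p)) = MonAlg.path k Z p := by
  rw [embed_path, Rep.glue_val_mapPath _ hα hβ hp, MonAlg.rep_val]

theorem range_embed : (embed k hα hβ hZ).range = gluedSubalgebra k g Z := by
  rw [gluedSubalgebra, ← Algebra.map_top, ← MonAlg.adjoin_eq_top, AlgHom.map_adjoin,
    Set.image_union, ← Set.range_comp, ← Set.range_comp,
    show ⇑(embed k hα hβ hZ) ∘ MonAlg.vertex k (g.relations Z) = vertexSum k g Z from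
      funext (embed_vertex hα hβ hZ),
    show ⇑(embed k hα hβ hZ) ∘ MonAlg.arrow k (g.relations Z) = arrowSum k g Z from
      funext (embed_arrow hα hβ hZ)]

-- From right to left no subpath has to be lifted: if `p*` contained a relation, it would vanish in
-- the glued algebra, whereas its image in `A`, multiplied by `s(p)`, is `p ≠ 0`.
include hα hβ hZ in
theorem mapPath_mem_basisPaths {p : Q.Path} :
    g.mapPath p ∈ g.quiver.basisPaths (g.relations Z) ↔ p ∈ Q.basisPaths Z := by
  constructor
  · intro hp z hz hzp
    exact hp (g.mapPath z) (Or.inl ⟨z, hz, rfl⟩) (hzp.map g.mapE)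
  · intro hp
    by_contra h
    refine MonAlg.path_ne_zero (k := ℚ) hp ?_
    rw [← embed_path_mapPath_mul_vertex hα hβ hZ p,
      MonAlg.path_eq_zero (g.two_le_length_of_mem_relations hZ) h, map_zero, zero_mul]

include hα hβ in
/-- A walk that starts with an arrow other than `γ*` can be lifted. -/
theorem exists_lift_walk {b : g.Arr} (hb : b ≠ g.γ) {l : List g.Arr} {v : g.Vert}
    (h : g.quiver.IsWalk v (b :: l)) (hp : (⟨v, b :: l, h⟩ : g.quiver.Path) ∈
      g.quiver.basisPaths (g.relations Z)) :
    ∃ m, Q.IsWalk (Q.src b.1) (b.1 :: m) ∧ (b.1 :: m).map g.mapE = b :: l := by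
  induction l generalizing b v with
  | nil => exact ⟨[], ⟨rfl, trivial⟩, by simp [g.mapE_val]⟩
  | cons c l ih =>
    have hn := g.nodup'
    by_cases hc : c = g.γ
    · subst hc
      have h₁ : g.mapV (Q.src g.α) = g.mapV (Q.tgt b.1) := h.2.1
      have h₂ : Q.tgt b.1 = Q.src g.β := by
        rw [g.mapV_src_α] at h₁
        exact (g.mapV_eq_f₁.1 h₁.symm).resolve_left (hα.1 _)
      cases l with
      | nil =>
        refine ⟨[g.β], ⟨rfl, h₂.symm, trivial⟩, ?_⟩
        simp [g.mapE_val, g.mapE_β]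
      | cons d l =>
        exfalso
        have h₃ : g.mapV (Q.src d.1) = g.mapV (Q.tgt g.α) := h.2.2.1
        have h₄ : Q.src d.1 = Q.tgt g.α := by
          rw [g.mapV_tgt_α] at h₃
          exact (g.mapV_eq_f₂.1 h₃).resolve_right (hβ.1 _)
        refine hp ⟨v, [b, g.γ, d], h.1, h.2.1, h.2.2.1, trivial⟩ (Or.inr ?_)
          (List.prefix_append _ l).isInfix
        exact (g.mem_newPaths hα hβ).2 ⟨b.1, d.1, h₂, h₄, by simp only [g.mapE_val]⟩
    · obtain ⟨m, hm, hm'⟩ := ih hc h.2 (Qvr.basisPaths_of_infix hp (List.suffix_cons b _).isInfix)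
      refine ⟨c.1 :: m, ⟨rfl, ?_, hm.2⟩, ?_⟩
      · have h₁ : g.mapV (Q.src c.1) = g.mapV (Q.tgt b.1) := h.2.1
        have hc' : c.1 ≠ g.α := fun h => hc (Subtype.ext h)
        have hb' : b.1 ≠ g.α := fun h => hb (Subtype.ext h)
        -- For two arrows other than α and β, every way in which gluing could create a new composite
        -- is excluded.
        obtain h₂ | ⟨h₂, -⟩ | ⟨h₂, -⟩ | ⟨-, h₂⟩ | ⟨h₂, -⟩ := g.mapV_eq_mapV h₁
        · exact h₂
        · exact (hc' (hα.2.1 _ h₂)).elim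
        · exact (c.2 (hβ.2.1 _ h₂)).elim
        · exact (b.2 (hβ.2.2 _ h₂)).elim
        · exact (hβ.1 _ h₂).elim
      · rw [List.map_cons, hm', g.mapE_val]

-- A leading γ* that is followed by an arrow stands for α, since nothing starts at `t(β)`; a later
-- γ* stands for β. For a trivial path or γ* alone, one of the possible lifts is chosen.
include hα hβ in
theorem exists_mapPath_eq {p : g.quiver.Path}
    (hp : p ∈ g.quiver.basisPaths (g.relations Z)) : ∃ q, g.mapPath q = p := by
  obtain ⟨v, l, h⟩ := p
  have key : ∀ q : Q.Path, l ≠ [] → q.arrows.map g.mapE = l →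
      g.mapPath q = ⟨v, l, h⟩ := by
    rintro ⟨w, m, hm⟩ hl rfl
    ext1
    · cases m with
      | nil => exact (hl rfl).elim
      | cons a m =>
        refine Eq.trans ?_ h.1
        rw [g.src_mapE, hm.1]
        rfl
    · rfl
  cases l with
  | nil =>
    refine ⟨Qvr.Path.trivial Q v.1, ?_⟩
    rw [g.mapPath_trivial, g.mapV_val]
    rfl
  | cons b l =>
    by_cases hb : b = g.γ
    · subst hb
      cases l with
      | nil => exact ⟨Qvr.Path.ofArrow Q g.α, key _ (by simp) (by simp [Qvr.Path.ofArrow, g.mapE_α])⟩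
      | cons c l =>
        have h₁ : g.mapV (Q.src c.1) = g.mapV (Q.tgt g.α) := h.2.1
        rw [g.mapV_tgt_α] at h₁
        have h₂ : Q.src c.1 = Q.tgt g.α := (g.mapV_eq_f₂.1 h₁).resolve_right (hβ.1 _)
        have hc : c ≠ g.γ := by
          rintro rfl
          exact g.nodup'.1.1 h₂
        obtain ⟨m, hm, hm'⟩ := exists_lift_walk hα hβ hc h.2
          (Qvr.basisPaths_of_infix hp (List.suffix_cons _ _).isInfix)
        refine ⟨⟨Q.src g.α, g.α :: c.1 :: m, rfl, h₂, hm.2⟩, key _ (by simp) ?_⟩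
        rw [List.map_cons, hm', g.mapE_α]
    · obtain ⟨m, hm, hm'⟩ := exists_lift_walk hα hβ hb h hp
      exact ⟨⟨_, _, hm⟩, key _ (by simp) hm'⟩

open Classical in
theorem nf_vertexSum (hZ : ∀ z ∈ Z, 2 ≤ z.length) (f : g.Vert) (p : Q.Path) :
    MonAlg.nf k Z (vertexSum k g Z f) p =
      if Qvr.Path.trivial g.quiver f = g.mapPath p then 1 else 0 := by
  have h : ∀ v, MonAlg.nf k Z (MonAlg.vertex k Z v) =
      Finsupp.single (Qvr.Path.trivial Q v) 1 := fun v => MonAlg.nf_path_of_mem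
    (Qvr.mem_basisPaths_of_length_le_one hZ (by simp [Qvr.Path.trivial, Qvr.Path.length]))
  rw [vertexSum, map_sum, Finsupp.finsetSum_apply]
  simp only [h, Finsupp.single_apply]
  split_ifs with hp
  · have hp₁ : f = g.mapV p.start := congrArg Qvr.Path.start hp
    have hp₂ : [] = p.arrows.map g.mapE := congrArg Qvr.Path.arrows hp
    rw [Finset.sum_eq_single p.start]
    · rw [if_pos]
      ext1
      · rfl
      · exact (List.map_eq_nil_iff.1 hp₂.symm).symm
    · exact fun v _ hv => if_neg fun h' => hv (congrArg Qvr.Path.start h')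
    · exact fun hv => (hv (Finset.mem_filter.2 ⟨Finset.mem_univ _, hp₁.symm⟩)).elim
  · refine Finset.sum_eq_zero fun v hv => if_neg ?_
    rintro rfl
    exact hp (by rw [g.mapPath_trivial, (Finset.mem_filter.1 hv).2])

open Classical in
theorem nf_arrowSum (hZ : ∀ z ∈ Z, 2 ≤ z.length) (b : g.Arr) (p : Q.Path) :
    MonAlg.nf k Z (arrowSum k g Z b) p =
      if Qvr.Path.ofArrow g.quiver b = g.mapPath p then 1 else 0 := by
  have h : ∀ a, MonAlg.nf k Z (MonAlg.arrow k Z a) =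
      Finsupp.single (Qvr.Path.ofArrow Q a) 1 := fun v => MonAlg.nf_path_of_mem
    (Qvr.mem_basisPaths_of_length_le_one hZ (by simp [Qvr.Path.ofArrow, Qvr.Path.length]))
  rw [arrowSum, map_sum, Finsupp.finsetSum_apply]
  simp only [h, Finsupp.single_apply]
  split_ifs with hp
  · obtain ⟨v, m, hm⟩ := p
    have hp₂ : [b] = m.map g.mapE := congrArg Qvr.Path.arrows hp
    match m, hm, hp₂ with
    | [a], hm, hp₂ =>
      have hab : g.mapE a = b := (List.cons.inj hp₂).1.symm
      rw [Finset.sum_eq_single a]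
      · rw [if_pos]
        ext1
        · exact hm.1
        · rfl
      · exact fun c _ hc => if_neg fun h' =>
          hc (List.cons.inj (congrArg Qvr.Path.arrows h')).1
      · exact fun ha => (ha (Finset.mem_filter.2 ⟨Finset.mem_univ _, hab⟩)).elim
  · refine Finset.sum_eq_zero fun a ha => if_neg ?_
    rintro rfl
    exact hp (by rw [g.mapPath_ofArrow, (Finset.mem_filter.1 ha).2])

/-- In the bases `𝓑`, the matrix of `embed` is the incidence matrix of `p ↦ p*`: a basis path goes
to the sum of its lifts. As every basis path has a lift, injectivity follows. -/
theorem nf_embed {p : Q.Path} (x : GluedAlg k g Z) :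
    MonAlg.nf k Z (embed k hα hβ hZ x) p = MonAlg.nf k (g.relations Z) x (g.mapPath p) := by
  classical
  have h : Finsupp.lapply p ∘ₗ MonAlg.nf k Z ∘ₗ (embed k hα hβ hZ).toLinearMap =
      Finsupp.lapply (g.mapPath p) ∘ₗ MonAlg.nf k (g.relations Z) := by
    refine MonAlg.linearMap_ext fun r => ?_
    simp only [LinearMap.comp_apply, AlgHom.toLinearMap_apply, Finsupp.lapply_apply]
    by_cases hr : r ∈ g.quiver.basisPaths (g.relations Z)
    · obtain ⟨q, rfl⟩ := exists_mapPath_eq hα hβ hr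
      have hq := (mapPath_mem_basisPaths hα hβ hZ).1 hr
      rw [MonAlg.nf_path_of_mem hr, Finsupp.single_apply]
      by_cases h2 : 2 ≤ q.length
      · rw [embed_path_mapPath hα hβ hZ h2, MonAlg.nf_path_of_mem hq, Finsupp.single_apply]
        congr 1
        exact propext ⟨fun h => by rw [h], mapPath_injective_of_two_le hα hβ h2⟩
      · obtain ⟨v, l, hl⟩ := q
        match l, hl, h2 with
        | [], hl, _ =>
          exact (congrArg (fun x => MonAlg.nf k Z x p) (embed_vertex hα hβ hZ _)).trans
            (nf_vertexSum hZ _ p)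
        | [a], hl, _ =>
          obtain rfl : Q.src a = v := hl.1
          have h₁ : g.mapPath ⟨Q.src a, [a], hl⟩ = Qvr.Path.ofArrow g.quiver (g.mapE a) :=
            g.mapPath_ofArrow a
          rw [h₁]
          exact (congrArg (fun x => MonAlg.nf k Z x p) (embed_arrow hα hβ hZ _)).trans
            (nf_arrowSum hZ _ p)
        | a :: b :: l, _, h2 => exact (h2 (by simp [Qvr.Path.length])).elim
    · rw [MonAlg.path_eq_zero (g.two_le_length_of_mem_relations hZ) hr]
      simp
  exact DFunLike.congr_fun h x

theorem embed_injective : Function.Injective (embed k hα hβ hZ) := by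
  refine (injective_iff_map_eq_zero _).2 fun x hx => ?_
  refine MonAlg.nf_injective (g.two_le_length_of_mem_relations hZ) ?_
  rw [map_zero]
  ext r
  by_cases hr : r ∈ g.quiver.basisPaths (g.relations Z)
  · obtain ⟨q, rfl⟩ := exists_mapPath_eq hα hβ hr
    rw [← nf_embed hα hβ hZ, hx, map_zero]
    rfl
  · exact MonAlg.nf_apply_of_notMem x hr

end Embedding

/-! ### Paths at the ends of the glued arrows -/

namespace Qvr

variable {V E : Type*} {Q : Qvr V E}

/-- The last arrow of a path of positive length. -/
theorem Path.exists_eq_append (p : Q.Path) (hp : p.arrows ≠ []) :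
    ∃ m b, p.arrows = m ++ [b] ∧ Q.IsWalk p.start m ∧ Q.src b = Q.walkEnd p.start m ∧
      Q.tgt b = p.target := by
  obtain ⟨v, l, h⟩ := p
  obtain rfl | ⟨m, b, rfl⟩ := l.eq_nil_or_concat'
  · exact (hp rfl).elim
  · obtain ⟨h₁, h₂⟩ := isWalk_append.1 h
    exact ⟨m, b, rfl, h₁, h₂.1, (walkEnd_append (m := [b])).symm⟩

theorem Path.exists_src_eq_start (p : Q.Path) (hp : p.arrows ≠ []) : ∃ b, Q.src b = p.start := by
  obtain ⟨v, l, h⟩ := p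
  cases l with
  | nil => exact (hp rfl).elim
  | cons b l => exact ⟨b, h.1⟩

theorem Path.arrows_eq_nil_of_target {p : Q.Path} (h : ∀ b, Q.tgt b ≠ p.target) :
    p.arrows = [] := by
  by_contra hp
  obtain ⟨_, b, _, _, _, hb⟩ := p.exists_eq_append hp
  exact h b hb

theorem Path.arrows_eq_nil_of_start {p : Q.Path} (h : ∀ b, Q.src b ≠ p.start) :
    p.arrows = [] := by
  by_contra hp
  obtain ⟨b, hb⟩ := p.exists_src_eq_start hp
  exact h b hb

theorem Path.target_eq_start {p : Q.Path} (h : p.arrows = []) : p.target = p.start := by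
  rw [target, h]
  rfl

theorem Path.eq_trivial {p : Q.Path} (h : p.arrows = []) : p = Path.trivial Q p.start := by
  ext1
  · rfl
  · exact h

/-- A nontrivial path that ends at the target of a source arrow is this arrow. -/
theorem IsSourceArrow.path_of_target {a : E} (ha : Q.IsSourceArrow a) {p : Q.Path}
    (hp : p.arrows ≠ []) (ht : p.target = Q.tgt a) : p = Path.ofArrow Q a := by
  obtain ⟨m, b, hm, hw, hs, hb⟩ := p.exists_eq_append hp
  obtain rfl := ha.2.2 b (hb.trans ht)
  have hm' : m = [] := Path.arrows_eq_nil_of_target (p := ⟨p.start, m, hw⟩)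
    fun c hc => ha.1 c (hc.trans hs.symm)
  subst hm'
  ext1
  · exact hs.symm
  · exact hm

/-- A nontrivial path that starts at the source of a sink arrow is this arrow. -/
theorem IsSinkArrow.path_of_start {a : E} (ha : Q.IsSinkArrow a) {p : Q.Path}
    (hp : p.arrows ≠ []) (hs : p.start = Q.src a) : p = Path.ofArrow Q a := by
  obtain ⟨v, l, h⟩ := p
  cases l with
  | nil => exact (hp rfl).elim
  | cons b l =>
    obtain rfl := ha.2.1 b (h.1.trans hs)
    have hl : l = [] := Path.arrows_eq_nil_of_start (p := ⟨Q.tgt b, l, h.2⟩) ha.1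
    subst hl
    ext1
    · exact hs
    · rfl

end Qvr

/-! ### Fibres of the gluing over vertices and arrows -/

section Fibres

variable {k : Type*} [Field k] {V E : Type*} [Fintype V] [DecidableEq V] [Fintype E]
  [DecidableEq E] {Q : Qvr V E} {g : Q.GluePair} {Z : Set Q.Path}

theorem arrowSum_mapE {a : E} (h₁ : a ≠ g.α) (h₂ : a ≠ g.β) :
    arrowSum k g Z (g.mapE a) = MonAlg.arrow k Z a := by
  rw [arrowSum, Finset.sum_eq_single a]
  · intro b hb hba
    have := g.mapE_eq_mapE (Finset.mem_filter.1 hb).2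
    grind
  · simp

theorem arrowSum_γ : arrowSum k g Z g.γ = MonAlg.arrow k Z g.α + MonAlg.arrow k Z g.β := by
  rw [arrowSum, ← Finset.sum_pair g.α_ne_β]
  congr 1
  ext a
  simp [g.mapE_eq_γ]

theorem vertexSum_mapV {v : V} (h₁ : v ≠ Q.src g.α) (h₂ : v ≠ Q.tgt g.α) (h₃ : v ≠ Q.src g.β)
    (h₄ : v ≠ Q.tgt g.β) : vertexSum k g Z (g.mapV v) = MonAlg.vertex k Z v := by
  rw [vertexSum, Finset.sum_eq_single v]
  · intro w hw hwv
    have := g.mapV_eq_mapV (Finset.mem_filter.1 hw).2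
    grind
  · simp

theorem vertexSum_f₂ :
    vertexSum k g Z g.f₂ = MonAlg.vertex k Z (Q.tgt g.α) + MonAlg.vertex k Z (Q.tgt g.β) := by
  rw [vertexSum, ← Finset.sum_pair g.nodup'.2.1.2]
  congr 1
  ext a
  simp [g.mapV_eq_f₂]

variable (hα : Q.IsSourceArrow g.α) (hβ : Q.IsSinkArrow g.β) (hZ : ∀ z ∈ Z, 2 ≤ z.length)

include hα hβ in
/-- The paths whose image is parallel to the image of an arrow other than `α` and `β` are parallel
to this arrow. -/
theorem parallel_of_mapPath_parallel {a : E} (h₁ : a ≠ g.α) (h₂ : a ≠ g.β) {p : Q.Path}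
    (hs : g.mapV p.start = g.mapV (Q.src a)) (ht : g.mapV p.target = g.mapV (Q.tgt a)) :
    p.start = Q.src a ∧ p.target = Q.tgt a := by
  have hsα := mt (hα.2.1 a) h₁
  have htα := mt (hα.2.2 a) h₁
  have hsβ := mt (hβ.2.1 a) h₂
  have htβ := mt (hβ.2.2 a) h₂
  have hα₁ := hα.1 a
  have hβ₁ := hβ.1 a
  have hn := g.nodup'
  have hs' := g.mapV_eq_mapV hs
  have ht' := g.mapV_eq_mapV ht
  -- If `p` ended at the wrong preimage e₁ of `s(β)` or started at the wrong preimage eₙ of `t(α)`,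
  -- it would be trivial, and its other end would not match `a`.
  have h₃ : p.target = Q.src g.α → p.start = Q.src g.α := fun h => by
    rw [← h, Qvr.Path.target_eq_start (Qvr.Path.arrows_eq_nil_of_target (h ▸ hα.1))]
  have h₄ : p.start = Q.tgt g.β → p.target = Q.tgt g.β := fun h => by
    rw [← h, Qvr.Path.target_eq_start (Qvr.Path.arrows_eq_nil_of_start (h ▸ hβ.1))]
  grind

/-- Only a path of length at most one could have a sum of two paths as image. Being parallel to an
arrow other than α and β, it is neither a glued vertex nor α or β. -/
theorem embed_path_mapPath_of_parallel {a : E} (h₁ : a ≠ g.α) (h₂ : a ≠ g.β) {p : Q.Path}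
    (hs : p.start = Q.src a) (ht : p.target = Q.tgt a) :
    embed k hα hβ hZ (MonAlg.path k (g.relations Z) (g.mapPath p)) = MonAlg.path k Z p := by
  have hsα := mt (hα.2.1 a) h₁
  have htα := mt (hα.2.2 a) h₁
  have hsβ := mt (hβ.2.1 a) h₂
  have htβ := mt (hβ.2.2 a) h₂
  obtain ⟨v, l, h⟩ := p
  match l, h, hs, ht with
  | [], h, hs, ht =>
    refine (embed_vertex hα hβ hZ (g.mapV v)).trans (vertexSum_mapV ?_ ?_ ?_ ?_)
    · rwa [← hs] at hsα
    · rwa [← ht] at htα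
    · rwa [← hs] at hsβ
    · rwa [← ht] at htβ
  | [b], h, hs, ht =>
    obtain rfl : Q.src b = v := h.1
    change Q.src b = _ at hs
    have h₃ : g.mapPath ⟨Q.src b, [b], h⟩ = Qvr.Path.ofArrow g.quiver (g.mapE b) :=
      g.mapPath_ofArrow b
    rw [h₃]
    refine (embed_arrow hα hβ hZ (g.mapE b)).trans (arrowSum_mapE ?_ ?_)
    · rintro rfl
      exact hsα hs.symm
    · rintro rfl
      exact hsβ hs.symm
  | b :: c :: l, h, _, _ => exact embed_path_mapPath hα hβ hZ (by simp [Qvr.Path.length])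

/-! ### The map `ψ₁` and the evaluation at an arrow -/

theorem psi1_single (x : Q.ArrowPar Z) (c : k) : psi1 k g Z (Finsupp.single x c) =
    c • arrowPar k (g.relations Z) (g.mapE x.1.1) (g.mapPath x.1.2) := by
  simp [psi1]

theorem start_mapPath_of_par (x : Q.ArrowPar Z) :
    (g.mapPath x.1.2).start = g.quiver.src (g.mapE x.1.1) := by
  rw [g.src_mapE, ← x.2.2.1]
  rfl

theorem target_mapPath_of_par (x : Q.ArrowPar Z) :
    (g.mapPath x.1.2).target = g.quiver.tgt (g.mapE x.1.1) := by
  rw [g.tgt_mapE, ← x.2.2.2, g.target_mapPath]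

include hα hβ in
theorem psi1_arrowPar (hZ : ∀ z ∈ Z, 2 ≤ z.length) (a : E) {p : Q.Path} (h₁ : p.start = Q.src a)
    (h₂ : p.target = Q.tgt a) : psi1 k g Z (arrowPar k Z a p) =
      arrowPar k (g.relations Z) (g.mapE a) (g.mapPath p) := by
  by_cases hp : p ∈ Q.basisPaths Z
  · rw [arrowPar_of_mem k Z ⟨hp, h₁, h₂⟩]
    exact (psi1_single ⟨(a, p), hp, h₁, h₂⟩ 1).trans (one_smul _ _)
  · rw [arrowPar_of_notMem k Z hp, map_zero, arrowPar_of_notMem]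
    rwa [mapPath_mem_basisPaths hα hβ hZ]

theorem embed_evArrow_psi1 {a : E} (h₁ : a ≠ g.α) (h₂ : a ≠ g.β) (x : Q.ArrowPar Z →₀ k) :
    embed k hα hβ hZ (evArrow k (g.relations Z) (g.mapE a) (psi1 k g Z x)) = evArrow k Z a x := by
  classical
  have h : (embed k hα hβ hZ).toLinearMap ∘ₗ evArrow k (g.relations Z) (g.mapE a) ∘ₗ
      psi1 k g Z = evArrow k Z a := by
    refine Finsupp.lhom_ext fun x c => ?_
    simp only [LinearMap.comp_apply, AlgHom.toLinearMap_apply, psi1_single, map_smul]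
    rw [evArrow_arrowPar (g.two_le_length_of_mem_relations hZ) _ _ (start_mapPath_of_par x)
      (target_mapPath_of_par x), evArrow_single]
    by_cases hx : x.1.1 = a
    · rw [if_pos hx, if_pos (by rw [hx]), embed_path_mapPath_of_parallel hα hβ hZ h₁ h₂
        (x.2.2.1.trans (by rw [hx])) (x.2.2.2.trans (by rw [hx]))]
    · rw [if_neg hx, if_neg, map_zero, smul_zero]
      intro h
      have := g.mapE_eq_mapE h
      grind
  exact DFunLike.congr_fun h x

-- The only pairs over γ* are `α ‖ α` and `β ‖ β`. Both go to `γ* ‖ γ*`, where their coefficients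
-- add up.
include hα hβ hZ in
theorem exists_evArrow_psi1_γ (x : Q.ArrowPar Z →₀ k) : ∃ c d : k,
    evArrow k Z g.α x = c • MonAlg.arrow k Z g.α ∧ evArrow k Z g.β x = d • MonAlg.arrow k Z g.β ∧
      evArrow k (g.relations Z) g.γ (psi1 k g Z x) =
        (c + d) • MonAlg.arrow k (g.relations Z) g.γ := by
  classical
  have hn := g.nodup'
  induction x using Finsupp.induction_linear with
  | zero => exact ⟨0, 0, by simp⟩
  | add x y hx hy =>
    obtain ⟨c, d, h₁, h₂, h₃⟩ := hx
    obtain ⟨c', d', h₁', h₂', h₃'⟩ := hy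
    refine ⟨c + c', d + d', ?_, ?_, ?_⟩
    · rw [map_add, h₁, h₁', add_smul]
    · rw [map_add, h₂, h₂', add_smul]
    · rw [map_add, map_add, h₃, h₃', ← add_smul]
      congr 1
      ring
  | single x c =>
    have hpsi : evArrow k (g.relations Z) g.γ (psi1 k g Z (Finsupp.single x c)) =
        if g.mapE x.1.1 = g.γ then c • MonAlg.path k (g.relations Z) (g.mapPath x.1.2) else 0 := by
      rw [psi1_single, map_smul, evArrow_arrowPar (g.two_le_length_of_mem_relations hZ) _ _
        (start_mapPath_of_par x) (target_mapPath_of_par x), smul_ite, smul_zero]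
      split_ifs <;> rfl
    rw [hpsi, evArrow_single, evArrow_single]
    by_cases h₁ : x.1.1 = g.α
    · have hx : x.1.2 = Qvr.Path.ofArrow Q g.α := by
        refine hα.path_of_target (fun h => ?_) (x.2.2.2.trans (by rw [h₁]))
        have := Qvr.Path.target_eq_start h
        rw [x.2.2.1, x.2.2.2, h₁] at this
        exact hn.1.1 this.symm
      refine ⟨c, 0, ?_, ?_, ?_⟩
      · rw [if_pos h₁, hx]
        rfl
      · rw [if_neg (h₁ ▸ g.α_ne_β), zero_smul]
      · rw [if_pos (g.mapE_eq_γ.2 (Or.inl h₁)), hx, add_zero, g.mapPath_ofArrow, g.mapE_α]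
        rfl
    · by_cases h₂ : x.1.1 = g.β
      · have hx : x.1.2 = Qvr.Path.ofArrow Q g.β := by
          refine hβ.path_of_start (fun h => ?_) (x.2.2.1.trans (by rw [h₂]))
          have := Qvr.Path.target_eq_start h
          rw [x.2.2.1, x.2.2.2, h₂] at this
          exact hn.2.2 this.symm
        refine ⟨0, c, ?_, ?_, ?_⟩
        · rw [if_neg h₁, zero_smul]
        · rw [if_pos h₂, hx]
          rfl
        · rw [if_pos (g.mapE_eq_γ.2 (Or.inr h₂)), hx, zero_add, g.mapPath_ofArrow, g.mapE_β]
          rfl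
      · refine ⟨0, 0, ?_, ?_, ?_⟩
        · rw [if_neg h₁, zero_smul]
        · rw [if_neg h₂, zero_smul]
        · rw [if_neg (fun h => (g.mapE_eq_γ.1 h).elim h₁ h₂), add_zero, zero_smul]

theorem evArrow_mem_range_embed {a : E} (h₁ : a ≠ g.α) (h₂ : a ≠ g.β) (x : Q.ArrowPar Z →₀ k) :
    evArrow k Z a x ∈ (embed k hα hβ hZ).range :=
  ⟨_, embed_evArrow_psi1 hα hβ hZ h₁ h₂ x⟩

/-! ### Restriction and extension of derivations -/

theorem exists_der_comp_eq {R S : Type*} [Ring R] [Algebra k R] [Ring S] [Algebra k S]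
    {ι : S →ₐ[k] R} (hι : Function.Injective ι) (D : Der k R)
    (h : ∀ x, D.1 (ι x) ∈ ι.range) : ∃ D' : Der k S, ∀ x, D.1 (ι x) = ι (D'.1 x) := by
  choose f hf using h
  change ∀ x, ι (f x) = D.1 (ι x) at hf
  refine ⟨⟨⟨⟨f, fun x y => hι ?_⟩, fun c x => hι ?_⟩, fun x y => hι ?_⟩, fun x => (hf x).symm⟩
  · rw [hf, map_add, map_add, map_add, hf, hf]
  · change ι (f (c • x)) = ι (c • f x)
    rw [hf, map_smul, map_smul, map_smul, hf]
  · change ι (f (x * y)) = ι (f x * y + x * f y)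
    rw [hf, map_mul, Der.leibniz, map_add, map_mul, map_mul, hf, hf]

theorem exists_restrict (D : Der k (MonAlg k Q Z))
    (hv : ∀ f, D.1 (vertexSum k g Z f) ∈ (embed k hα hβ hZ).range)
    (ha : ∀ b, D.1 (arrowSum k g Z b) ∈ (embed k hα hβ hZ).range) :
    ∃ D' : Der k (GluedAlg k g Z), ∀ x, D.1 (embed k hα hβ hZ x) = embed k hα hβ hZ (D'.1 x) := by
  refine exists_der_comp_eq (embed_injective hα hβ hZ) D fun x => ?_
  have hx : x ∈ Algebra.adjoin k (Set.range (MonAlg.vertex k (g.relations Z)) ∪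
      Set.range (MonAlg.arrow k (g.relations Z))) := by
    rw [MonAlg.adjoin_eq_top]
    trivial
  induction hx using Algebra.adjoin_induction with
  | mem x hx =>
    obtain ⟨v, rfl⟩ | ⟨a, rfl⟩ := hx
    · rw [embed_vertex]
      exact hv v
    · rw [embed_arrow]
      exact ha a
  | algebraMap c =>
    rw [Algebra.algebraMap_eq_smul_one, map_smul, map_smul, map_one, Der.map_one, smul_zero]
    exact zero_mem _
  | add x y _ _ hx hy =>
    rw [map_add, map_add]
    exact add_mem hx hy
  | mul x y _ _ hx hy =>
    rw [map_mul, Der.leibniz]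
    exact add_mem (mul_mem hx ⟨y, rfl⟩) (mul_mem ⟨x, rfl⟩ hy)

/-- Vanishing on α and β gives vanishing on γ*, and at every other arrow the value already lies in
the range by `embed_evArrow_psi1`. -/
theorem exists_restrict_of_eq_zero (D : Der k (MonAlg k Q Z))
    (hv : ∀ v, D.1 (MonAlg.vertex k Z v) = 0) (hDα : D.1 (MonAlg.arrow k Z g.α) = 0)
    (hDβ : D.1 (MonAlg.arrow k Z g.β) = 0) :
    ∃ D' : Der k (GluedAlg k g Z), ∀ x, D.1 (embed k hα hβ hZ x) = embed k hα hβ hZ (D'.1 x) := by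
  obtain ⟨y, hy⟩ := exists_realizes hZ hv
  refine exists_restrict hα hβ hZ D (fun f => ?_) fun b => ?_
  · rw [vertexSum, map_sum, Finset.sum_eq_zero fun v _ => hv v]
    exact zero_mem _
  · by_cases hb : b = g.γ
    · rw [hb, arrowSum_γ, map_add, hDα, hDβ, add_zero]
      exact zero_mem _
    · have hb' : b.1 ≠ g.α := fun h => hb (Subtype.ext h)
      rw [← g.mapE_val b, arrowSum_mapE hb' b.2, (realizes_iff.1 hy).2]
      exact evArrow_mem_range_embed hα hβ hZ hb' b.2 y

/-- A derivation `D` along an algebra homomorphism `ι`, as the homomorphism `ι + D ε` to the dual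
numbers. -/
def dualHom {R S : Type*} [Ring R] [Algebra k R] [Ring S] [Algebra k S] (ι : S →ₐ[k] R)
    (D : Der k S) : S →ₐ[k] TrivSqZeroExt R R :=
  AlgHom.ofLinearMap
    ((TrivSqZeroExt.inlAlgHom k R R).toLinearMap ∘ₗ ι.toLinearMap +
      (TrivSqZeroExt.inrHom R R).restrictScalars k ∘ₗ ι.toLinearMap ∘ₗ D.1)
    (by ext <;> simp [Der.map_one])
    (fun x y => by
      ext
      · simp
      · simp [Der.leibniz, add_comm])

theorem dualHom_apply {R S : Type*} [Ring R] [Algebra k R] [Ring S] [Algebra k S] (ι : S →ₐ[k] R)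
    (D : Der k S) (x : S) :
    dualHom ι D x = TrivSqZeroExt.inl (ι x) + TrivSqZeroExt.inr (ι (D.1 x)) := rfl

/-- The derivation that belongs to a section of the dual numbers. -/
def derOfDualHom {R : Type*} [Ring R] [Algebra k R] (Φ : R →ₐ[k] TrivSqZeroExt R R)
    (h : ∀ x, (Φ x).fst = x) : Der k R :=
  ⟨(TrivSqZeroExt.sndHom R R).restrictScalars k ∘ₗ Φ.toLinearMap, fun x y => by
    simp [h, add_comm]⟩

/-- A priori the value at `a*` lies only between glued vertices. Its image in `A` lies between the
actual ends of `a`, because each path that occurs lifts to one parallel to `a`; this is what a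
representation of `Q` requires. -/
theorem vertex_mul_embed_der {D : Der k (GluedAlg k g Z)}
    (hv : ∀ v, D.1 (MonAlg.vertex k (g.relations Z) v) = 0) {a : E} (h₁ : a ≠ g.α)
    (h₂ : a ≠ g.β) :
    MonAlg.vertex k Z (Q.tgt a) *
        embed k hα hβ hZ (D.1 (MonAlg.arrow k (g.relations Z) (g.mapE a))) =
      embed k hα hβ hZ (D.1 (MonAlg.arrow k (g.relations Z) (g.mapE a))) ∧
    embed k hα hβ hZ (D.1 (MonAlg.arrow k (g.relations Z) (g.mapE a))) *
        MonAlg.vertex k Z (Q.src a) =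
      embed k hα hβ hZ (D.1 (MonAlg.arrow k (g.relations Z) (g.mapE a))) := by
  classical
  obtain ⟨y, hy⟩ := exists_realizes (g.two_le_length_of_mem_relations hZ) hv
  rw [(realizes_iff.1 hy).2]
  clear hy
  induction y using Finsupp.induction_linear with
  | zero => simp
  | add y y' hy hy' =>
    simp only [map_add, mul_add, add_mul, hy.1, hy'.1, hy.2, hy'.2, and_self]
  | single x c =>
    rw [evArrow_single]
    split_ifs with hx
    · obtain ⟨p, hp⟩ := exists_mapPath_eq hα hβ x.2.1
      have hs : g.mapV p.start = g.mapV (Q.src a) := by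
        have h := x.2.2.1
        rw [← hp, hx, g.src_mapE] at h
        exact h
      have ht : g.mapV p.target = g.mapV (Q.tgt a) := by
        have h := x.2.2.2
        rw [← hp, hx, g.tgt_mapE, g.target_mapPath] at h
        exact h
      obtain ⟨hs', ht'⟩ := parallel_of_mapPath_parallel hα hβ h₁ h₂ hs ht
      rw [← hp, map_smul, embed_path_mapPath_of_parallel hα hβ hZ h₁ h₂ hs' ht', mul_smul_comm,
        smul_mul_assoc, MonAlg.vertex_mul_path, MonAlg.path_mul_vertex, if_pos ht', if_pos hs']
      exact ⟨rfl, rfl⟩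
    · simp

/-- A derivation of the glued algebra that kills the vertices and `γ*` extends. -/
theorem exists_extend (D : Der k (GluedAlg k g Z))
    (hv : ∀ v, D.1 (MonAlg.vertex k (g.relations Z) v) = 0)
    (hγ : D.1 (MonAlg.arrow k (g.relations Z) g.γ) = 0) :
    ∃ D' : Der k (MonAlg k Q Z), (∀ v, D'.1 (MonAlg.vertex k Z v) = 0) ∧
      D'.1 (MonAlg.arrow k Z g.α) = 0 ∧ D'.1 (MonAlg.arrow k Z g.β) = 0 ∧
      ∀ x, D'.1 (embed k hα hβ hZ x) = embed k hα hβ hZ (D.1 x) := by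
  obtain ⟨d, hd, hdα, hdβ, hdD⟩ : ∃ d : E → MonAlg k Q Z,
      (∀ a, MonAlg.vertex k Z (Q.tgt a) * d a = d a ∧ d a * MonAlg.vertex k Z (Q.src a) = d a) ∧
      d g.α = 0 ∧ d g.β = 0 ∧
      ∀ a, d a = embed k hα hβ hZ (D.1 (MonAlg.arrow k (g.relations Z) (g.mapE a))) := by
    refine ⟨fun a => embed k hα hβ hZ (D.1 (MonAlg.arrow k (g.relations Z) (g.mapE a))),
      fun a => ?_, ?_, ?_, fun a => rfl⟩
    · by_cases ha : g.mapE a = g.γ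
      · simp [ha, hγ]
      · exact vertex_mul_embed_der hα hβ hZ hv (fun h => ha (g.mapE_eq_γ.2 (Or.inl h)))
          (fun h => ha (g.mapE_eq_γ.2 (Or.inr h)))
    · simp [g.mapE_α, hγ]
    · simp [g.mapE_β, hγ]
  -- An extension of `D` amounts to an algebra map from `A` to its dual numbers lifting the
  -- identity, hence to a representation of `Q` there that satisfies `Z`. It sends `a` to `a + d(a)
  -- ε`.
  let ρ : Rep Q (TrivSqZeroExt (MonAlg k Q Z) (MonAlg k Q Z)) :=
    { e := fun v => TrivSqZeroExt.inl (MonAlg.vertex k Z v)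
      x := fun a => TrivSqZeroExt.inl (MonAlg.arrow k Z a) + TrivSqZeroExt.inr (d a)
      e_mul_e := fun v w => by
        rw [← TrivSqZeroExt.inl_mul, MonAlg.vertex_mul_vertex]
        split_ifs <;> simp
      sum_e := by
        rw [← TrivSqZeroExt.inl_sum, MonAlg.sum_vertex, TrivSqZeroExt.inl_one]
      e_mul_x := fun a => by
        rw [mul_add, ← TrivSqZeroExt.inl_mul, TrivSqZeroExt.inl_mul_inr, smul_eq_mul, (hd a).1,
          MonAlg.vertex_mul_arrow, if_pos rfl]
      x_mul_e := fun a => by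
        rw [add_mul, ← TrivSqZeroExt.inl_mul, TrivSqZeroExt.inr_mul_inl, op_smul_eq_mul, (hd a).2,
          MonAlg.arrow_mul_vertex, if_pos rfl] }
  let ψ := dualHom (embed k hα hβ hZ) D
  have hψv : ∀ f, ψ (MonAlg.vertex k (g.relations Z) f) = (ρ.glue g).e f := fun f => by
    rw [dualHom_apply, hv, map_zero, TrivSqZeroExt.inr_zero, add_zero, embed_vertex, vertexSum,
      TrivSqZeroExt.inl_sum]
    rfl
  have hψa : ∀ b, ψ (MonAlg.arrow k (g.relations Z) b) = (ρ.glue g).x b := fun b => by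
    have h : (ρ.glue g).x b = ∑ a with g.mapE a = b,
        (TrivSqZeroExt.inl (MonAlg.arrow k Z a) + TrivSqZeroExt.inr (d a)) := rfl
    rw [h, Finset.sum_add_distrib, ← TrivSqZeroExt.inl_sum, ← TrivSqZeroExt.inr_sum,
      dualHom_apply, embed_arrow]
    congr 2
    by_cases hb : b = g.γ
    · rw [hb, hγ, map_zero]
      refine (Finset.sum_eq_zero fun a ha => ?_).symm
      obtain rfl | rfl := g.mapE_eq_γ.1 (Finset.mem_filter.1 ha).2
      · exact hdα
      · exact hdβ
    · rw [Finset.sum_eq_single b.1]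
      · rw [hdD, g.mapE_val]
      · intro a ha hab
        have := g.mapE_eq_mapE ((Finset.mem_filter.1 ha).2.trans (g.mapE_val b).symm)
        have hb' : b.1 ≠ g.α := fun h => hb (Subtype.ext h)
        have := b.2
        grind
      · simp [g.mapE_val]
  have hψ : ψ.comp (MonAlg.proj k (g.relations Z)) = (ρ.glue g).lift k :=
    PathAlg.algHom_ext
      (fun f => (hψv f).trans (Rep.lift_of _ (Qvr.Path.trivial g.quiver f)).symm)
      (fun b => (hψa b).trans ((Rep.lift_of _ _).trans (Rep.val_ofArrow _ b)).symm)
  let Φ : MonAlg k Q Z →ₐ[k] TrivSqZeroExt (MonAlg k Q Z) (MonAlg k Q Z) :=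
    MonAlg.lift (ρ.lift k) fun z hz => by
      -- As `z` has length at least two, its value is that of `z*` under the glued representation,
      -- which is `ψ(z*) = 0`; nothing has to be computed with `d`.
      rw [Rep.lift_of, ← ρ.glue_val_mapPath hα hβ (hZ z hz), ← Rep.lift_of (k := k), ← hψ]
      change ψ (MonAlg.path k (g.relations Z) (g.mapPath z)) = 0
      rw [MonAlg.path_of_mem (Or.inl ⟨z, hz, rfl⟩), map_zero]
  have hΦv : ∀ v, Φ (MonAlg.vertex k Z v) = TrivSqZeroExt.inl (MonAlg.vertex k Z v) :=
    fun v => Rep.lift_of _ _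
  have hΦa : ∀ a, Φ (MonAlg.arrow k Z a) =
      TrivSqZeroExt.inl (MonAlg.arrow k Z a) + TrivSqZeroExt.inr (d a) :=
    fun a => (Rep.lift_of _ _).trans (Rep.val_ofArrow ρ a)
  have hΦ : ∀ x, (Φ x).fst = x := fun x => by
    have h : (TrivSqZeroExt.fstHom k (MonAlg k Q Z) (MonAlg k Q Z)).comp Φ = AlgHom.id k _ :=
      MonAlg.algHom_ext (fun v => by simp [hΦv]) (fun a => by simp [hΦa])
    exact DFunLike.congr_fun h x
  have hΦψ : Φ.comp (embed k hα hβ hZ) = ψ := by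
    refine MonAlg.algHom_ext (fun f => ?_) (fun b => ?_)
    · rw [hψv, AlgHom.comp_apply, embed_vertex, vertexSum, map_sum]
      exact Finset.sum_congr rfl fun v _ => hΦv v
    · rw [hψa, AlgHom.comp_apply, embed_arrow, arrowSum, map_sum]
      exact Finset.sum_congr rfl fun a _ => hΦa a
  refine ⟨derOfDualHom Φ hΦ, fun v => ?_, ?_, ?_, fun x => ?_⟩
  · change (Φ _).snd = 0
    simp [hΦv]
  · change (Φ _).snd = 0
    simp [hΦa, hdα]
  · change (Φ _).snd = 0
    simp [hΦa, hdβ]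
  · change ((Φ.comp (embed k hα hβ hZ)) x).snd = _
    rw [hΦψ]
    simp [ψ, dualHom_apply]

end Fibres

/-! ### The map `δ⁰` and gluing -/

section DeltaGlue

variable {k : Type*} [Field k] {V E : Type*} [Fintype V] [DecidableEq V] [Fintype E]
  [DecidableEq E] {Q : Qvr V E} {g : Q.GluePair} {Z : Set Q.Path}

theorem arrowPar_apply_ne_zero {V E : Type*} {Q : Qvr V E} {Z : Set Q.Path} {a : E} {p : Q.Path}
    {x : Q.ArrowPar Z} (h : arrowPar k Z a p x ≠ 0) : x.1 = (a, p) := by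
  classical
  unfold arrowPar at h
  split_ifs at h with hp
  · by_contra hx
    exact h (Finsupp.single_eq_of_ne fun h' => hx (by rw [h']))
  · exact (h rfl).elim

theorem vertexPar_self {V E : Type*} {Q : Qvr V E} {Z : Set Q.Path} (x : Q.VertexPar Z) :
    vertexPar k Z x.1.1 x.1.2 = Finsupp.single x 1 := dif_pos x.2

theorem arrowPar_self {V E : Type*} {Q : Qvr V E} {Z : Set Q.Path} (x : Q.ArrowPar Z) :
    arrowPar k Z x.1.1 x.1.2 = Finsupp.single x 1 := dif_pos x.2

theorem delta0_single {V E : Type*} [DecidableEq V] [Fintype E] {Q : Qvr V E} {Z : Set Q.Path}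
    (x : Q.VertexPar Z) (c : k) : delta0 k Z (Finsupp.single x c) = c •
      ((∑ a : E, if h : x.1.2.target = Q.src a then
        arrowPar k Z a ((Qvr.Path.ofArrow Q a).comp x.1.2 h) else 0) -
      ∑ a : E, if h : Q.tgt a = x.1.2.start then
        arrowPar k Z a (x.1.2.comp (Qvr.Path.ofArrow Q a) h) else 0) := by
  simp [delta0]

theorem evVertex_vertexPar_trivial (hZ : ∀ z ∈ Z, 2 ≤ z.length) (v : V) :
    evVertex k Z (vertexPar k Z v (Qvr.Path.trivial Q v)) = MonAlg.vertex k Z v := by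
  have h : Qvr.Path.trivial Q v ∈ Q.basisPaths Z ∧ (Qvr.Path.trivial Q v).start = v ∧
      (Qvr.Path.trivial Q v).target = v :=
    ⟨Qvr.mem_basisPaths_of_length_le_one hZ (Nat.zero_le 1), rfl, rfl⟩
  rw [vertexPar_of_mem k Z h]
  exact (evVertex_single ⟨(v, Qvr.Path.trivial Q v), h⟩ 1).trans (one_smul _ _)

theorem evArrow_delta0_vertexPar_trivial (hZ : ∀ z ∈ Z, 2 ≤ z.length) (a : E) (v : V) :
    evArrow k Z a (delta0 k Z (vertexPar k Z v (Qvr.Path.trivial Q v))) =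
      MonAlg.arrow k Z a * MonAlg.vertex k Z v - MonAlg.vertex k Z v * MonAlg.arrow k Z a := by
  rw [evArrow_delta0 hZ, evVertex_vertexPar_trivial hZ]

theorem single_eq_smul_vertexPar_trivial (x : Q.VertexPar Z) (c : k) {v : V} (hv : x.1.1 = v)
    (hx : x.1.2.arrows = []) :
    Finsupp.single x c = c • vertexPar k Z v (Qvr.Path.trivial Q v) := by
  have hp : x.1.2 = Qvr.Path.trivial Q v := by
    rw [← hv, ← x.2.2.1]
    exact Qvr.Path.eq_trivial hx
  rw [← hp, ← hv, vertexPar_self, Finsupp.smul_single_one]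

theorem Zsp_le_imB : Zsp k g Z ≤ imB k g Z := by
  rw [Zsp, Submodule.span_le]
  rintro _ (⟨p, -, rfl⟩ | ⟨p, -, rfl⟩)
  · exact ⟨_, rfl⟩
  · exact ⟨_, rfl⟩

variable (hα : Q.IsSourceArrow g.α) (hβ : Q.IsSinkArrow g.β) (hZ : ∀ z ∈ Z, 2 ≤ z.length)

/-- The map `a ↦ a*` identifies α with β. The predicate `C`, later that of having a prescribed end,
selects arrows on which it is injective while every nonzero term on the right is still reached. -/
theorem sum_eq_sum_of_mapE {M : Type*} [AddCommMonoid M] {f : E → M} {F : g.Arr → M}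
    (C : E → Prop) (h₀ : ∀ a, ¬ C a → f a = 0) (h₁ : ∀ a, C a → f a = F (g.mapE a))
    (hinj : ∀ a b, C a → C b → g.mapE a = g.mapE b → a = b)
    (hsurj : ∀ b, F b ≠ 0 → ∃ a, C a ∧ g.mapE a = b) : ∑ a, f a = ∑ b, F b := by
  have hC : ∀ a, f a ≠ 0 → C a := fun a ha => by
    by_contra h
    exact ha (h₀ a h)
  refine Finset.sum_bij_ne_zero (fun a _ _ => g.mapE a) (fun _ _ _ => Finset.mem_univ _)
    (fun a _ ha b _ hb => hinj a b (hC a ha) (hC b hb)) (fun b _ hb => ?_)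
    (fun a _ ha => h₁ a (hC a ha))
  obtain ⟨a, ha, rfl⟩ := hsurj b hb
  exact ⟨a, Finset.mem_univ _, by rwa [h₁ a ha], rfl⟩

include hα hβ hZ

/-- Gluing adds nothing to the arrows that leave eₙ₋₁ or e₂: e₁ contributes only α, which becomes
the same γ* as β, and eₙ contributes none. The next lemma is the mirror image for incoming arrows.
-/
theorem psi1_sum_arrow_comp {p : Q.Path} (hp : p.target = p.start) (h₁ : p.target ≠ Q.src g.α)
    (h₂ : p.target ≠ Q.tgt g.β) :
    psi1 k g Z (∑ a : E, if h : p.target = Q.src a then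
        arrowPar k Z a ((Qvr.Path.ofArrow Q a).comp p h) else 0) =
      ∑ b : g.Arr, if h : (g.mapPath p).target = g.quiver.src b then
        arrowPar k (g.relations Z) b ((Qvr.Path.ofArrow g.quiver b).comp (g.mapPath p) h)
        else 0 := by
  have hn := g.nodup'
  rw [map_sum]
  refine sum_eq_sum_of_mapE (fun a => p.target = Q.src a) (fun a ha => ?_) (fun a ha => ?_)
    (fun a b ha hb hab => ?_) (fun b hb => ?_)
  · rw [dif_neg ha, map_zero]
  · have h' : (g.mapPath p).target = g.quiver.src (g.mapE a) := by
      rw [g.target_mapPath, g.src_mapE, ha]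
    rw [dif_pos ha, dif_pos h', psi1_arrowPar hα hβ hZ a
      (p := (Qvr.Path.ofArrow Q a).comp p ha) (hp.symm.trans ha)
      (Qvr.Path.target_comp (Qvr.Path.ofArrow Q a) p ha)]
    congr 1
    ext1
    · rfl
    · exact List.map_append
  · have := g.mapE_eq_mapE hab
    grind
  · have hb' : g.mapV p.target = g.mapV (Q.src b.1) := by
      by_contra h
      exact hb (dif_neg fun h' => h ((g.target_mapPath p).symm.trans h'))
    obtain h | ⟨h, -⟩ | ⟨h, h'⟩ | ⟨-, h⟩ | ⟨h, -⟩ := g.mapV_eq_mapV hb'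
    · exact ⟨b.1, h, g.mapE_val b⟩
    · exact (h₁ h).elim
    -- Here `t(p) = eₙ₋₁`, so γ*, which is represented by α, has to be lifted to β.
    · exact ⟨g.β, h, by rw [g.mapE_β, ← g.mapE_α, ← hα.2.1 _ h', g.mapE_val]⟩
    · exact (hβ.1 _ h).elim
    · exact (h₂ h).elim

theorem psi1_sum_comp_arrow {p : Q.Path} (hp : p.target = p.start) (h₁ : p.start ≠ Q.src g.α)
    (h₂ : p.start ≠ Q.tgt g.β) :
    psi1 k g Z (∑ a : E, if h : Q.tgt a = p.start then
        arrowPar k Z a (p.comp (Qvr.Path.ofArrow Q a) h) else 0) =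
      ∑ b : g.Arr, if h : g.quiver.tgt b = (g.mapPath p).start then
        arrowPar k (g.relations Z) b ((g.mapPath p).comp (Qvr.Path.ofArrow g.quiver b) h)
        else 0 := by
  have hn := g.nodup'
  rw [map_sum]
  refine sum_eq_sum_of_mapE (fun a => Q.tgt a = p.start) (fun a ha => ?_) (fun a ha => ?_)
    (fun a b ha hb hab => ?_) (fun b hb => ?_)
  · rw [dif_neg ha, map_zero]
  · have h' : g.quiver.tgt (g.mapE a) = (g.mapPath p).start := by
      rw [g.tgt_mapE, ha]
      rfl
    rw [dif_pos ha, dif_pos h', psi1_arrowPar hα hβ hZ a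
      (p := p.comp (Qvr.Path.ofArrow Q a) ha) rfl
      ((Qvr.Path.target_comp p (Qvr.Path.ofArrow Q a) ha).trans (hp.trans ha.symm))]
    congr 1
    ext1
    · exact (g.src_mapE a).symm
    · exact List.map_append
  · have := g.mapE_eq_mapE hab
    grind
  · have hb' : g.mapV (Q.tgt b.1) = g.mapV p.start := by
      by_contra h
      exact hb (dif_neg h)
    obtain h | ⟨h, -⟩ | ⟨-, h⟩ | ⟨-, h⟩ | ⟨h, -⟩ := g.mapV_eq_mapV hb'
    · exact ⟨b.1, h, g.mapE_val b⟩
    · exact (hα.1 _ h).elim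
    · exact (h₁ h).elim
    · exact (h₂ h).elim
    · exact (b.2 (hβ.2.2 _ h)).elim

/-- `ψ₁ (δ⁰_A(v ‖ p)) = δ⁰_B(v* ‖ p*)` unless `v = e₁` or `v = eₙ`. -/
theorem psi1_delta0_single (x : Q.VertexPar Z) (c : k) (h₁ : x.1.1 ≠ Q.src g.α)
    (h₂ : x.1.1 ≠ Q.tgt g.β) :
    psi1 k g Z (delta0 k Z (Finsupp.single x c)) = c • deltaStar k g Z (g.mapV x.1.1) x.1.2 := by
  have hp : x.1.2.target = x.1.2.start := x.2.2.2.trans x.2.2.1.symm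
  have hx : g.mapPath x.1.2 ∈ g.quiver.basisPaths (g.relations Z) ∧
      (g.mapPath x.1.2).start = g.mapV x.1.1 ∧ (g.mapPath x.1.2).target = g.mapV x.1.1 :=
    ⟨(mapPath_mem_basisPaths hα hβ hZ).2 x.2.1, congrArg g.mapV x.2.2.1,
      (g.target_mapPath _).trans (congrArg g.mapV x.2.2.2)⟩
  rw [delta0_single, map_smul, map_sub, deltaStar, vertexPar_of_mem k _ hx]
  refine congrArg (c • ·) (Eq.trans ?_
    (delta0_single ⟨(g.mapV x.1.1, g.mapPath x.1.2), hx⟩ 1).symm)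
  rw [one_smul, psi1_sum_arrow_comp hα hβ hZ hp (by rwa [x.2.2.2]) (by rwa [x.2.2.2]),
    psi1_sum_comp_arrow hα hβ hZ hp (by rwa [x.2.2.1]) (by rwa [x.2.2.1])]

theorem evArrow_deltaStar (b : g.Arr) (f : g.Vert) {p : Q.Path}
    (h₁ : g.mapV p.start = f) (h₂ : g.mapV p.target = f) :
    evArrow k (g.relations Z) b (deltaStar k g Z f p) =
      MonAlg.arrow k (g.relations Z) b * MonAlg.path k (g.relations Z) (g.mapPath p) -
        MonAlg.path k (g.relations Z) (g.mapPath p) * MonAlg.arrow k (g.relations Z) b := by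
  have hZ' := g.two_le_length_of_mem_relations hZ
  rw [deltaStar, evArrow_delta0 hZ']
  have h : evVertex k (g.relations Z) (vertexPar k (g.relations Z) f (g.mapPath p)) =
      MonAlg.path k (g.relations Z) (g.mapPath p) := by
    by_cases hp : g.mapPath p ∈ g.quiver.basisPaths (g.relations Z)
    · have hx : g.mapPath p ∈ g.quiver.basisPaths (g.relations Z) ∧
          (g.mapPath p).start = f ∧ (g.mapPath p).target = f :=
        ⟨hp, h₁, (g.target_mapPath p).trans h₂⟩
      rw [vertexPar_of_mem k _ hx]
      exact (evVertex_single ⟨(f, g.mapPath p), hx⟩ 1).trans (one_smul _ _)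
    · rw [vertexPar, dif_neg (fun h => hp h.1), map_zero, MonAlg.path_eq_zero hZ' hp]
  rw [h]

/-- `δ⁰_B(f₁ ‖ p*) = γ* ‖ (β p)*` for a path `p` from `e₁` to `eₙ₋₁`. -/
theorem deltaStar_f₁ {p : Q.Path} (hs : p.start = Q.src g.α) (ht : p.target = Q.src g.β) :
    deltaStar k g Z g.f₁ p =
      arrowPar k (g.relations Z) g.γ (g.mapPath ((Qvr.Path.ofArrow Q g.β).comp p ht)) := by
  classical
  have hn := g.nodup'
  have hZ' := g.two_le_length_of_mem_relations hZ
  have hlen : 2 ≤ p.length := by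
    obtain ⟨v, l, h⟩ := p
    match l, h, hs, ht with
    | [], h, hs, ht => exact (hn.1.2.1 (hs.symm.trans ht)).elim
    | [a], h, hs, ht =>
      obtain rfl := hα.2.1 a (h.1.trans hs)
      exact (hn.2.1.1 ht).elim
    | a :: b :: l, h, _, _ => simp [Qvr.Path.length]
  have hs' : g.mapV p.start = g.f₁ := by rw [hs, g.mapV_src_α]
  have ht' : g.mapV p.target = g.f₁ := by rw [ht, g.mapV_src_β]
  refine evArrow_ext fun b => ?_
  have hstart : (g.mapPath ((Qvr.Path.ofArrow Q g.β).comp p ht)).start = g.quiver.src g.γ :=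
    hs'.trans g.mapV_src_α.symm
  have htarget : (g.mapPath ((Qvr.Path.ofArrow Q g.β).comp p ht)).target = g.quiver.tgt g.γ := by
    refine (g.target_mapPath _).trans ?_
    rw [Qvr.Path.target_comp (Qvr.Path.ofArrow Q g.β) p ht]
    exact g.mapV_tgt_β.trans g.mapV_tgt_α.symm
  rw [evArrow_arrowPar hZ' b g.γ hstart htarget, evArrow_deltaStar hα hβ hZ b _ hs' ht']
  -- The comparison takes place in `A`: nothing ends at e₁ and β is the only arrow from eₙ₋₁, so of
  -- the commutators with arrows only `β p` survives.
  apply embed_injective (k := k) hα hβ hZ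
  have hlen' : 2 ≤ ((Qvr.Path.ofArrow Q g.β).comp p ht).length := by
    have : ((Qvr.Path.ofArrow Q g.β).comp p ht).length = p.length + 1 := List.length_append
    omega
  rw [map_sub, map_mul, map_mul, embed_path_mapPath hα hβ hZ hlen, embed_arrow, apply_ite
    (embed k hα hβ hZ), embed_path_mapPath hα hβ hZ hlen', map_zero,
    MonAlg.path_comp (Qvr.Path.ofArrow Q g.β) p ht]
  have h₁ : MonAlg.path k Z p * arrowSum k g Z b = 0 := by
    rw [arrowSum, Finset.mul_sum]
    exact Finset.sum_eq_zero fun a _ =>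
      MonAlg.path_mul_path_of_ne (q := Qvr.Path.ofArrow Q a) fun h => hα.1 a (h.trans hs)
  have h₂ : arrowSum k g Z b * MonAlg.path k Z p =
      if g.γ = b then MonAlg.arrow k Z g.β * MonAlg.path k Z p else 0 := by
    have h₃ : ∀ a, a ≠ g.β → MonAlg.arrow k Z a * MonAlg.path k Z p = 0 := fun a ha =>
      MonAlg.path_mul_path_of_ne (p := Qvr.Path.ofArrow Q a)
        fun h => ha (hβ.2.1 a (h.symm.trans ht))
    rw [arrowSum, Finset.sum_mul]
    split_ifs with hb
    · refine Finset.sum_eq_single g.β (fun a _ ha => h₃ a ha) fun h => (h ?_).elim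
      exact Finset.mem_filter.2 ⟨Finset.mem_univ _, g.mapE_β.trans hb⟩
    · refine Finset.sum_eq_zero fun a ha => h₃ a ?_
      rintro rfl
      exact hb (g.mapE_β.symm.trans (Finset.mem_filter.1 ha).2)
  rw [h₁, h₂, sub_zero]
  split_ifs <;> rfl

/-- `δ⁰_B(f₂ ‖ q*) = - γ* ‖ (q α)*` for a path `q` from `e₂` to `eₙ`. -/
theorem deltaStar_f₂ {p : Q.Path} (hs : Q.tgt g.α = p.start) (ht : p.target = Q.tgt g.β) :
    deltaStar k g Z g.f₂ p =
      -arrowPar k (g.relations Z) g.γ (g.mapPath (p.comp (Qvr.Path.ofArrow Q g.α) hs)) := by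
  classical
  have hn := g.nodup'
  have hZ' := g.two_le_length_of_mem_relations hZ
  have hlen : 2 ≤ p.length := by
    obtain ⟨v, l, h⟩ := p
    match l, h, hs, ht with
    | [], h, hs, ht => exact (hn.2.1.2 (hs.trans ht)).elim
    | [a], h, hs, ht =>
      obtain rfl := hβ.2.2 a ht
      exact (hn.2.1.1 (hs.trans h.1.symm)).elim
    | a :: b :: l, h, _, _ => simp [Qvr.Path.length]
  have hs' : g.mapV p.start = g.f₂ := by rw [← hs, g.mapV_tgt_α]
  have ht' : g.mapV p.target = g.f₂ := by rw [ht, g.mapV_tgt_β]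
  refine evArrow_ext fun b => ?_
  have hstart : (g.mapPath (p.comp (Qvr.Path.ofArrow Q g.α) hs)).start = g.quiver.src g.γ := rfl
  have htarget : (g.mapPath (p.comp (Qvr.Path.ofArrow Q g.α) hs)).target = g.quiver.tgt g.γ := by
    refine (g.target_mapPath _).trans ?_
    rw [Qvr.Path.target_comp p (Qvr.Path.ofArrow Q g.α) hs]
    exact ht'.trans g.mapV_tgt_α.symm
  rw [map_neg, evArrow_arrowPar hZ' b g.γ hstart htarget, evArrow_deltaStar hα hβ hZ b _ hs' ht']
  apply embed_injective (k := k) hα hβ hZ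
  have hlen' : 2 ≤ (p.comp (Qvr.Path.ofArrow Q g.α) hs).length := by
    have : (p.comp (Qvr.Path.ofArrow Q g.α) hs).length = 1 + p.length := List.length_append
    omega
  rw [map_sub, map_mul, map_mul, embed_path_mapPath hα hβ hZ hlen, embed_arrow, map_neg, apply_ite
    (embed k hα hβ hZ), embed_path_mapPath hα hβ hZ hlen', map_zero,
    MonAlg.path_comp p (Qvr.Path.ofArrow Q g.α) hs]
  have h₁ : arrowSum k g Z b * MonAlg.path k Z p = 0 := by
    rw [arrowSum, Finset.sum_mul]
    exact Finset.sum_eq_zero fun a _ =>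
      MonAlg.path_mul_path_of_ne (p := Qvr.Path.ofArrow Q a) fun h => hβ.1 a (h.symm.trans ht)
  have h₂ : MonAlg.path k Z p * arrowSum k g Z b =
      if g.γ = b then MonAlg.path k Z p * MonAlg.arrow k Z g.α else 0 := by
    have h₃ : ∀ a, a ≠ g.α → MonAlg.path k Z p * MonAlg.arrow k Z a = 0 := fun a ha =>
      MonAlg.path_mul_path_of_ne (q := Qvr.Path.ofArrow Q a)
        fun h => ha (hα.2.2 a (h.trans hs.symm))
    rw [arrowSum, Finset.mul_sum]
    split_ifs with hb
    · refine Finset.sum_eq_single g.α (fun a _ ha => h₃ a ha) fun h => (h ?_).elim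
      exact Finset.mem_filter.2 ⟨Finset.mem_univ _, g.mapE_α.trans hb⟩
    · refine Finset.sum_eq_zero fun a ha => h₃ a ?_
      rintro rfl
      exact hb (g.mapE_α.symm.trans (Finset.mem_filter.1 ha).2)
  rw [h₁, h₂, zero_sub]
  split_ifs <;> rfl

/-! ### The subspaces `ψ₁(Im δ⁰_A)` and `Z_sp(α, β)` -/

theorem psi1_apply_eq_zero (u : Q.ArrowPar Z →₀ k) {x : g.quiver.ArrowPar (g.relations Z)}
    (hx : x.1.1 = g.γ) (hlen : 2 ≤ x.1.2.length) : psi1 k g Z u x = 0 := by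
  have hn := g.nodup'
  induction u using Finsupp.induction_linear with
  | zero => simp
  | add u v hu hv => rw [map_add, Finsupp.add_apply, hu, hv, add_zero]
  | single w c =>
    rw [psi1_single, Finsupp.smul_apply]
    by_contra h
    have hw := arrowPar_apply_ne_zero (right_ne_zero_of_smul h)
    rw [hw] at hx hlen
    rw [g.length_mapPath] at hlen
    obtain h' | h' := g.mapE_eq_γ.1 hx
    · have : w.1.2 = Qvr.Path.ofArrow Q g.α := by
        refine hα.path_of_target (fun h => ?_) (w.2.2.2.trans (by rw [h']))
        rw [Qvr.Path.length, h] at hlen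
        simp at hlen
      rw [this] at hlen
      simp [Qvr.Path.length, Qvr.Path.ofArrow] at hlen
    · have : w.1.2 = Qvr.Path.ofArrow Q g.β := by
        refine hβ.path_of_start (fun h => ?_) (w.2.2.1.trans (by rw [h']))
        rw [Qvr.Path.length, h] at hlen
        simp at hlen
      rw [this] at hlen
      simp [Qvr.Path.length, Qvr.Path.ofArrow] at hlen

theorem apply_eq_zero_of_mem_Zsp {y : g.quiver.ArrowPar (g.relations Z) →₀ k}
    (hy : y ∈ Zsp k g Z) {x : g.quiver.ArrowPar (g.relations Z)}
    (hx : ¬ (x.1.1 = g.γ ∧ 2 ≤ x.1.2.length)) : y x = 0 := by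
  have hn := g.nodup'
  have key : ∀ p : Q.Path, 1 ≤ p.length → ∀ q : Q.Path, q.length = p.length + 1 →
      arrowPar k (g.relations Z) g.γ (g.mapPath q) x = 0 := by
    intro p hp q hq
    by_contra h
    refine hx ?_
    rw [arrowPar_apply_ne_zero h]
    refine ⟨rfl, ?_⟩
    rw [g.length_mapPath]
    omega
  induction hy using Submodule.span_induction with
  | zero => rfl
  | add u v _ _ hu hv => rw [Finsupp.add_apply, hu, hv, add_zero]
  | smul c u _ hu => rw [Finsupp.smul_apply, hu, smul_zero]
  | mem u hu =>
    obtain ⟨p, ⟨-, hp, ⟨hs, ht⟩ | ⟨hs, ht⟩, -⟩, rfl⟩ | ⟨p, ⟨-, hp, ⟨hs, ht⟩ | ⟨hs, ht⟩, -⟩, rfl⟩ := hu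
    · rw [deltaStar_f₁ hα hβ hZ hs ht]
      exact key p hp _ List.length_append
    · have := Qvr.Path.arrows_eq_nil_of_target (p := p) (ht ▸ hα.1)
      simp [Qvr.Path.length, this] at hp
    · rw [deltaStar_f₂ hα hβ hZ hs.symm ht, Finsupp.neg_apply, key p hp _ ?_, neg_zero]
      exact List.length_append.trans (add_comm _ _)
    · have := Qvr.Path.arrows_eq_nil_of_start (p := p) (hs ▸ hβ.1)
      simp [Qvr.Path.length, this] at hp

/-- The supports are complementary: over γ*, the map ψ₁ produces only `γ* ‖ γ*`, while `Z_sp` is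
supported on the `γ* ‖ p` with `p` of length at least two. -/
theorem disjoint_range_psi1_Zsp : Disjoint (LinearMap.range (psi1 k g Z)) (Zsp k g Z) := by
  rw [Submodule.disjoint_def]
  rintro _ ⟨u, rfl⟩ hu
  ext x
  by_cases hx : x.1.1 = g.γ ∧ 2 ≤ x.1.2.length
  · exact psi1_apply_eq_zero hα hβ hZ u hx.1 hx.2
  · exact apply_eq_zero_of_mem_Zsp hα hβ hZ hu hx

theorem psi1_delta0_src_α : psi1 k g Z (delta0 k Z (vertexPar k Z (Q.src g.α)
    (Qvr.Path.trivial Q (Q.src g.α)))) = gammaPar k g Z := by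
  have h : delta0 k Z (vertexPar k Z (Q.src g.α) (Qvr.Path.trivial Q (Q.src g.α))) =
      arrowPar k Z g.α (Qvr.Path.ofArrow Q g.α) := by
    classical
    refine evArrow_ext fun a => ?_
    rw [evArrow_delta0_vertexPar_trivial hZ, evArrow_arrowPar hZ _ _ rfl rfl,
      MonAlg.arrow_mul_vertex, MonAlg.vertex_mul_arrow, if_neg (hα.1 a), sub_zero]
    by_cases ha : g.α = a
    · subst ha
      rw [if_pos rfl, if_pos rfl]
      rfl
    · rw [if_neg ha, if_neg fun h => ha (hα.2.1 a h).symm]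
  rw [h, psi1_arrowPar hα hβ hZ _ rfl rfl, g.mapPath_ofArrow, g.mapE_α]
  rfl

theorem psi1_delta0_tgt_β : psi1 k g Z (delta0 k Z (vertexPar k Z (Q.tgt g.β)
    (Qvr.Path.trivial Q (Q.tgt g.β)))) = -gammaPar k g Z := by
  have h : delta0 k Z (vertexPar k Z (Q.tgt g.β) (Qvr.Path.trivial Q (Q.tgt g.β))) =
      -arrowPar k Z g.β (Qvr.Path.ofArrow Q g.β) := by
    classical
    refine evArrow_ext fun a => ?_
    rw [evArrow_delta0_vertexPar_trivial hZ, map_neg, evArrow_arrowPar hZ _ _ rfl rfl,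
      MonAlg.arrow_mul_vertex, MonAlg.vertex_mul_arrow, if_neg (hβ.1 a), zero_sub]
    by_cases ha : g.β = a
    · subst ha
      rw [if_pos rfl, if_pos rfl]
      rfl
    · rw [if_neg ha, if_neg fun h => ha (hβ.2.2 a h).symm]
  rw [h, map_neg, psi1_arrowPar hα hβ hZ _ rfl rfl, g.mapPath_ofArrow, g.mapE_β]
  rfl

theorem gammaPar_mem_Ysub : gammaPar k g Z ∈ Ysub k g Z :=
  Submodule.mem_sup_left ⟨_, ⟨_, rfl⟩, psi1_delta0_src_α hα hβ hZ⟩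

/-- ψ₁ carries `δ⁰_A` to `δ⁰_B` at all vertices but e₁ and eₙ; there the only closed path is
trivial, and the result is `±γ* ‖ γ*`. -/
theorem psiIm_le : psiIm k g Z ≤ imB k g Z ⊔ Submodule.span k {gammaPar k g Z} := by
  rintro _ ⟨_, ⟨w, rfl⟩, rfl⟩
  induction w using Finsupp.induction_linear with
  | zero => simp
  | add u v hu hv =>
    rw [map_add, map_add]
    exact add_mem hu hv
  | single x c =>
    by_cases h₁ : x.1.1 = Q.src g.α
    · have hx : Finsupp.single x c = c • vertexPar k Z (Q.src g.α)
          (Qvr.Path.trivial Q (Q.src g.α)) := by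
        refine single_eq_smul_vertexPar_trivial x c h₁ ?_
        exact Qvr.Path.arrows_eq_nil_of_target (by rw [x.2.2.2, h₁]; exact hα.1)
      rw [hx, map_smul, map_smul, psi1_delta0_src_α hα hβ hZ]
      exact Submodule.mem_sup_right (Submodule.smul_mem _ _ (Submodule.mem_span_singleton_self _))
    · by_cases h₂ : x.1.1 = Q.tgt g.β
      · have hx : Finsupp.single x c = c • vertexPar k Z (Q.tgt g.β)
            (Qvr.Path.trivial Q (Q.tgt g.β)) := by
          refine single_eq_smul_vertexPar_trivial x c h₂ ?_
          exact Qvr.Path.arrows_eq_nil_of_start (by rw [x.2.2.1, h₂]; exact hβ.1)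
        rw [hx, map_smul, map_smul, psi1_delta0_tgt_β hα hβ hZ]
        exact Submodule.mem_sup_right (Submodule.smul_mem _ _
          (neg_mem (Submodule.mem_span_singleton_self _)))
      · rw [psi1_delta0_single hα hβ hZ x c h₁ h₂]
        exact Submodule.mem_sup_left (Submodule.smul_mem _ _ ⟨_, rfl⟩)

theorem imB_le_Ysub : imB k g Z ≤ Ysub k g Z := by
  have hn := g.nodup'
  rintro _ ⟨w, rfl⟩
  induction w using Finsupp.induction_linear with
  | zero => simp
  | add u v hu hv =>
    rw [map_add]
    exact add_mem hu hv
  | single x c =>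
    obtain ⟨q, hq⟩ := exists_mapPath_eq hα hβ x.2.1
    have hqB : q ∈ Q.basisPaths Z := (mapPath_mem_basisPaths hα hβ hZ).1 (hq ▸ x.2.1)
    have hs : g.mapV q.start = x.1.1 := (congrArg Qvr.Path.start hq).trans x.2.2.1
    have ht : g.mapV q.target = x.1.1 := by
      rw [← g.target_mapPath, hq, x.2.2.2]
    have hx : ∀ p : Q.Path, g.mapPath p = g.mapPath q →
        delta0 k (g.relations Z) (Finsupp.single x c) = c • deltaStar k g Z x.1.1 p := by
      intro p hp
      rw [deltaStar, hp, hq, vertexPar_self, ← map_smul, Finsupp.smul_single_one]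
    -- A closed lift at a vertex other than e₁ and eₙ is covered by `psi1_delta0_single`.
    have main : ∀ p : Q.Path, g.mapPath p = g.mapPath q → p ∈ Q.basisPaths Z →
        p.start = p.target → p.start ≠ Q.src g.α → p.start ≠ Q.tgt g.β →
        delta0 k (g.relations Z) (Finsupp.single x c) ∈ Ysub k g Z := by
      intro p hp hpB hp' h₁ h₂
      rw [hx p hp]
      have hps : g.mapV p.start = x.1.1 := (congrArg Qvr.Path.start hp).trans hs
      have := psi1_delta0_single (k := k) hα hβ hZ ⟨(p.start, p), hpB, rfl, hp'.symm⟩ c h₁ h₂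
      rw [hps] at this
      rw [← this]
      exact Submodule.mem_sup_left ⟨_, ⟨_, rfl⟩, rfl⟩
    by_cases h : q.start = q.target
    · by_cases h₁ : q.start = Q.src g.α
      · have hq' : q = Qvr.Path.trivial Q (Q.src g.α) := by
          rw [← h₁]
          exact Qvr.Path.eq_trivial (Qvr.Path.arrows_eq_nil_of_target (by rw [← h, h₁]; exact hα.1))
        -- The trivial path at f₁ also lifts to eₙ₋₁, where the comparison of `δ⁰_A` and `δ⁰_B`
        -- holds.
        refine main (Qvr.Path.trivial Q (Q.src g.β)) ?_ ?_ rfl hn.1.2.1.symm hn.2.2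
        · rw [hq', g.mapPath_trivial, g.mapPath_trivial, g.mapV_src_α, g.mapV_src_β]
        · exact Qvr.mem_basisPaths_of_length_le_one hZ (Nat.zero_le 1)
      · by_cases h₂ : q.start = Q.tgt g.β
        · have hq' : q = Qvr.Path.trivial Q (Q.tgt g.β) := by
            rw [← h₂]
            exact Qvr.Path.eq_trivial (Qvr.Path.arrows_eq_nil_of_start (by rw [h₂]; exact hβ.1))
          refine main (Qvr.Path.trivial Q (Q.tgt g.α)) ?_ ?_ rfl hn.1.1.symm hn.2.1.2
          · rw [hq', g.mapPath_trivial, g.mapPath_trivial, g.mapV_tgt_α, g.mapV_tgt_β]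
          · exact Qvr.mem_basisPaths_of_length_le_one hZ (Nat.zero_le 1)
        · exact main q rfl hqB h h₁ h₂
    -- A lift that is not closed joins the two preimages of f₁ or of f₂; unless its coboundary
    -- vanishes, it is a special path.
    · rw [hx q rfl]
      refine Submodule.smul_mem _ _ (Submodule.mem_sup_right ?_)
      by_cases h0 : deltaStar k g Z x.1.1 q = 0
      · rw [h0]
        exact zero_mem _
      · have hlen : 1 ≤ q.length := by
          by_contra hl
          refine h (Qvr.Path.target_eq_start (List.length_eq_zero_iff.1 ?_)).symm
          have : q.length = q.arrows.length := rfl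
          omega
        obtain h' | h' | h' | h' | h' := g.mapV_eq_mapV (hs.trans ht.symm)
        · exact (h h').elim
        all_goals
          have hf := hs
          rw [h'.1] at hf
          simp only [g.mapV_src_α, g.mapV_src_β, g.mapV_tgt_α, g.mapV_tgt_β] at hf
          rw [← hf] at h0 ⊢
          apply Submodule.subset_span
        · exact Or.inl ⟨q, ⟨hqB, hlen, Or.inl h', h0⟩, rfl⟩
        · exact Or.inl ⟨q, ⟨hqB, hlen, Or.inr h', h0⟩, rfl⟩
        · exact Or.inr ⟨q, ⟨hqB, hlen, Or.inl h', h0⟩, rfl⟩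
        · exact Or.inr ⟨q, ⟨hqB, hlen, Or.inr h', h0⟩, rfl⟩

/-- `Z_sp` consists of coboundaries of `B`, so `γ* ‖ γ*` is all that `Y` can add to `Im δ⁰_B`. -/
theorem Ysub_eq : Ysub k g Z = imB k g Z ⊔ Submodule.span k {gammaPar k g Z} := by
  refine le_antisymm (sup_le (psiIm_le hα hβ hZ) (le_sup_of_le_left Zsp_le_imB))
    (sup_le (imB_le_Ysub hα hβ hZ) ?_)
  rw [Submodule.span_singleton_le_iff_mem]
  exact gammaPar_mem_Ysub hα hβ hZ

/-- A lift runs from e₁ or eₙ₋₁ to e₂ or eₙ. Ending at e₂ forces α, and starting at eₙ₋₁ forces β. A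
path from e₁ to eₙ has the form `β p'`, and then `γ* ‖ (β p')* = δ⁰_B(f₁ ‖ p'*)`. -/
theorem single_mem_Ysub (x : g.quiver.ArrowPar (g.relations Z)) (hx : x.1.1 = g.γ) (c : k) :
    Finsupp.single x c ∈ Ysub k g Z := by
  have hn := g.nodup'
  obtain ⟨q, hq⟩ := exists_mapPath_eq hα hβ x.2.1
  have hs : g.mapV q.start = g.f₁ := (congrArg Qvr.Path.start hq).trans
    (x.2.2.1.trans (by rw [hx]; exact g.mapV_src_α))
  have ht : g.mapV q.target = g.f₂ := by
    rw [← g.target_mapPath, hq, x.2.2.2, hx]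
    exact g.mapV_tgt_α
  have hsingle : Finsupp.single x c = c • arrowPar k (g.relations Z) g.γ (g.mapPath q) := by
    rw [hq, ← hx, arrowPar_self, Finsupp.smul_single_one]
  rw [hsingle]
  refine Submodule.smul_mem _ _ ?_
  have hnil : q.arrows ≠ [] := fun h => by
    have := Qvr.Path.target_eq_start h
    rw [this, hs] at ht
    exact g.f₁_ne_f₂ ht
  have hγ : ∀ a, g.mapE a = g.γ → q = Qvr.Path.ofArrow Q a →
      arrowPar k (g.relations Z) g.γ (g.mapPath q) ∈ Ysub k g Z := by
    rintro a ha rfl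
    rw [g.mapPath_ofArrow, ha]
    exact gammaPar_mem_Ysub hα hβ hZ
  obtain ht | ht := g.mapV_eq_f₂.1 ht
  · exact hγ g.α g.mapE_α (hα.path_of_target hnil ht)
  obtain hs | hs := g.mapV_eq_f₁.1 hs
  · obtain ⟨m, b, hm, hw, hsb, htb⟩ := q.exists_eq_append hnil
    obtain rfl := hβ.2.2 b (htb.trans ht)
    have hq' : q = (Qvr.Path.ofArrow Q g.β).comp ⟨q.start, m, hw⟩ hsb.symm := by
      ext1
      · rfl
      · exact hm
    have := deltaStar_f₁ (k := k) hα hβ hZ (p := ⟨q.start, m, hw⟩) hs hsb.symm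
    rw [← hq'] at this
    rw [← this]
    exact imB_le_Ysub hα hβ hZ ⟨_, rfl⟩
  · exact hγ g.β g.mapE_β (hβ.path_of_start hnil hs)

/-- Modulo `Y`, an element of `k((Q_B)₁ ‖ 𝓑_B)` can be made to vanish at `γ*`. -/
theorem exists_mem_Ysub_evArrow_γ_eq (y : g.quiver.ArrowPar (g.relations Z) →₀ k) :
    ∃ y' ∈ Ysub k g Z, evArrow k (g.relations Z) g.γ y' = evArrow k (g.relations Z) g.γ y := by
  classical
  induction y using Finsupp.induction_linear with
  | zero => exact ⟨0, zero_mem _, rfl⟩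
  | add u v hu hv =>
    obtain ⟨u', hu', hu⟩ := hu
    obtain ⟨v', hv', hv⟩ := hv
    exact ⟨u' + v', add_mem hu' hv', by rw [map_add, map_add, hu, hv]⟩
  | single x c =>
    by_cases hx : x.1.1 = g.γ
    · exact ⟨_, single_mem_Ysub hα hβ hZ x hx c, rfl⟩
    · exact ⟨0, zero_mem _, by rw [evArrow_single, if_neg hx, map_zero]⟩

/-- The kernel of `ψ₁` consists of coboundaries. -/
theorem mem_range_delta0_of_psi1_eq_zero {u : Q.ArrowPar Z →₀ k} (hu : psi1 k g Z u = 0) :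
    u ∈ LinearMap.range (delta0 k Z) := by
  obtain ⟨c, d, hc, hd, -⟩ := exists_evArrow_psi1_γ hα hβ hZ u
  -- Away from α and β, ψ₁ loses nothing, so `u` is `c (α ‖ α) + d (β ‖ β)`; these pairs are
  -- `δ⁰_A(e₁ ‖ e₁)` and `-δ⁰_A(eₙ ‖ eₙ)`.
  refine ⟨c • vertexPar k Z (Q.src g.α) (Qvr.Path.trivial Q (Q.src g.α)) -
    d • vertexPar k Z (Q.tgt g.β) (Qvr.Path.trivial Q (Q.tgt g.β)), evArrow_ext fun a => ?_⟩
  rw [map_sub, map_sub, map_smul, map_smul, map_smul, map_smul,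
    evArrow_delta0_vertexPar_trivial hZ, evArrow_delta0_vertexPar_trivial hZ,
    MonAlg.arrow_mul_vertex, MonAlg.vertex_mul_arrow, MonAlg.arrow_mul_vertex,
    MonAlg.vertex_mul_arrow, if_neg (hα.1 a), if_neg (hβ.1 a), sub_zero, zero_sub, smul_neg,
    sub_neg_eq_add]
  by_cases h₁ : a = g.α
  · subst h₁
    rw [if_pos rfl, if_neg g.nodup'.2.1.2, smul_zero, add_zero, hc]
  · rw [if_neg (mt (hα.2.1 a) h₁), smul_zero, zero_add]
    by_cases h₂ : a = g.β
    · subst h₂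
      rw [if_pos rfl, hd]
    · rw [if_neg (mt (hβ.2.2 a) h₂), smul_zero, ← embed_evArrow_psi1 hα hβ hZ h₁ h₂, hu, map_zero,
        map_zero]

end DeltaGlue

/-! ### The derivation `γ* ‖ γ*` -/

section GammaDer

attribute [local instance 100] LieRing.ofAssociativeRing

variable {k : Type*} [Field k] {V E : Type*} [Fintype V] [DecidableEq V] [Fintype E]
  [DecidableEq E] {Q : Qvr V E} {g : Q.GluePair} {Z : Set Q.Path}

theorem adDer_vertex_sub_vertex_vertex (u v w : V) :
    (adDer k (MonAlg.vertex k Z u - MonAlg.vertex k Z v)).1 (MonAlg.vertex k Z w) = 0 := by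
  have h : ∀ u, MonAlg.vertex k Z u * MonAlg.vertex k Z w =
      MonAlg.vertex k Z w * MonAlg.vertex k Z u := fun u => by
    rw [MonAlg.vertex_mul_vertex, MonAlg.vertex_mul_vertex]
    by_cases h : u = w
    · rw [if_pos h, if_pos h.symm, h]
    · rw [if_neg h, if_neg (Ne.symm h)]
  rw [adDer_apply, sub_mul, mul_sub, h, h, sub_self]

/-- In the commutator with `eₙ - e₁`, only `α e₁` survives at α and only `eₙ β` at β, both with sign
plus; no other arrow meets e₁ or eₙ. -/
theorem adDer_γ_arrow (hα : Q.IsSourceArrow g.α) (hβ : Q.IsSinkArrow g.β) (a : E) :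
    (adDer k (MonAlg.vertex k Z (Q.tgt g.β) - MonAlg.vertex k Z (Q.src g.α))).1
      (MonAlg.arrow k Z a) = if g.mapE a = g.γ then MonAlg.arrow k Z a else 0 := by
  have hn := g.nodup'
  rw [adDer_apply, sub_mul, mul_sub, MonAlg.vertex_mul_arrow, MonAlg.vertex_mul_arrow,
    MonAlg.arrow_mul_vertex, MonAlg.arrow_mul_vertex, if_neg (hα.1 a), if_neg (hβ.1 a)]
  by_cases h₁ : a = g.α
  · subst h₁
    rw [if_pos g.mapE_α, if_pos rfl, if_neg hn.2.1.2]
    abel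
  · by_cases h₂ : a = g.β
    · subst h₂
      rw [if_pos g.mapE_β, if_pos rfl, if_neg hn.1.2.1.symm]
      abel
    · rw [if_neg (mt (hα.2.1 a) h₁), if_neg (mt (hβ.2.2 a) h₂),
        if_neg fun h => (g.mapE_eq_γ.1 h).elim h₁ h₂]
      abel

variable (hα : Q.IsSourceArrow g.α) (hβ : Q.IsSinkArrow g.β) (hZ : ∀ z ∈ Z, 2 ≤ z.length)

theorem adDer_γ_arrowSum (b : g.Arr) :
    (adDer k (MonAlg.vertex k Z (Q.tgt g.β) - MonAlg.vertex k Z (Q.src g.α))).1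
      (arrowSum k g Z b) =
        embed k hα hβ hZ (if b = g.γ then MonAlg.arrow k (g.relations Z) b else 0) := by
  have h : (adDer k (MonAlg.vertex k Z (Q.tgt g.β) - MonAlg.vertex k Z (Q.src g.α))).1
      (arrowSum k g Z b) = if b = g.γ then arrowSum k g Z b else 0 := by
    rw [arrowSum, map_sum]
    split_ifs with hb
    · refine Finset.sum_congr rfl fun a ha => ?_
      rw [adDer_γ_arrow hα hβ, if_pos ((Finset.mem_filter.1 ha).2.trans hb)]
    · refine Finset.sum_eq_zero fun a ha => ?_
      rw [adDer_γ_arrow hα hβ, if_neg fun h => hb ((Finset.mem_filter.1 ha).2.symm.trans h)]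
  rw [h, apply_ite (embed k hα hβ hZ), embed_arrow, map_zero]

theorem adDer_γ_vertexSum (f : g.Vert) :
    (adDer k (MonAlg.vertex k Z (Q.tgt g.β) - MonAlg.vertex k Z (Q.src g.α))).1
      (vertexSum k g Z f) = 0 := by
  rw [vertexSum, map_sum]
  exact Finset.sum_eq_zero fun v _ => adDer_vertex_sub_vertex_vertex _ _ v

/-- The derivation of the glued algebra that corresponds to `γ* ‖ γ*` is the restriction of an
inner derivation of `kQ/⟨Z⟩`. -/
theorem exists_gammaDer : ∃ D : Der k (GluedAlg k g Z), Realizes k (g.relations Z) (gammaPar k g Z) D ∧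
    ∀ x, (adDer k (MonAlg.vertex k Z (Q.tgt g.β) - MonAlg.vertex k Z (Q.src g.α))).1
      (embed k hα hβ hZ x) = embed k hα hβ hZ (D.1 x) := by
  classical
  obtain ⟨D, hD⟩ := exists_restrict hα hβ hZ
    (adDer k (MonAlg.vertex k Z (Q.tgt g.β) - MonAlg.vertex k Z (Q.src g.α)))
    (fun f => by rw [adDer_γ_vertexSum]; exact zero_mem _)
    (fun b => ⟨_, (adDer_γ_arrowSum hα hβ hZ b).symm⟩)
  refine ⟨D, realizes_iff.2 ⟨fun f => ?_, fun b => ?_⟩, hD⟩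
  · apply embed_injective hα hβ hZ
    rw [← hD, embed_vertex, adDer_γ_vertexSum, map_zero]
  · apply embed_injective hα hβ hZ
    rw [← hD, embed_arrow, adDer_γ_arrowSum hα hβ hZ, gammaPar,
      evArrow_arrowPar (g.two_le_length_of_mem_relations hZ) b g.γ rfl rfl]
    by_cases hb : b = g.γ
    · rw [if_pos hb, if_pos hb.symm, hb]
      rfl
    · rw [if_neg hb, if_neg (Ne.symm hb)]

include hα hβ hZ

/-- By `Ysub_eq`, `y` is a coboundary plus `c (γ* ‖ γ*)`. Both parts are realized, and the first has
class zero. -/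
theorem exists_realizes_of_mem_Ysub {y : g.quiver.ArrowPar (g.relations Z) →₀ k}
    (hy : y ∈ Ysub k g Z) {Dγ : Der k (GluedAlg k g Z)}
    (hDγ : Realizes k (g.relations Z) (gammaPar k g Z) Dγ) :
    ∃ (D : Der k (GluedAlg k g Z)) (c : k), Realizes k (g.relations Z) y D ∧
      HH1.mk k (GluedAlg k g Z) D = c • HH1.mk k (GluedAlg k g Z) Dγ := by
  rw [Ysub_eq hα hβ hZ, Submodule.mem_sup] at hy
  obtain ⟨_, ⟨w, rfl⟩, _, hz, rfl⟩ := hy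
  obtain ⟨c, rfl⟩ := Submodule.mem_span_singleton.1 hz
  refine ⟨_, c, (realizes_delta0 (g.two_le_length_of_mem_relations hZ) w).add (hDγ.smul c), ?_⟩
  rw [map_add, HH1.mk_adDer, zero_add, map_smul]

/-- Modulo `Y`, a derivation of the glued algebra kills the vertices and `γ*`. -/
theorem exists_mk_eq_add (D : Der k (GluedAlg k g Z)) :
    ∃ D₁ D₂ : Der k (GluedAlg k g Z), ∃ y ∈ Ysub k g Z,
      HH1.mk k (GluedAlg k g Z) D = HH1.mk k (GluedAlg k g Z) D₁ + HH1.mk k (GluedAlg k g Z) D₂ ∧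
      Realizes k (g.relations Z) y D₂ ∧
      (∀ v, D₁.1 (MonAlg.vertex k (g.relations Z) v) = 0) ∧
      D₁.1 (MonAlg.arrow k (g.relations Z) g.γ) = 0 := by
  obtain ⟨x, hx⟩ := exists_sub_adDer_vertex_eq_zero D
  obtain ⟨y, hy⟩ := exists_realizes (g.two_le_length_of_mem_relations hZ) hx
  obtain ⟨y', hy', h⟩ := exists_mem_Ysub_evArrow_γ_eq hα hβ hZ y
  obtain ⟨Dγ, hDγ, -⟩ := exists_gammaDer (k := k) hα hβ hZ
  obtain ⟨D₂, -, hD₂, -⟩ := exists_realizes_of_mem_Ysub hα hβ hZ hy' hDγ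
  have h₁ := hy.add (hD₂.smul (-1))
  refine ⟨D - adDer k x + (-1 : k) • D₂, D₂, y', hy', ?_, hD₂, (realizes_iff.1 h₁).1, ?_⟩
  · rw [map_add, map_smul, map_sub, HH1.mk_adDer]
    module
  · rw [(realizes_iff.1 h₁).2, map_add, map_smul, h]
    module

/-- The class of `γ* ‖ γ*` is central. -/
theorem lie_mk_gammaDer {Dγ : Der k (GluedAlg k g Z)}
    (hDγ : Realizes k (g.relations Z) (gammaPar k g Z) Dγ) (x : HH1 k (GluedAlg k g Z)) :
    ⁅x, HH1.mk k (GluedAlg k g Z) Dγ⁆ = 0 := by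
  obtain ⟨D, rfl⟩ := HH1.mk_surjective x
  obtain ⟨D₁, D₂, y, hy, h, hD₂, hv, hγ⟩ := exists_mk_eq_add hα hβ hZ D
  obtain ⟨D₂', c, hD₂', hc⟩ := exists_realizes_of_mem_Ysub hα hβ hZ hy hDγ
  -- The part from `Y` is a multiple of the class of `γ* ‖ γ*` and drops out of the bracket.
  rw [h, hD₂.ext hD₂', hc, add_lie, smul_lie, lie_self, smul_zero, add_zero, ← LieHom.map_lie]
  obtain ⟨D', hv', -, -, hD'⟩ := exists_extend hα hβ hZ D₁ hv hγ
  obtain ⟨Dγ', hDγ', hι⟩ := exists_gammaDer (k := k) hα hβ hZ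
  rw [hDγ.ext hDγ']
  -- In `A`, the extension of `D₁` kills the vertices and so commutes with `ad (eₙ - e₁)`; the
  -- bracket vanishes already on derivations.
  have h0 : ⁅D₁, Dγ'⁆ = 0 := by
    refine Subtype.ext (LinearMap.ext fun x => ?_)
    apply embed_injective hα hβ hZ
    change embed k hα hβ hZ (D₁.1 (Dγ'.1 x) - Dγ'.1 (D₁.1 x)) = embed k hα hβ hZ 0
    rw [map_sub, ← hD', ← hι, ← hι, ← hD', adDer_apply, adDer_apply, map_sub, Der.leibniz,
      Der.leibniz, map_sub, hv', hv', map_zero]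
    noncomm_ring
  rw [h0, map_zero]

/-- A derivation of `kQ/⟨Z⟩` and its restriction correspond under `ψ₁`. -/
theorem realizes_psi1 {D' : Der k (MonAlg k Q Z)} {D : Der k (GluedAlg k g Z)}
    (hD : ∀ x, D'.1 (embed k hα hβ hZ x) = embed k hα hβ hZ (D.1 x))
    (hDα : D'.1 (MonAlg.arrow k Z g.α) = 0) (hDβ : D'.1 (MonAlg.arrow k Z g.β) = 0)
    {x : Q.ArrowPar Z →₀ k} (hx : Realizes k Z x D') :
    Realizes k (g.relations Z) (psi1 k g Z x) D := by
  rw [realizes_iff] at hx ⊢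
  constructor
  · intro f
    apply embed_injective hα hβ hZ
    rw [← hD, embed_vertex, vertexSum, map_sum, map_zero]
    exact Finset.sum_eq_zero fun v _ => hx.1 v
  · intro b
    apply embed_injective hα hβ hZ
    rw [← hD, embed_arrow]
    by_cases hb : b = g.γ
    · obtain ⟨c, d, hc, hd, h⟩ := exists_evArrow_psi1_γ hα hβ hZ x
      rw [← hx.2, hDα] at hc
      rw [← hx.2, hDβ] at hd
      rw [hb, arrowSum_γ, map_add, hDα, hDβ, h,
        (smul_eq_zero.1 hc.symm).resolve_right (MonAlg.arrow_ne_zero hZ _),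
        (smul_eq_zero.1 hd.symm).resolve_right (MonAlg.arrow_ne_zero hZ _)]
      simp
    · have hb' : b.1 ≠ g.α := fun h => hb (Subtype.ext h)
      rw [← g.mapE_val b, arrowSum_mapE hb' b.2, hx.2, embed_evArrow_psi1 hα hβ hZ hb' b.2]

/-- A derivation of `kQ/⟨Z⟩` that kills the vertices, `α` and `β` is inner if and only if its
restriction corresponds to an element of `Y`. -/
theorem mk_eq_zero_iff_of_restrict {D' : Der k (MonAlg k Q Z)} {D : Der k (GluedAlg k g Z)}
    (hD : ∀ x, D'.1 (embed k hα hβ hZ x) = embed k hα hβ hZ (D.1 x))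
    (hv : ∀ v, D'.1 (MonAlg.vertex k Z v) = 0)
    (hDα : D'.1 (MonAlg.arrow k Z g.α) = 0) (hDβ : D'.1 (MonAlg.arrow k Z g.β) = 0) :
    HH1.mk k (MonAlg k Q Z) D' = 0 ↔ ∃ y ∈ Ysub k g Z, ∃ D₁ : Der k (GluedAlg k g Z),
      Realizes k (g.relations Z) y D₁ ∧
        HH1.mk k (GluedAlg k g Z) D₁ = HH1.mk k (GluedAlg k g Z) D := by
  obtain ⟨x, hx⟩ := exists_realizes hZ hv
  have hx' := realizes_psi1 hα hβ hZ hD hDα hDβ hx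
  rw [hx.mk_eq_zero_iff hZ]
  constructor
  · intro h
    exact ⟨_, Submodule.mem_sup_left ⟨x, h, rfl⟩, D, hx', rfl⟩
  · rintro ⟨y, hy, D₁, hD₁, h⟩
    have h₁ : psi1 k g Z x ∈ Ysub k g Z := by
      have h₂ := hx'.add (hD₁.smul (-1))
      have h₃ : HH1.mk k (GluedAlg k g Z) (D + (-1 : k) • D₁) = 0 := by
        rw [map_add, map_smul, h]
        module
      rw [h₂.mk_eq_zero_iff (g.two_le_length_of_mem_relations hZ)] at h₃
      have h₄ := add_mem (imB_le_Ysub hα hβ hZ h₃) hy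
      have h₅ : psi1 k g Z x + (-1 : k) • y + y = psi1 k g Z x := by module
      rwa [h₅] at h₄
    -- Here `ψ₁ x = ψ₁ u + z` with `u` a coboundary and `z ∈ Z_sp`. Directness forces `z = ψ₁ (x -
    -- u)` to vanish, and then `x - u` is a coboundary too.
    obtain ⟨_, ⟨u, hu, rfl⟩, z, hz, huz⟩ := Submodule.mem_sup.1 h₁
    have hz' : z = psi1 k g Z (x - u) := by rw [map_sub, ← huz, add_sub_cancel_left]
    have hz0 : z = 0 := Submodule.disjoint_def.1 (disjoint_range_psi1_Zsp hα hβ hZ) z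
      ⟨_, hz'.symm⟩ hz
    rw [hz0] at hz'
    have := add_mem (mem_range_delta0_of_psi1_eq_zero hα hβ hZ hz'.symm) hu
    rwa [sub_add_cancel] at this

end GammaDer

/-! ### The Lie algebra that maps to both cohomologies -/

section LieAlgebra

variable {k : Type*} [Field k]

/-- The Lie ideal spanned by a central element. -/
def centralIdeal {L : Type*} [LieRing L] [LieAlgebra k L] (z : L) (hz : ∀ x : L, ⁅x, z⁆ = 0) :
    LieIdeal k L :=
  { Submodule.span k {z} with
    lie_mem := fun {x m} hm => by
      obtain ⟨c, rfl⟩ := Submodule.mem_span_singleton.1 hm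
      rw [lie_smul, hz, smul_zero]
      exact zero_mem (Submodule.span k {z}) }

theorem mem_centralIdeal {L : Type*} [LieRing L] [LieAlgebra k L] {z : L}
    {hz : ∀ x : L, ⁅x, z⁆ = 0} {x : L} : x ∈ centralIdeal (k := k) z hz ↔ ∃ c : k, c • z = x :=
  Submodule.mem_span_singleton

/-- Two Lie algebras that are images of a third one under homomorphisms with the same kernel are
isomorphic. -/
theorem nonempty_lieEquiv_of_ker_eq {L M N : Type*} [LieRing L] [LieAlgebra k L] [LieRing M]
    [LieAlgebra k M] [LieRing N] [LieAlgebra k N] (f : L →ₗ⁅k⁆ M) (h : L →ₗ⁅k⁆ N)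
    (hf : Function.Surjective f) (hh : Function.Surjective h) (hker : ∀ x, f x = 0 ↔ h x = 0) :
    Nonempty (M ≃ₗ⁅k⁆ N) := by
  have hker' : ∀ x y, f x = f y ↔ h x = h y := fun x y => by
    rw [← sub_eq_zero, ← map_sub, hker, map_sub, sub_eq_zero]
  choose r hr using hf
  have hrf : ∀ x, h (r (f x)) = h x := fun x => (hker' _ _).1 (hr _)
  let φ : M →ₗ⁅k⁆ N :=
    { toFun := fun m => h (r m)
      map_add' := fun m m' => by
        rw [← map_add, ← hker', map_add, hr, hr, hr]
      map_smul' := fun c m => by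
        rw [RingHom.id_apply, ← map_smul, ← hker', map_smul, hr, hr]
      map_lie' := fun {m m'} => by
        rw [← LieHom.map_lie, ← hker', LieHom.map_lie, hr, hr, hr] }
  refine ⟨LieEquiv.ofBijective φ ⟨fun m m' hm => ?_, fun n => ?_⟩⟩
  · have : f (r m) = f (r m') := (hker' _ _).2 hm
    rwa [hr, hr] at this
  · obtain ⟨x, rfl⟩ := hh n
    exact ⟨f x, hrf x⟩

variable {V E : Type*} [Fintype V] [DecidableEq V] [Fintype E]
  [DecidableEq E] {Q : Qvr V E} {g : Q.GluePair} {Z : Set Q.Path}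
  (hα : Q.IsSourceArrow g.α) (hβ : Q.IsSinkArrow g.β) (hZ : ∀ z ∈ Z, 2 ≤ z.length)

/-- The Lie algebra of the derivations of `kQ/⟨Z⟩` that kill the vertices, `α` and `β`, together
with their restrictions to the glued algebra. -/
def restrictPairs : LieSubalgebra k (Der k (MonAlg k Q Z) × Der k (GluedAlg k g Z)) where
  carrier := {x | (∀ v, x.1.1 (MonAlg.vertex k Z v) = 0) ∧ x.1.1 (MonAlg.arrow k Z g.α) = 0 ∧
    x.1.1 (MonAlg.arrow k Z g.β) = 0 ∧
      ∀ b, x.1.1 (embed k hα hβ hZ b) = embed k hα hβ hZ (x.2.1 b)}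
  add_mem' := by
    rintro x y ⟨h₁, h₂, h₃, h₄⟩ ⟨h₁', h₂', h₃', h₄'⟩
    refine ⟨fun v => ?_, ?_, ?_, fun b => ?_⟩
    · change x.1.1 _ + y.1.1 _ = 0
      rw [h₁, h₁', add_zero]
    · change x.1.1 _ + y.1.1 _ = 0
      rw [h₂, h₂', add_zero]
    · change x.1.1 _ + y.1.1 _ = 0
      rw [h₃, h₃', add_zero]
    · change x.1.1 _ + y.1.1 _ = embed k hα hβ hZ (x.2.1 b + y.2.1 b)
      rw [h₄, h₄', map_add]
  zero_mem' := by
    refine ⟨fun v => rfl, rfl, rfl, fun b => ?_⟩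
    exact (map_zero _).symm
  smul_mem' := by
    rintro c x ⟨h₁, h₂, h₃, h₄⟩
    refine ⟨fun v => ?_, ?_, ?_, fun b => ?_⟩
    · change c • x.1.1 _ = 0
      rw [h₁, smul_zero]
    · change c • x.1.1 _ = 0
      rw [h₂, smul_zero]
    · change c • x.1.1 _ = 0
      rw [h₃, smul_zero]
    · change c • x.1.1 _ = embed k hα hβ hZ (c • x.2.1 b)
      rw [h₄, map_smul]
  lie_mem' := by
    rintro x y ⟨h₁, h₂, h₃, h₄⟩ ⟨h₁', h₂', h₃', h₄'⟩
    refine ⟨fun v => ?_, ?_, ?_, fun b => ?_⟩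
    · change x.1.1 (y.1.1 _) - y.1.1 (x.1.1 _) = 0
      rw [h₁, h₁', map_zero, map_zero, sub_zero]
    · change x.1.1 (y.1.1 _) - y.1.1 (x.1.1 _) = 0
      rw [h₂, h₂', map_zero, map_zero, sub_zero]
    · change x.1.1 (y.1.1 _) - y.1.1 (x.1.1 _) = 0
      rw [h₃, h₃', map_zero, map_zero, sub_zero]
    · change x.1.1 (y.1.1 _) - y.1.1 (x.1.1 _) =
        embed k hα hβ hZ (x.2.1 (y.2.1 b) - y.2.1 (x.2.1 b))
      rw [h₄, h₄', h₄, h₄', map_sub]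

/-- The class in `HH¹(kQ/⟨Z⟩)` of the first member of a pair. -/
def restrictPairsFst :
    restrictPairs (k := k) hα hβ hZ →ₗ⁅k⁆ HH1 k (MonAlg k Q Z) :=
  ((HH1.mk k (MonAlg k Q Z)).comp (LieHom.fst k _ _)).comp (restrictPairs hα hβ hZ).incl

/-- The class in `HH¹` of the glued algebra of the second member of a pair. -/
def restrictPairsSnd :
    restrictPairs (k := k) hα hβ hZ →ₗ⁅k⁆ HH1 k (GluedAlg k g Z) :=
  ((HH1.mk k (GluedAlg k g Z)).comp (LieHom.snd k _ _)).comp (restrictPairs hα hβ hZ).incl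

theorem restrictPairsFst_surjective :
    Function.Surjective (restrictPairsFst (k := k) hα hβ hZ) := by
  intro x
  obtain ⟨D, rfl⟩ := HH1.mk_surjective x
  obtain ⟨u, hu⟩ := exists_sub_adDer_vertex_eq_zero D
  obtain ⟨y, hy⟩ := exists_realizes hZ hu
  obtain ⟨c, d, hc, hd, -⟩ := exists_evArrow_psi1_γ hα hβ hZ y
  rw [realizes_iff] at hy
  have hn := g.nodup'
  have hvv : ∀ v w, (adDer k (MonAlg.vertex k Z v)).1 (MonAlg.vertex k Z w) = 0 := fun v w => by
    rw [adDer_apply, MonAlg.vertex_mul_vertex, MonAlg.vertex_mul_vertex]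
    by_cases h : v = w
    · rw [if_pos h, if_pos h.symm, h, sub_self]
    · rw [if_neg h, if_neg (Ne.symm h), sub_self]
  -- `D - ad u` acts on α by `c` and on β by `d`, while `ad e₁` sends α to `-α` and `ad eₙ` sends β
  -- to β; hence the two signs.
  let D' : Der k (MonAlg k Q Z) := D - adDer k u + c • adDer k (MonAlg.vertex k Z (Q.src g.α)) -
    d • adDer k (MonAlg.vertex k Z (Q.tgt g.β))
  have hD' : ∀ z, D'.1 z = (D - adDer k u).1 z +
      c • (MonAlg.vertex k Z (Q.src g.α) * z - z * MonAlg.vertex k Z (Q.src g.α)) -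
      d • (MonAlg.vertex k Z (Q.tgt g.β) * z - z * MonAlg.vertex k Z (Q.tgt g.β)) := fun z => rfl
  have hv : ∀ v, D'.1 (MonAlg.vertex k Z v) = 0 := fun v => by
    rw [hD', hy.1, ← adDer_apply (k := k), ← adDer_apply (k := k), hvv, hvv]
    simp
  have h₁ : D'.1 (MonAlg.arrow k Z g.α) = 0 := by
    rw [hD', hy.2, hc]
    simp only [MonAlg.vertex_mul_arrow, MonAlg.arrow_mul_vertex, if_true, hn.1.1.symm, hn.2.1.2,
      hn.1.2.2, if_false]
    simp
  have h₂ : D'.1 (MonAlg.arrow k Z g.β) = 0 := by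
    rw [hD', hy.2, hd]
    simp only [MonAlg.vertex_mul_arrow, MonAlg.arrow_mul_vertex, if_true, hn.2.2, hn.1.2.1.symm,
      hn.1.2.2.symm, if_false]
    simp
  obtain ⟨D'', h⟩ := exists_restrict_of_eq_zero hα hβ hZ D' hv h₁ h₂
  refine ⟨⟨(D', D''), hv, h₁, h₂, h⟩, ?_⟩
  change HH1.mk k (MonAlg k Q Z) D' = HH1.mk k (MonAlg k Q Z) D
  simp only [D', map_add, map_sub, map_smul, HH1.mk_adDer]
  simp

/-- This is surjectivity onto `HH¹(B)` modulo `I`: the part that kills the vertices and γ* extends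
to `A`, and the rest is realized by an element of `Y`. -/
theorem exists_sub_restrictPairsSnd (x : HH1 k (GluedAlg k g Z)) :
    ∃ p : restrictPairs (k := k) hα hβ hZ, ∃ y ∈ Ysub k g Z, ∃ D : Der k (GluedAlg k g Z),
      Realizes k (g.relations Z) y D ∧
        HH1.mk k (GluedAlg k g Z) D = x - restrictPairsSnd hα hβ hZ p := by
  obtain ⟨D, rfl⟩ := HH1.mk_surjective x
  obtain ⟨D₁, D₂, y, hy, h, hD₂, hv, hγ⟩ := exists_mk_eq_add hα hβ hZ D
  obtain ⟨D', h₁, h₂, h₃, h₄⟩ := exists_extend hα hβ hZ D₁ hv hγ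
  refine ⟨⟨(D', D₁), h₁, h₂, h₃, h₄⟩, y, hy, D₂, hD₂, ?_⟩
  rw [h]
  exact (add_sub_cancel_left _ _).symm

end LieAlgebra

/-! ### Blocks of a monomial algebra -/

section Blocks

variable {k : Type*} [Field k] {V E : Type*} [Fintype V] [DecidableEq V] {Q : Qvr V E}
  {Z : Set Q.Path}

/-- The one-dimensional representation at a vertex. -/
def simpleRep (k : Type*) [Field k] {V E : Type*} [Fintype V] [DecidableEq V] (Q : Qvr V E)
    (v : V) : Rep Q k where
  e w := if w = v then 1 else 0
  x _ := 0
  e_mul_e u w := by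
    by_cases h : u = w
    · subst h
      simp
    · rw [if_neg h]
      by_cases hu : u = v
      · subst hu
        rw [if_neg (Ne.symm h), mul_zero]
      · rw [if_neg hu, zero_mul]
  sum_e := by simp
  e_mul_x _ := mul_zero _
  x_mul_e _ := zero_mul _

theorem simpleRep_val_of_ne_nil {v : V} {p : Q.Path} (hp : p.arrows ≠ []) :
    (simpleRep k Q v).val p = 0 := by
  obtain ⟨w, l, h⟩ := p
  cases l with
  | nil => exact (hp rfl).elim
  | cons a l => exact mul_zero _

/-- The coefficient of a trivial path, as an algebra homomorphism. -/
def vertexCoeff (k : Type*) [Field k] {V E : Type*} [Fintype V] [DecidableEq V] {Q : Qvr V E}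
    {Z : Set Q.Path} (hZ : ∀ z ∈ Z, 2 ≤ z.length) (v : V) : MonAlg k Q Z →ₐ[k] k :=
  MonAlg.lift ((simpleRep k Q v).lift k) fun z hz => by
    rw [Rep.lift_of]
    refine simpleRep_val_of_ne_nil fun h => ?_
    have := hZ z hz
    rw [Qvr.Path.length, h] at this
    simp at this

theorem vertexCoeff_path (hZ : ∀ z ∈ Z, 2 ≤ z.length) (v : V) {p : Q.Path} (hp : p.arrows ≠ []) :
    vertexCoeff k hZ v (MonAlg.path k Z p) = 0 :=
  (Rep.lift_of _ p).trans (simpleRep_val_of_ne_nil hp)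

theorem vertexCoeff_vertex (hZ : ∀ z ∈ Z, 2 ≤ z.length) (v w : V) :
    vertexCoeff k hZ v (MonAlg.vertex k Z w) = if w = v then 1 else 0 :=
  Rep.lift_of _ _

variable (k Z) in
/-- The span of the paths of length at least `n`. -/
def lengthFilt (n : ℕ) : Submodule k (MonAlg k Q Z) :=
  Submodule.span k (MonAlg.path k Z '' {p | n ≤ p.length})

theorem mul_mem_lengthFilt {m n : ℕ} {x y : MonAlg k Q Z} (hx : x ∈ lengthFilt k Z m)
    (hy : y ∈ lengthFilt k Z n) : x * y ∈ lengthFilt k Z (m + n) := by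
  have h := Submodule.mul_mem_mul hx hy
  rw [lengthFilt, lengthFilt, Submodule.span_mul_span] at h
  refine (Submodule.span_le.2 ?_ : _ ≤ lengthFilt k Z (m + n)) h
  rintro _ ⟨_, ⟨p, hp, rfl⟩, _, ⟨q, hq, rfl⟩, rfl⟩
  change MonAlg.path k Z p * MonAlg.path k Z q ∈ lengthFilt k Z (m + n)
  by_cases h : q.target = p.start
  · rw [← MonAlg.path_comp p q h]
    refine Submodule.subset_span ⟨_, ?_, rfl⟩
    have h₁ : (p.comp q h).length = q.length + p.length := List.length_append
    change m + n ≤ (p.comp q h).length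
    change m ≤ p.length at hp
    change n ≤ q.length at hq
    omega
  · rw [MonAlg.path_mul_path_of_ne h]
    exact zero_mem _

theorem nf_eq_zero_of_mem_lengthFilt {n : ℕ} {x : MonAlg k Q Z} (hx : x ∈ lengthFilt k Z n)
    {p : Q.Path} (hp : p.length < n) : MonAlg.nf k Z x p = 0 := by
  induction hx using Submodule.span_induction with
  | zero => simp
  | add x y _ _ hx hy => rw [map_add, Finsupp.add_apply, hx, hy, add_zero]
  | smul c x _ hx => rw [map_smul, Finsupp.smul_apply, hx, smul_zero]
  | mem x hx =>
    obtain ⟨q, hq, rfl⟩ := hx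
    by_cases hqB : q ∈ Q.basisPaths Z
    · rw [MonAlg.nf_path_of_mem hqB]
      refine Finsupp.single_eq_of_ne ?_
      rintro rfl
      exact absurd hq (not_le.2 hp)
    · rw [MonAlg.nf_path_of_notMem hqB]
      rfl

theorem sub_sum_vertexCoeff_mem (hZ : ∀ z ∈ Z, 2 ≤ z.length) (x : MonAlg k Q Z) :
    x - ∑ v, vertexCoeff k hZ v x • MonAlg.vertex k Z v ∈ lengthFilt k Z 1 := by
  have hx : x ∈ Submodule.span k (Set.range (MonAlg.path k Z)) := by
    rw [MonAlg.span_range_path]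
    trivial
  induction hx using Submodule.span_induction with
  | zero => simp
  | add x y _ _ hx hy =>
    have h := add_mem hx hy
    rw [sub_add_sub_comm, ← Finset.sum_add_distrib] at h
    simpa only [map_add, add_smul] using h
  | smul c x _ hx =>
    have h := Submodule.smul_mem _ c hx
    rw [smul_sub, Finset.smul_sum] at h
    simpa only [map_smul, smul_assoc] using h
  | mem x hx =>
    obtain ⟨p, rfl⟩ := hx
    by_cases hp : p.arrows = []
    · rw [Qvr.Path.eq_trivial hp]
      change MonAlg.vertex k Z _ - ∑ v, vertexCoeff k hZ v (MonAlg.vertex k Z _) • _ ∈ _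
      simp only [vertexCoeff_vertex, ite_smul, one_smul, zero_smul, Finset.sum_ite_eq,
        Finset.mem_univ, if_true, sub_self]
      exact zero_mem _
    · simp only [vertexCoeff_path hZ _ hp, zero_smul, Finset.sum_const_zero, sub_zero]
      exact Submodule.subset_span ⟨p, List.length_pos_of_ne_nil hp, rfl⟩

/-- An idempotent without trivial paths in its support vanishes. -/
theorem eq_zero_of_isIdempotentElem (hZ : ∀ z ∈ Z, 2 ≤ z.length) {d : MonAlg k Q Z}
    (hd : IsIdempotentElem d) (h : ∀ v, vertexCoeff k hZ v d = 0) : d = 0 := by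
  have h₁ : d ∈ lengthFilt k Z 1 := by
    simpa [h] using sub_sum_vertexCoeff_mem hZ d
  -- Since `d` equals all its powers, it lies in every step of the length filtration, while a given
  -- coefficient belongs to a path of finite length.
  have h₂ : ∀ n, d ∈ lengthFilt k Z (n + 1) := fun n => by
    induction n with
    | zero => exact h₁
    | succ n ih =>
      have := mul_mem_lengthFilt ih h₁
      rwa [hd] at this
  refine MonAlg.nf_injective hZ ?_
  rw [map_zero]
  ext p
  exact nf_eq_zero_of_mem_lengthFilt (h₂ p.length) (Nat.lt_succ_self _)

/-- Up to paths of length two or more, only the vertex part of `x` contributes to `x a - a x`. This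
is how vertex coefficients detect inner derivations. -/
theorem adDer_arrow_sub_mem (hZ : ∀ z ∈ Z, 2 ≤ z.length) (x : MonAlg k Q Z) (a : E) :
    (adDer k x).1 (MonAlg.arrow k Z a) - (vertexCoeff k hZ (Q.tgt a) x -
      vertexCoeff k hZ (Q.src a) x) • MonAlg.arrow k Z a ∈ lengthFilt k Z 2 := by
  have ha : MonAlg.arrow k Z a ∈ lengthFilt k Z 1 :=
    Submodule.subset_span ⟨_, le_refl 1, rfl⟩
  have h := sub_mem (mul_mem_lengthFilt (sub_sum_vertexCoeff_mem hZ x) ha)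
    (mul_mem_lengthFilt ha (sub_sum_vertexCoeff_mem hZ x))
  rw [sub_mul, mul_sub, Finset.sum_mul, Finset.mul_sum] at h
  simp only [smul_mul_assoc, mul_smul_comm, MonAlg.vertex_mul_arrow, MonAlg.arrow_mul_vertex,
    smul_ite, smul_zero, Finset.sum_ite_eq, Finset.mem_univ, if_true] at h
  rw [adDer_apply, sub_smul]
  convert h using 1
  abel

theorem eq_zero_of_smul_arrow_mem (hZ : ∀ z ∈ Z, 2 ≤ z.length) {c : k} {a : E}
    (h : c • MonAlg.arrow k Z a ∈ lengthFilt k Z 2) : c = 0 := by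
  have h₁ := nf_eq_zero_of_mem_lengthFilt h (p := Qvr.Path.ofArrow Q a) (Nat.lt_succ_self 1)
  rwa [map_smul, MonAlg.arrow, MonAlg.nf_path_of_mem (Qvr.mem_basisPaths_of_length_le_one hZ
    (le_refl 1)), Finsupp.smul_apply, Finsupp.single_eq_same, smul_eq_mul, mul_one] at h₁

theorem vertexCoeff_tgt_eq_src (hZ : ∀ z ∈ Z, 2 ≤ z.length) {x : MonAlg k Q Z} {a : E}
    (h : x * MonAlg.arrow k Z a = MonAlg.arrow k Z a * x) :
    vertexCoeff k hZ (Q.tgt a) x = vertexCoeff k hZ (Q.src a) x := by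
  have h₁ := adDer_arrow_sub_mem hZ x a
  rw [adDer_apply, h, sub_self, zero_sub, ← neg_smul] at h₁
  exact sub_eq_zero.1 (neg_eq_zero.1 (eq_zero_of_smul_arrow_mem hZ h₁))

open Classical in
variable (k Z) in
/-- The sum of the vertices in a set. -/
def vertexSetSum (S : Set V) : MonAlg k Q Z := ∑ v : V with v ∈ S, MonAlg.vertex k Z v

open Classical in
theorem vertexSetSum_mul_path (S : Set V) (p : Q.Path) :
    vertexSetSum k Z S * MonAlg.path k Z p = if p.target ∈ S then MonAlg.path k Z p else 0 := by
  rw [vertexSetSum, Finset.sum_mul]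
  simp only [MonAlg.vertex_mul_path, Finset.sum_ite_eq, Finset.mem_filter, Finset.mem_univ,
    true_and]

open Classical in
theorem path_mul_vertexSetSum (S : Set V) (p : Q.Path) :
    MonAlg.path k Z p * vertexSetSum k Z S = if p.start ∈ S then MonAlg.path k Z p else 0 := by
  rw [vertexSetSum, Finset.mul_sum]
  simp only [MonAlg.path_mul_vertex, Finset.sum_ite_eq, Finset.mem_filter, Finset.mem_univ,
    true_and]

open Classical in
theorem vertexSetSum_mul_arrow (S : Set V) (a : E) :
    vertexSetSum k Z S * MonAlg.arrow k Z a =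
      if Q.tgt a ∈ S then MonAlg.arrow k Z a else 0 :=
  vertexSetSum_mul_path S _

theorem isIdempotentElem_vertexSetSum (S : Set V) :
    IsIdempotentElem (vertexSetSum k Z S) := by
  classical
  change _ * vertexSetSum k Z S = _
  nth_rewrite 2 [vertexSetSum]
  rw [Finset.mul_sum]
  refine Finset.sum_congr rfl fun v hv => ?_
  exact (vertexSetSum_mul_path S (Qvr.Path.trivial Q v)).trans (if_pos (Finset.mem_filter.1 hv).2)

theorem vertexSetSum_mul_comm {S : Set V} (hS : ∀ a, Q.src a ∈ S ↔ Q.tgt a ∈ S)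
    (x : MonAlg k Q Z) : vertexSetSum k Z S * x = x * vertexSetSum k Z S := by
  classical
  have hp : ∀ p : Q.Path, p.target ∈ S ↔ p.start ∈ S := by
    rintro ⟨v, l, h⟩
    induction l generalizing v with
    | nil => exact Iff.rfl
    | cons a l ih =>
      obtain ⟨rfl, h'⟩ := h
      exact (ih _ h').trans (hS a).symm
  have h : LinearMap.mulLeft k (vertexSetSum k Z S) = LinearMap.mulRight k (vertexSetSum k Z S) :=
    MonAlg.linearMap_ext fun p => by
      rw [LinearMap.mulLeft_apply, LinearMap.mulRight_apply, vertexSetSum_mul_path,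
        path_mul_vertexSetSum]
      simp only [hp]
  exact DFunLike.congr_fun h x

theorem vertexSetSum_mem_center {S : Set V} (hS : ∀ a, Q.src a ∈ S ↔ Q.tgt a ∈ S) :
    vertexSetSum k Z S ∈ Subring.center (MonAlg k Q Z) :=
  Subring.mem_center_iff.2 fun x => (vertexSetSum_mul_comm hS x).symm

open Classical in
theorem vertexCoeff_vertexSetSum (hZ : ∀ z ∈ Z, 2 ≤ z.length) (S : Set V) (v : V) :
    vertexCoeff k hZ v (vertexSetSum k Z S) = if v ∈ S then 1 else 0 := by
  rw [vertexSetSum, map_sum]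
  simp only [vertexCoeff_vertex, Finset.sum_ite_eq', Finset.mem_filter, Finset.mem_univ, true_and]

/-- Functions on the vertices that are constant along arrows take the same value at arrows in the
same block. -/
theorem InSameBlock.eq_of_const (hZ : ∀ z ∈ Z, 2 ≤ z.length) {a b : E}
    (hab : InSameBlock (MonAlg.arrow k Z a) (MonAlg.arrow k Z b)) {T : Type*} {f : V → T}
    (hf : ∀ a, f (Q.src a) = f (Q.tgt a)) : f (Q.tgt a) = f (Q.tgt b) := by
  classical
  obtain ⟨c, ⟨hc, hci, -, hprim⟩, hca, hcb⟩ := hab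
  by_contra hne
  -- The level set of `f` through `t(a)` is closed along arrows in both directions, so its vertex
  -- sum is central. Its product with `c` is a central idempotent that fixes `a` and kills `b`,
  -- against the primitivity of `c`.
  let S : Set V := {v | f v = f (Q.tgt a)}
  have hS : ∀ a, Q.src a ∈ S ↔ Q.tgt a ∈ S := fun a => by
    change f _ = _ ↔ f _ = _
    rw [hf]
  have hcomm := vertexSetSum_mul_comm (k := k) (Z := Z) hS
  have hdc : c * vertexSetSum k Z S * c = c * vertexSetSum k Z S := by
    rw [mul_assoc, hcomm, ← mul_assoc, hci]
  have hdi : IsIdempotentElem (c * vertexSetSum k Z S) := by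
    change c * vertexSetSum k Z S * (c * vertexSetSum k Z S) = _
    rw [← mul_assoc, hdc, mul_assoc, isIdempotentElem_vertexSetSum]
  have hda : c * vertexSetSum k Z S * MonAlg.arrow k Z a = MonAlg.arrow k Z a := by
    rw [mul_assoc, vertexSetSum_mul_arrow, if_pos (show Q.tgt a ∈ S from rfl), hca]
  have hdb : c * vertexSetSum k Z S * MonAlg.arrow k Z b = 0 := by
    rw [mul_assoc, vertexSetSum_mul_arrow, if_neg (show ¬ Q.tgt b ∈ S from Ne.symm hne), mul_zero]
  obtain h | h := hprim _ (mul_mem hc (vertexSetSum_mem_center hS)) hdi hdc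
  · rw [h, zero_mul] at hda
    exact MonAlg.arrow_ne_zero hZ a hda.symm
  · rw [h, hcb] at hdb
    exact MonAlg.arrow_ne_zero hZ b hdb

/-- The vertices in the connected component of a vertex. -/
def component (Q : Qvr V E) (v : V) : Set V :=
  {w | Relation.EqvGen (fun u u' => ∃ a, Q.src a = u ∧ Q.tgt a = u') v w}

theorem src_mem_component_iff (v : V) (a : E) :
    Q.src a ∈ component Q v ↔ Q.tgt a ∈ component Q v :=
  ⟨fun h => h.trans _ _ _ (.rel _ _ ⟨a, rfl, rfl⟩),
    fun h => h.trans _ _ _ (.symm _ _ (.rel _ _ ⟨a, rfl, rfl⟩))⟩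

/-- The sum of the vertices of a connected component is a block idempotent. -/
theorem isBlockIdempotent_component (hZ : ∀ z ∈ Z, 2 ≤ z.length) (v : V) :
    IsBlockIdempotent (vertexSetSum k Z (component Q v)) := by
  classical
  have hS := src_mem_component_iff (Q := Q) v
  have hv : v ∈ component Q v := Relation.EqvGen.refl v
  refine ⟨vertexSetSum_mem_center hS, isIdempotentElem_vertexSetSum _, fun h => ?_,
    fun d hd hdi hdc => ?_⟩
  · have := vertexCoeff_vertexSetSum (k := k) hZ (component Q v) v
    rw [h, map_zero, if_pos hv] at this
    exact zero_ne_one this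
  -- The vertex coefficients of the central idempotent `d` are constant on the component, with value
  -- 0 or 1. So `d` or its complement in the component has no vertex part and vanishes.
  · have hconst : ∀ w w', Relation.EqvGen (fun u u' => ∃ a, Q.src a = u ∧ Q.tgt a = u') w w' →
        vertexCoeff k hZ w d = vertexCoeff k hZ w' d := by
      intro w w' h
      induction h with
      | rel w w' h =>
        obtain ⟨a, rfl, rfl⟩ := h
        exact (vertexCoeff_tgt_eq_src hZ (Subring.mem_center_iff.1 hd _).symm).symm
      | refl => rfl
      | symm _ _ _ ih => exact ih.symm
      | trans _ _ _ _ _ ih ih' => exact ih.trans ih'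
    have hout : ∀ w, w ∉ component Q v → vertexCoeff k hZ w d = 0 := by
      intro w hw
      rw [← hdc, map_mul, vertexCoeff_vertexSetSum, if_neg hw, mul_zero]
    have h01 : vertexCoeff k hZ v d = 0 ∨ vertexCoeff k hZ v d = 1 := by
      have : IsIdempotentElem (vertexCoeff k hZ v d) := by
        rw [IsIdempotentElem, ← map_mul, hdi]
      exact IsIdempotentElem.iff_eq_zero_or_one.1 this
    obtain h | h := h01
    · left
      refine eq_zero_of_isIdempotentElem hZ hdi fun w => ?_
      by_cases hw : w ∈ component Q v
      · rw [← hconst v w hw, h]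
      · exact hout w hw
    · right
      have hi : IsIdempotentElem (vertexSetSum k Z (component Q v) - d) := by
        have h₁ : vertexSetSum k Z (component Q v) * d = d := by
          rw [vertexSetSum_mul_comm hS, hdc]
        rw [IsIdempotentElem, sub_mul, mul_sub, mul_sub, isIdempotentElem_vertexSetSum, h₁, hdc,
          hdi]
        abel
      refine (sub_eq_zero.1 (eq_zero_of_isIdempotentElem hZ hi fun w => ?_)).symm
      rw [map_sub, vertexCoeff_vertexSetSum]
      by_cases hw : w ∈ component Q v
      · rw [← hconst v w hw, h, if_pos hw, sub_self]
      · rw [hout w hw, if_neg hw, sub_self]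

end Blocks

/-! ### When the derivation of the glued arrow is inner -/

section GluedBlocks

variable {k : Type*} [Field k] {V E : Type*} [Fintype V] [DecidableEq V] [Fintype E]
  [DecidableEq E] {Q : Qvr V E} {g : Q.GluePair} {Z : Set Q.Path}
  (hα : Q.IsSourceArrow g.α) (hβ : Q.IsSinkArrow g.β) (hZ : ∀ z ∈ Z, 2 ≤ z.length)

include hα hβ hZ

/-- If `α` and `β` lie in the same block, then the derivation `γ* ‖ γ*` is not inner. -/
theorem mk_gammaDer_ne_zero (h : InSameBlock (MonAlg.arrow k Z g.α) (MonAlg.arrow k Z g.β))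
    {D : Der k (GluedAlg k g Z)} (hD : Realizes k (g.relations Z) (gammaPar k g Z) D) :
    HH1.mk k (GluedAlg k g Z) D ≠ 0 := by
  classical
  intro h0
  have hn := g.nodup'
  have hZ' := g.two_le_length_of_mem_relations hZ
  obtain ⟨x, rfl⟩ := HH1.mk_eq_zero_iff.1 h0
  have hx : ∀ b, (adDer k x).1 (MonAlg.arrow k (g.relations Z) b) =
      if g.γ = b then MonAlg.arrow k (g.relations Z) g.γ else 0 := fun b => by
    rw [(realizes_iff.1 hD).2, gammaPar, evArrow_arrowPar hZ' b g.γ rfl rfl]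
    split_ifs <;> rfl
  -- Comparison of arrow coefficients: those of the vertices in `x` rise by one along γ* and are
  -- constant along every other arrow.
  have h₁ : vertexCoeff k hZ' g.f₂ x = vertexCoeff k hZ' g.f₁ x + 1 := by
    have h₂ := adDer_arrow_sub_mem hZ' x g.γ
    rw [hx, if_pos rfl] at h₂
    nth_rewrite 1 [← one_smul k (MonAlg.arrow k (g.relations Z) g.γ)] at h₂
    rw [← sub_smul] at h₂
    have h₃ := eq_zero_of_smul_arrow_mem hZ' h₂
    have h₄ : g.quiver.tgt g.γ = g.f₂ := g.mapV_tgt_α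
    have h₅ : g.quiver.src g.γ = g.f₁ := g.mapV_src_α
    rw [h₄, h₅] at h₃
    linear_combination -h₃
  have h₂ : ∀ b, b ≠ g.γ → vertexCoeff k hZ' (g.quiver.tgt b) x =
      vertexCoeff k hZ' (g.quiver.src b) x := fun b hb => by
    refine vertexCoeff_tgt_eq_src hZ' (sub_eq_zero.1 ?_)
    rw [← adDer_apply (k := k), hx, if_neg (Ne.symm hb)]
  -- Pulled back to `Q`, the coefficients jump along α and β. Giving e₁ the value of f₂ and eₙ the
  -- value of f₁ removes both jumps, as no other arrow meets these vertices; the values at `t(α)`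
  -- and `t(β)` then differ by one.
  have key := h.eq_of_const hZ (f := fun v => if v = Q.src g.α then vertexCoeff k hZ' g.f₂ x else
    if v = Q.tgt g.β then vertexCoeff k hZ' g.f₁ x else vertexCoeff k hZ' (g.mapV v) x) ?_
  · simp only [if_neg hn.1.1.symm, if_neg hn.2.1.2, if_neg hn.1.2.2.symm, if_true,
      g.mapV_tgt_α, h₁] at key
    simp at key
  · intro a
    by_cases haα : a = g.α
    · subst haα
      simp only [if_true, if_neg hn.1.1.symm, if_neg hn.2.1.2, g.mapV_tgt_α]
    · by_cases haβ : a = g.β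
      · subst haβ
        simp only [if_true, if_neg hn.1.2.1.symm, if_neg hn.2.2, if_neg hn.1.2.2.symm,
          g.mapV_src_β]
      · have h₃ := h₂ ⟨a, haβ⟩ fun h => haα (congrArg Subtype.val h)
        simp only [if_neg (mt (hα.2.1 a) haα), if_neg (hβ.1 a), if_neg (hα.1 a),
          if_neg (mt (hβ.2.2 a) haβ)]
        exact h₃.symm

/-- If `α` and `β` lie in different blocks, then the derivation `γ* ‖ γ*` is inner. -/
theorem mk_gammaDer_eq_zero (h : ¬ InSameBlock (MonAlg.arrow k Z g.α) (MonAlg.arrow k Z g.β))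
    {D : Der k (GluedAlg k g Z)} (hD : Realizes k (g.relations Z) (gammaPar k g Z) D) :
    HH1.mk k (GluedAlg k g Z) D = 0 := by
  classical
  have hn := g.nodup'
  let S := component Q (Q.src g.α)
  have hS := src_mem_component_iff (Q := Q) (Q.src g.α)
  have h₁ : Q.src g.α ∈ S := Relation.EqvGen.refl _
  have h₂ : Q.tgt g.α ∈ S := (hS _).1 h₁
  have h₄ : Q.tgt g.β ∉ S := fun h₄ => h
    ⟨_, isBlockIdempotent_component hZ (Q.src g.α), by rw [vertexSetSum_mul_arrow, if_pos h₂],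
      by rw [vertexSetSum_mul_arrow, if_pos h₄]⟩
  have h₃ : Q.src g.β ∉ S := fun h₃ => h₄ ((hS _).1 h₃)
  obtain ⟨D', hD', hι⟩ := exists_gammaDer (k := k) hα hβ hZ
  -- Adding the central vertex sum of the component of α to `eₙ - e₁` keeps the inner derivation and
  -- cancels e₁. What remains is `e₂ + eₙ` plus unglued vertices, an element of `B`, because eₙ₋₁
  -- and eₙ lie outside the component.
  obtain ⟨w, hw⟩ : vertexSetSum k Z S + (MonAlg.vertex k Z (Q.tgt g.β) -
      MonAlg.vertex k Z (Q.src g.α)) ∈ (embed k hα hβ hZ).range := by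
    have h₅ : vertexSetSum k Z S + (MonAlg.vertex k Z (Q.tgt g.β) -
        MonAlg.vertex k Z (Q.src g.α)) = vertexSum k g Z g.f₂ +
          ∑ v ∈ (({v : V | v ∈ S} : Finset V).erase (Q.src g.α)).erase (Q.tgt g.α),
            MonAlg.vertex k Z v := by
      rw [vertexSetSum, ← Finset.add_sum_erase _ _ (Finset.mem_filter.2 ⟨Finset.mem_univ _, h₁⟩),
        ← Finset.add_sum_erase (Finset.erase _ _) _ (Finset.mem_erase.2 ⟨hn.1.1.symm,
          Finset.mem_filter.2 ⟨Finset.mem_univ _, h₂⟩⟩), vertexSum_f₂]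
      abel
    rw [h₅]
    refine add_mem ⟨_, embed_vertex hα hβ hZ g.f₂⟩ (sum_mem fun v hv => ?_)
    simp only [Finset.mem_erase, Finset.mem_filter, Finset.mem_univ, true_and] at hv
    rw [← vertexSum_mapV (g := g) hv.2.1 hv.1 (fun h => h₃ (h ▸ hv.2.2))
      (fun h => h₄ (h ▸ hv.2.2))]
    exact ⟨_, embed_vertex hα hβ hZ _⟩
  change embed k hα hβ hZ w = _ at hw
  refine HH1.mk_eq_zero_iff.2 ⟨w, ?_⟩
  rw [hD.ext hD']
  refine Subtype.ext (LinearMap.ext fun x => ?_)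
  apply embed_injective hα hβ hZ
  rw [← hι, adDer_apply, adDer_apply, map_sub, map_mul, map_mul, hw, add_mul, mul_add,
    vertexSetSum_mul_comm hS]
  abel

end GluedBlocks

end GluingArrows

end

/-! ### The theorem -/

open GluingArrows

theorem theorem3 {k : Type*} [Field k] {V E : Type*} [Fintype V] [DecidableEq V] [Fintype E]
    [DecidableEq E] (Q : Qvr V E) (Z : Set Q.Path) (hZ : ∀ z ∈ Z, 2 ≤ z.length)
    [FiniteDimensional k (MonAlg k Q Z)] (g : Q.GluePair)
    (hα : Q.IsSourceArrow g.α) (hβ : Q.IsSinkArrow g.β) :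
    -- `B = k Q_B / I_B` is the subalgebra of `A` obtained by gluing `α` and `β`
    (∃ ι : GluedAlg k g Z →ₐ[k] MonAlg k Q Z, Function.Injective ι ∧
      (∀ f, ι (MonAlg.vertex k (g.relations Z) f) = vertexSum k g Z f) ∧
      (∀ b, ι (MonAlg.arrow k (g.relations Z) b) = arrowSum k g Z b) ∧
      ι.range = gluedSubalgebra k g Z) ∧
    -- the sum that defines `Y` is direct, and `Y / Im δ⁰_B` is a subspace of `HH¹(B)`
    Disjoint (psiIm k g Z) (Zsp k g Z) ∧
    imB k g Z ≤ Ysub k g Z ∧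
    (∀ y ∈ Ysub k g Z, ∃ D : Der k (GluedAlg k g Z), Realizes k (g.relations Z) y D) ∧
    (∀ y ∈ Ysub k g Z, ∀ D : Der k (GluedAlg k g Z), Realizes k (g.relations Z) y D →
      (HH1.mk k (GluedAlg k g Z) D = 0 ↔ y ∈ imB k g Z)) ∧
    -- `I = Y / Im δ⁰_B` is a Lie ideal of `HH¹(B)` and `HH¹(A) ≃ HH¹(B) / I`
    ∃ I : LieIdeal k (HH1 k (GluedAlg k g Z)),
      (∀ x, x ∈ I ↔ ∃ y ∈ Ysub k g Z, ∃ D : Der k (GluedAlg k g Z),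
        Realizes k (g.relations Z) y D ∧ HH1.mk k (GluedAlg k g Z) D = x) ∧
      Nonempty (HH1 k (MonAlg k Q Z) ≃ₗ⁅k⁆ (HH1 k (GluedAlg k g Z) ⧸ I)) ∧
      -- the same block
      (InSameBlock (MonAlg.arrow k Z g.α) (MonAlg.arrow k Z g.β) →
        Module.finrank k I = 1 ∧
        ∃ D : Der k (GluedAlg k g Z), Realizes k (g.relations Z) (gammaPar k g Z) D ∧
          LieSubmodule.toSubmodule I =
            Submodule.span k {HH1.mk k (GluedAlg k g Z) D}) ∧
      -- different blocks
      (¬ InSameBlock (MonAlg.arrow k Z g.α) (MonAlg.arrow k Z g.β) →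
        I = ⊥ ∧ Nonempty (HH1 k (MonAlg k Q Z) ≃ₗ⁅k⁆ HH1 k (GluedAlg k g Z))) := by
  obtain ⟨Dγ, hDγ, -⟩ := exists_gammaDer (k := k) hα hβ hZ
  -- The ideal is taken to be the span of the central class of `γ* ‖ γ*`; this identifies it with
  -- the classes coming from `Y`.
  have hI : ∀ x, x ∈ centralIdeal (k := k) (HH1.mk k (GluedAlg k g Z) Dγ)
      (lie_mk_gammaDer hα hβ hZ hDγ) ↔ ∃ y ∈ Ysub k g Z, ∃ D : Der k (GluedAlg k g Z),
        Realizes k (g.relations Z) y D ∧ HH1.mk k (GluedAlg k g Z) D = x := fun x => by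
    rw [mem_centralIdeal]
    constructor
    · rintro ⟨c, rfl⟩
      exact ⟨_, Submodule.smul_mem _ c (gammaPar_mem_Ysub hα hβ hZ), _, hDγ.smul c, map_smul _ _ _⟩
    · rintro ⟨y, hy, D, hD, rfl⟩
      obtain ⟨D', c, hD', hc⟩ := exists_realizes_of_mem_Ysub hα hβ hZ hy hDγ
      exact ⟨c, by rw [hD.ext hD', hc]⟩
  -- A pair dies in `HH¹(A)` exactly when its restriction dies in `HH¹(B)/I`; with both
  -- surjectivities this gives the isomorphism.
  have hker : ∀ p, restrictPairsFst (k := k) hα hβ hZ p = 0 ↔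
      restrictPairsSnd hα hβ hZ p ∈ centralIdeal (k := k) (HH1.mk k (GluedAlg k g Z) Dγ)
        (lie_mk_gammaDer hα hβ hZ hDγ) := fun p => by
    rw [hI]
    exact mk_eq_zero_iff_of_restrict hα hβ hZ p.2.2.2.2 p.2.1 p.2.2.1 p.2.2.2.1
  have hsurj : ∀ x, ∃ p, x - restrictPairsSnd hα hβ hZ p ∈
      centralIdeal (k := k) (HH1.mk k (GluedAlg k g Z) Dγ) (lie_mk_gammaDer hα hβ hZ hDγ) :=
    fun x => by
      obtain ⟨p, y, hy, D, hD, h⟩ := exists_sub_restrictPairsSnd hα hβ hZ x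
      exact ⟨p, (hI _).2 ⟨y, hy, D, hD, h⟩⟩
  refine ⟨⟨embed k hα hβ hZ, embed_injective hα hβ hZ, embed_vertex hα hβ hZ,
    embed_arrow hα hβ hZ, range_embed hα hβ hZ⟩,
    (disjoint_range_psi1_Zsp hα hβ hZ).mono_left LinearMap.map_le_range,
    imB_le_Ysub hα hβ hZ, fun y hy => ?_,
    fun y _ D hD => hD.mk_eq_zero_iff (g.two_le_length_of_mem_relations hZ),
    centralIdeal (HH1.mk k (GluedAlg k g Z) Dγ) (lie_mk_gammaDer hα hβ hZ hDγ), hI, ?_,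
    fun h => ⟨?_, Dγ, hDγ, rfl⟩, fun h => ?_⟩
  · obtain ⟨D, _, hD, _⟩ := exists_realizes_of_mem_Ysub hα hβ hZ hy hDγ
    exact ⟨D, hD⟩
  · let q : HH1 k (GluedAlg k g Z) →ₗ⁅k⁆ HH1 k (GluedAlg k g Z) ⧸
        centralIdeal (k := k) (HH1.mk k (GluedAlg k g Z) Dγ) (lie_mk_gammaDer hα hβ hZ hDγ) :=
      { (LieSubmodule.Quotient.mk' (centralIdeal (k := k) (HH1.mk k (GluedAlg k g Z) Dγ)
          (lie_mk_gammaDer hα hβ hZ hDγ)) : HH1 k (GluedAlg k g Z) →ₗ[k] _) with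
        map_lie' := rfl }
    have hq : ∀ x, q x = 0 ↔ x ∈ centralIdeal (k := k) (HH1.mk k (GluedAlg k g Z) Dγ)
        (lie_mk_gammaDer hα hβ hZ hDγ) := fun x => LieSubmodule.Quotient.mk_eq_zero _
    refine nonempty_lieEquiv_of_ker_eq (restrictPairsFst hα hβ hZ)
      (q.comp (restrictPairsSnd hα hβ hZ)) (restrictPairsFst_surjective hα hβ hZ) (fun x => ?_)
      (fun p => (hker p).trans (hq _).symm)
    obtain ⟨x, rfl⟩ := Submodule.Quotient.mk_surjective _ x
    obtain ⟨p, hp⟩ := hsurj x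
    refine ⟨p, ?_⟩
    have := (hq _).2 hp
    rw [map_sub, sub_eq_zero] at this
    exact this.symm
  · exact finrank_span_singleton (mk_gammaDer_ne_zero hα hβ hZ h hDγ)
  · have h0 := mk_gammaDer_eq_zero hα hβ hZ h hDγ
    have hbot : ∀ x, x ∈ centralIdeal (k := k) (HH1.mk k (GluedAlg k g Z) Dγ)
        (lie_mk_gammaDer hα hβ hZ hDγ) ↔ x = 0 := fun x => by
      rw [mem_centralIdeal, h0]
      simp [eq_comm]
    refine ⟨(LieSubmodule.eq_bot_iff _).2 fun x hx => (hbot x).1 hx, ?_⟩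
    refine nonempty_lieEquiv_of_ker_eq (restrictPairsFst hα hβ hZ) (restrictPairsSnd hα hβ hZ)
      (restrictPairsFst_surjective hα hβ hZ) (fun x => ?_) fun p => (hker p).trans (hbot _)
    obtain ⟨p, hp⟩ := hsurj x
    exact ⟨p, (sub_eq_zero.1 ((hbot _).1 hp)).symm⟩
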